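/- Fix an integer $k\ge 1$ and put $t=e^{\pi i/(2k+4)}$, $q=t^2$, $[i]=\dfrac{q^i-q^{-i}}{q-q^{-1}}$ and $\delta=-q-q^{-1}$. Let $\mathcal D$ be the strict monoidal category with objects $0,1,2,\dots$ whose morphisms $m\to n$ are the planar diagrams with $m$ dots on the bottom and $n$ dots on the top (each dot joined to exactly one line, lines non-crossing, finitely many closed loops allowed) up to isotopy; composition is vertical stacking, read upwards, and $\otimes$ is horizontal juxtaposition. Let $\cup:0\to 2$ and $\cap:2\to 0$ be the cup and the cap. Let $\mathrm{TL}$ be the additive and idempotent completion of the quotient of the $\mathbb C$-linearization of $\mathcal D$ by the relation that every loop equals $\delta$. In $\mathrm{TL}$ define the Jones–Wenzl idempotents $f_i:i\to i$ for $0\le i\le k+1$ by $f_0=1_0$, $f_1=1_1$ and $$f_i=f_{i-1}\otimes 1_1+\frac{[i-1]}{[i]}\,(f_{i-1}\otimes 1_1)\circ(1_{i-2}\otimes(\cup\circ\cap))\circ(f_{i-1}\otimes 1_1)\qquad(2\le i\le k+1),$$ and let $F_i=(i,f_i)$ be the corresponding objects. Let $\widetilde{\mathrm{TL}}=\mathrm{TL}/(F_{k+1})$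 be the quotient by the tensor ideal of morphisms generated by the identity of $F_{k+1}$. Equip $\widetilde{\mathrm{TL}}$ with the braiding $\sigma$ determined, through naturality and the hexagon axioms, by $\sigma_{1,1}=t\,1_{1\otimes 1}+t^{-1}\,\cup\circ\cap$. For $0\le j\le k+1$ the object $F_j$ is self-dual with evaluation $e_j=\cap^{(j)}\circ(f_j\otimes f_j):F_j\otimes F_j\to\mathbb 1$ and coevaluation $c_j=(f_j\otimes f_j)\circ\cup^{(j)}:\mathbb 1\to F_j\otimes F_j$, where $\cap^{(j)}:2j\to 0$ and $\cup^{(j)}:0\to 2j$ denote $j$ nested caps and $j$ nested cups; the pivotal structure is the identity $F_j\to F_j^{\vee\vee}=F_j$. The left and right twists of $F_j$ are $$\theta^{\ell}_{F_j}=(e_j\otimes 1_{F_j})\circ(1_{F_j}\otimes\sigma_{F_j,F_j})\circ(c_j\otimes 1_{F_j}),\qquad \theta^{r}_{F_j}=(1_{F_j}\otimes e_j)\circ(\sigma_{F_j,F_j}\otimes 1_{F_j})\circ(1_{F_j}\otimes c_j).$$ Then for every $0\le j\le k+1$, in $\widetilde{\mathrm{TL}}$, $$\theta^{\ell}_{F_j}=\theta^{r}_{F_j}=(-1)^j\,t^{\,j^2+2j}\,1_{F_j}.$$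 -/

import Mathlib

open CategoryTheory MonoidalCategory

namespace TLJ

noncomputable section

section Linearization
set_option linter.unusedSectionVars false
set_option linter.unusedVariables false
universe v u

/-- The bilinear extension of a binary operation on basis elements. -/
def bilin {A B D : Type*} (op : A → B → D) : (A →₀ ℂ) →ₗ[ℂ] (B →₀ ℂ) →ₗ[ℂ] (D →₀ ℂ) :=
  Finsupp.lsum ℂ fun a => LinearMap.toSpanSingleton ℂ _ (Finsupp.lmapDomain ℂ ℂ (op a))

theorem bilin_single {A B D : Type*} (op : A → B → D) (a : A) (b : B) (r s : ℂ) :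
    bilin op (Finsupp.single a r) (Finsupp.single b s) = Finsupp.single (op a b) (r * s) := by
  simp [bilin, Finsupp.mapDomain_single]

theorem bilin_assoc {A B D E F G : Type*} (op₁ : A → B → E) (op₂ : E → D → G) (op₃ : B → D → F)
    (op₄ : A → F → G) (H : ∀ a b d, op₂ (op₁ a b) d = op₄ a (op₃ b d))
    (f : A →₀ ℂ) (g : B →₀ ℂ) (h : D →₀ ℂ) :
    bilin op₂ (bilin op₁ f g) h = bilin op₄ f (bilin op₃ g h) := by
  induction f using Finsupp.induction_linear with
  | zero => simp
  | add f f' e e' => simp [e, e']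
  | single a r =>
    induction g using Finsupp.induction_linear with
    | zero => simp
    | add f f' e e' => simp [e, e']
    | single b s =>
      induction h using Finsupp.induction_linear with
      | zero => simp
      | add f f' e e' => simp [e, e']
      | single d t => simp only [bilin_single, H, mul_assoc]

theorem bilin_interchange {A B A' B' E F E' F' G : Type*} (c₁ : A → B → E) (c₂ : A' → B' → F)
    (t₁ : A → A' → E') (t₂ : B → B' → F') (t₃ : E → F → G) (c₃ : E' → F' → G)
    (H : ∀ a a' b b', c₃ (t₁ a a') (t₂ b b') = t₃ (c₁ a b) (c₂ a' b'))
    (f : A →₀ ℂ) (f' : A' →₀ ℂ) (g : B →₀ ℂ) (g' : B' →₀ ℂ) :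
    bilin c₃ (bilin t₁ f f') (bilin t₂ g g') = bilin t₃ (bilin c₁ f g) (bilin c₂ f' g') := by
  induction f using Finsupp.induction_linear with
  | zero => simp
  | add f f' e e' => simp [e, e']
  | single a r =>
    induction f' using Finsupp.induction_linear with
    | zero => simp
    | add f f' e e' => simp [e, e']
    | single b s =>
      induction g using Finsupp.induction_linear with
      | zero => simp
      | add f f' e e' => simp [e, e']
      | single d t =>
        induction g' using Finsupp.induction_linear with
        | zero => simp
        | add f f' e e' => simp [e, e']
        | single d t => simp only [bilin_single, H]; congr 1; ring

theorem bilin_unit_left {A B D : Type*} (op : A → B → D) (a : A) (φ : B → D)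
    (H : ∀ b, op a b = φ b) (g : B →₀ ℂ) :
    bilin op (Finsupp.single a 1) g = Finsupp.mapDomain φ g := by
  have : op a = φ := funext H
  simp [bilin, this]

theorem bilin_unit_right {A B D : Type*} (op : A → B → D) (b : B) (φ : A → D)
    (H : ∀ a, op a b = φ a) (f : A →₀ ℂ) :
    bilin op f (Finsupp.single b 1) = Finsupp.mapDomain φ f := by
  induction f using Finsupp.induction_linear with
  | zero => simp
  | add f f' e e' => simp [e, e', Finsupp.mapDomain_add]
  | single a r => rw [bilin_single, Finsupp.mapDomain_single, H, mul_one]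

/-- The `ℂ`-linearization of a category: the same objects, and morphism spaces with basis the
original morphisms. -/
structure Linearization (C : Type u) where
  /-- the underlying object -/
  base : C

namespace Linearization
variable {C : Type u} [Category.{v} C]

instance : Category (Linearization C) where
  Hom X Y := (X.base ⟶ Y.base) →₀ ℂ
  id X := Finsupp.single (𝟙 X.base) 1
  comp f g := bilin (fun a b => a ≫ b) f g
  id_comp f := (bilin_unit_left _ _ id (fun b => Category.id_comp b) f).trans Finsupp.mapDomain_id
  comp_id f := (bilin_unit_right _ _ id (fun b => Category.comp_id b) f).trans Finsupp.mapDomain_id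
  assoc f g h := bilin_assoc _ _ _ _ (fun a b c => Category.assoc a b c) f g h

/-- The basis morphism given by a morphism of the original category. -/
def ι {X Y : C} (f : X ⟶ Y) : (⟨X⟩ : Linearization C) ⟶ ⟨Y⟩ := Finsupp.single f 1

theorem ι_comp {X Y Z : C} (f : X ⟶ Y) (g : Y ⟶ Z) : ι (f ≫ g) = ι f ≫ ι g :=
  ((bilin_single _ f g 1 1).trans (by rw [one_mul]; rfl)).symm

theorem ι_id (X : C) : ι (𝟙 X) = 𝟙 (⟨X⟩ : Linearization C) := rfl

instance : Preadditive (Linearization C) where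
  homGroup X Y := inferInstanceAs (AddCommGroup ((X.base ⟶ Y.base) →₀ ℂ))
  add_comp X Y Z f f' g := LinearMap.map_add₂ (bilin fun a b => a ≫ b) f f' g
  comp_add X Y Z f g g' :=
    (bilin (fun (a : X.base ⟶ Y.base) (b : Y.base ⟶ Z.base) => a ≫ b) f).map_add' g g'

instance : Linear ℂ (Linearization C) where
  homModule X Y := inferInstanceAs (Module ℂ ((X.base ⟶ Y.base) →₀ ℂ))
  smul_comp X Y Z r f g := LinearMap.map_smul₂ (bilin fun a b => a ≫ b) r f g
  comp_smul X Y Z f r g :=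
    (bilin (fun (a : X.base ⟶ Y.base) (b : Y.base ⟶ Z.base) => a ≫ b) f).map_smul' r g

variable [MonoidalCategory C]

/-- An isomorphism of the original category as an isomorphism of the linearization. -/
def ιIso {X Y : C} (e : X ≅ Y) : (⟨X⟩ : Linearization C) ≅ ⟨Y⟩ where
  hom := ι e.hom
  inv := ι e.inv
  hom_inv_id := by rw [← ι_comp, e.hom_inv_id, ι_id]
  inv_hom_id := by rw [← ι_comp, e.inv_hom_id, ι_id]

instance : MonoidalCategoryStruct (Linearization C) where
  tensorObj X Y := ⟨X.base ⊗ Y.base⟩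
  tensorHom f g := bilin (fun a b => a ⊗ₘ b) f g
  whiskerLeft X _ _ f := bilin (fun a b => a ⊗ₘ b) (Finsupp.single (𝟙 X.base) 1) f
  whiskerRight f X := bilin (fun a b => a ⊗ₘ b) f (Finsupp.single (𝟙 X.base) 1)
  tensorUnit := ⟨𝟙_ C⟩
  associator X Y Z := ιIso (α_ X.base Y.base Z.base)
  leftUnitor X := ιIso (λ_ X.base)
  rightUnitor X := ιIso (ρ_ X.base)

theorem ι_tensor {X Y X' Y' : C} (f : X ⟶ Y) (g : X' ⟶ Y') : ι (f ⊗ₘ g) = ι f ⊗ₘ ι g :=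
  ((bilin_single _ f g 1 1).trans (by rw [one_mul]; rfl)).symm

theorem ι_wl (Z : C) {X Y : C} (f : X ⟶ Y) : ι (Z ◁ f) = (⟨Z⟩ : Linearization C) ◁ ι f := by
  rw [← id_tensorHom, ι_tensor]; rfl

theorem ι_wr (Z : C) {X Y : C} (f : X ⟶ Y) : ι (f ▷ Z) = ι f ▷ (⟨Z⟩ : Linearization C) := by
  rw [← tensorHom_id, ι_tensor]; rfl

instance : MonoidalCategory (Linearization C) := MonoidalCategory.ofTensorHom
  (id_tensorHom_id := fun X Y => by rw [← ι_id, ← ι_id, ← ι_tensor, id_tensorHom_id]; rfl)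
  (id_tensorHom := fun _ _ _ _ => rfl)
  (tensorHom_id := fun _ _ => rfl)
  (tensorHom_comp_tensorHom := fun f₁ f₂ g₁ g₂ =>
    bilin_interchange _ _ _ _ _ _ (fun a a' b b' => tensorHom_comp_tensorHom a a' b b') f₁ f₂ g₁ g₂)
  (associator_naturality := fun {X₁ X₂ X₃ Y₁ Y₂ Y₃} f₁ f₂ f₃ => by
    change bilin (fun a b => a ≫ b) (bilin (fun a b => a ⊗ₘ b) (bilin (fun a b => a ⊗ₘ b) f₁ f₂) f₃)
      (Finsupp.single (α_ Y₁.base Y₂.base Y₃.base).hom 1) =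
      bilin (fun a b => a ≫ b) (Finsupp.single (α_ X₁.base X₂.base X₃.base).hom 1)
        (bilin (fun a b => a ⊗ₘ b) f₁ (bilin (fun a b => a ⊗ₘ b) f₂ f₃))
    induction f₁ using Finsupp.induction_linear with
    | zero => simp
    | add f f' e e' => simp [e, e']
    | single a r =>
      induction f₂ using Finsupp.induction_linear with
      | zero => simp
      | add f f' e e' => simp [e, e']
      | single b s =>
        induction f₃ using Finsupp.induction_linear with
        | zero => simp
        | add f f' e e' => simp [e, e']
        | single d t =>
          simp only [bilin_single, MonoidalCategory.associator_naturality, mul_one, one_mul,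
            mul_assoc])
  (leftUnitor_naturality := fun {X Y} f => by
    change bilin (fun a b => a ≫ b) (bilin (fun a b => a ⊗ₘ b) (Finsupp.single (𝟙 _) 1) f)
      (Finsupp.single (λ_ Y.base).hom 1) = bilin (fun a b => a ≫ b)
        (Finsupp.single (λ_ X.base).hom 1) f
    induction f using Finsupp.induction_linear with
    | zero => simp
    | add f f' e e' => simp [e, e']
    | single a r =>
      simp only [bilin_single, id_tensorHom, MonoidalCategory.leftUnitor_naturality, mul_one,
        one_mul])
  (rightUnitor_naturality := fun {X Y} f => by
    change bilin (fun a b => a ≫ b) (bilin (fun a b => a ⊗ₘ b) f (Finsupp.single (𝟙 _) 1))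
      (Finsupp.single (ρ_ Y.base).hom 1) = bilin (fun a b => a ≫ b)
        (Finsupp.single (ρ_ X.base).hom 1) f
    induction f using Finsupp.induction_linear with
    | zero => simp
    | add f f' e e' => simp [e, e']
    | single a r =>
      simp only [bilin_single, tensorHom_id, MonoidalCategory.rightUnitor_naturality, mul_one,
        one_mul])
  (pentagon := fun W X Y Z => by
    have h := congrArg ι (pentagon W.base X.base Y.base Z.base)
    simp only [ι_comp, ι_wl, ι_wr] at h
    exact h)
  (triangle := fun X Y => by
    have h := congrArg ι (triangle X.base Y.base)
    simp only [ι_comp, ι_wl, ι_wr] at h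
    exact h)

instance : MonoidalPreadditive (Linearization C) where
  whiskerLeft_zero {X Y Z} := map_zero (bilin (fun a b => a ⊗ₘ b) (Finsupp.single (𝟙 X.base) 1))
  zero_whiskerRight {X Y Z} := LinearMap.map_zero₂ (bilin (fun a b => a ⊗ₘ b)) _
  whiskerLeft_add {X Y Z} f g :=
    map_add (bilin (fun a b => a ⊗ₘ b) (Finsupp.single (𝟙 X.base) 1)) f g
  add_whiskerRight {X Y Z} f g := LinearMap.map_add₂ (bilin (fun a b => a ⊗ₘ b)) f g _

instance : MonoidalLinear ℂ (Linearization C) where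
  whiskerLeft_smul X _ _ c f :=
    map_smul (bilin (fun a b => a ⊗ₘ b) (Finsupp.single (𝟙 X.base) 1)) c f
  smul_whiskerRight c _ _ f X := LinearMap.map_smul₂ (bilin (fun a b => a ⊗ₘ b)) c f _

/-- Every morphism of the linearization is a linear combination of basis morphisms. -/
theorem hom_induction {X Y : C} {P : ((⟨X⟩ : Linearization C) ⟶ ⟨Y⟩) → Prop}
    (f : (⟨X⟩ : Linearization C) ⟶ ⟨Y⟩) (h0 : P 0) (ha : ∀ f g, P f → P g → P (f + g))
    (hs : ∀ (r : ℂ) (f : X ⟶ Y), P (r • ι f)) : P f :=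
  Finsupp.induction_linear (motive := P) f h0 ha (fun a r => by
    have : (Finsupp.single a r : (X ⟶ Y) →₀ ℂ) = r • Finsupp.single a (1 : ℂ) := by simp
    rw [this]; exact hs r a)

end Linearization
end Linearization

section TensorQuotient
set_option linter.unusedSectionVars false
universe v u
variable {C : Type u} [Category.{v} C] [Preadditive C] [Linear ℂ C] [MonoidalCategory C]

/-- The tensor ideal of a `ℂ`-linear monoidal category generated by one morphism `g`: the smallest
family of linear subspaces of the morphism spaces that contains `g` and is stable under
composition and under tensoring with objects (hence with arbitrary morphisms) on both sides. -/
inductive TensorIdeal {A B : C} (g : A ⟶ B) : ∀ {X Y : C}, (X ⟶ Y) → Prop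
  | of : TensorIdeal g g
  | zero (X Y : C) : TensorIdeal g (0 : X ⟶ Y)
  | add {X Y : C} {f h : X ⟶ Y} : TensorIdeal g f → TensorIdeal g h → TensorIdeal g (f + h)
  | smul {X Y : C} (c : ℂ) {f : X ⟶ Y} : TensorIdeal g f → TensorIdeal g (c • f)
  | comp_left {X Y Z : C} (h : X ⟶ Y) {f : Y ⟶ Z} : TensorIdeal g f → TensorIdeal g (h ≫ f)
  | comp_right {X Y Z : C} {f : X ⟶ Y} (h : Y ⟶ Z) : TensorIdeal g f → TensorIdeal g (f ≫ h)
  | whisker_left (Z : C) {X Y : C} {f : X ⟶ Y} : TensorIdeal g f → TensorIdeal g (Z ◁ f)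
  | whisker_right {X Y : C} {f : X ⟶ Y} (Z : C) : TensorIdeal g f → TensorIdeal g (f ▷ Z)

/-- Congruence of morphisms modulo the tensor ideal generated by `g`. -/
def idealRel {A B : C} (g : A ⟶ B) : HomRel C := fun _ _ f h => TensorIdeal g (f - h)

variable {A B : C} (g : A ⟶ B)

theorem TensorIdeal.neg {X Y : C} {f : X ⟶ Y} (hf : TensorIdeal g f) : TensorIdeal g (-f) := by
  have h := TensorIdeal.smul (-1) hf
  rwa [neg_one_smul] at h

instance : Congruence (idealRel g) where
  equivalence :=
    { refl := fun f => by
        change TensorIdeal g (f - f); rw [sub_self]; exact .zero _ _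
      symm := fun {f h} hfh => by
        change TensorIdeal g (h - f); rw [← neg_sub]; exact TensorIdeal.neg g hfh
      trans := fun {a b c} h1 h2 => by
        change TensorIdeal g (a - c); rw [← sub_add_sub_cancel a b c]; exact .add h1 h2 }
  comp_left f _ _ h := by
    change TensorIdeal g _; rw [← Preadditive.comp_sub]; exact .comp_left f h
  comp_right f h := by
    change TensorIdeal g _; rw [← Preadditive.sub_comp]; exact .comp_right f h

/-- The quotient of a `ℂ`-linear monoidal category by the tensor ideal generated by `g`. -/
abbrev TensorQuotient : Type u := Quotient (idealRel g)

theorem idealRel_add ⦃X Y : C⦄ (f₁ f₂ g₁ g₂ : X ⟶ Y) (hf : idealRel g f₁ f₂)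
    (hg : idealRel g g₁ g₂) : idealRel g (f₁ + g₁) (f₂ + g₂) := by
  change TensorIdeal g _; rw [add_sub_add_comm]; exact .add hf hg

theorem idealRel_smul (a : ℂ) ⦃X Y : C⦄ (f₁ f₂ : X ⟶ Y) (hf : idealRel g f₁ f₂) :
    idealRel g (a • f₁) (a • f₂) := by
  change TensorIdeal g _; rw [← smul_sub]; exact .smul a hf

instance : Preadditive (TensorQuotient g) := Quotient.preadditive _ (idealRel_add g)

instance : (Quotient.functor (idealRel g)).Additive :=
  Quotient.functor_additive _ (idealRel_add g)

instance : Linear ℂ (TensorQuotient g) := Quotient.linear ℂ _ (idealRel_smul g)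

variable [MonoidalPreadditive C] [MonoidalLinear ℂ C]

theorem sub_wr {X Y : C} (f h : X ⟶ Y) (Z : C) : f ▷ Z - h ▷ Z = (f - h) ▷ Z := by
  rw [eq_comm, eq_sub_iff_add_eq, ← MonoidalPreadditive.add_whiskerRight, sub_add_cancel]

theorem wl_sub {X Y : C} (f h : X ⟶ Y) (Z : C) : Z ◁ f - Z ◁ h = Z ◁ (f - h) := by
  rw [eq_comm, eq_sub_iff_add_eq, ← MonoidalPreadditive.whiskerLeft_add, sub_add_cancel]

theorem idealRel_wl (Z : C) {X Y : C} {f h : X ⟶ Y} (H : idealRel g f h) :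
    idealRel g (Z ◁ f) (Z ◁ h) := by
  change TensorIdeal g _; rw [wl_sub]; exact .whisker_left Z H

theorem idealRel_wr {X Y : C} {f h : X ⟶ Y} (H : idealRel g f h) (Z : C) :
    idealRel g (f ▷ Z) (h ▷ Z) := by
  change TensorIdeal g _; rw [sub_wr]; exact .whisker_right Z H

/-- The functor to the quotient. -/
abbrev toQuot : C ⥤ TensorQuotient g := Quotient.functor (idealRel g)

theorem toQuot_eq {X Y : C} {f h : X ⟶ Y} (H : idealRel g f h) :
    (toQuot g).map f = (toQuot g).map h := CategoryTheory.Quotient.sound _ H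

theorem toQuot_surj {X Y : TensorQuotient g} (f : X ⟶ Y) :
    ∃ f' : X.as ⟶ Y.as, (toQuot g).map f' = f := (toQuot g).map_surjective f

instance : MonoidalCategoryStruct (TensorQuotient g) where
  tensorObj X Y := ⟨X.as ⊗ Y.as⟩
  whiskerLeft X _ _ f := Quot.liftOn f (fun f => (toQuot g).map (X.as ◁ f)) (fun _ _ h => by
    rw [HomRel.compClosure_iff_self] at h
    exact toQuot_eq g (idealRel_wl g _ h))
  whiskerRight f Y := Quot.liftOn f (fun f => (toQuot g).map (f ▷ Y.as)) (fun _ _ h => by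
    rw [HomRel.compClosure_iff_self] at h
    exact toQuot_eq g (idealRel_wr g h _))
  tensorUnit := ⟨𝟙_ C⟩
  associator X Y Z := (toQuot g).mapIso (α_ X.as Y.as Z.as)
  leftUnitor X := (toQuot g).mapIso (λ_ X.as)
  rightUnitor X := (toQuot g).mapIso (ρ_ X.as)

theorem toQuot_wl (Z : C) {X Y : C} (f : X ⟶ Y) :
    (toQuot g).obj Z ◁ (toQuot g).map f = (toQuot g).map (Z ◁ f) := rfl

theorem toQuot_wr {X Y : C} (f : X ⟶ Y) (Z : C) :
    (toQuot g).map f ▷ (toQuot g).obj Z = (toQuot g).map (f ▷ Z) := rfl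

theorem toQuot_tensor {X Y X' Y' : C} (f : X ⟶ Y) (f' : X' ⟶ Y') :
    (toQuot g).map f ⊗ₘ (toQuot g).map f' = (toQuot g).map (f ⊗ₘ f') := by
  rw [MonoidalCategory.tensorHom_def f f', Functor.map_comp]; rfl

instance : MonoidalCategory (TensorQuotient g) where
  tensorHom_def _ _ := rfl
  id_tensorHom_id := by
    rintro ⟨X⟩ ⟨Y⟩
    exact (toQuot_tensor g (𝟙 X) (𝟙 Y)).trans (congrArg (toQuot g).map (id_tensorHom_id X Y))
  tensorHom_comp_tensorHom := by
    rintro ⟨X₁⟩ ⟨Y₁⟩ ⟨Z₁⟩ ⟨X₂⟩ ⟨Y₂⟩ ⟨Z₂⟩ ⟨f₁⟩ ⟨f₂⟩ ⟨g₁⟩ ⟨g₂⟩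
    have h := congrArg (toQuot g).map (tensorHom_comp_tensorHom f₁ f₂ g₁ g₂)
    rw [Functor.map_comp, ← toQuot_tensor, ← toQuot_tensor, ← toQuot_tensor] at h
    exact h
  whiskerLeft_id := by
    rintro ⟨X⟩ ⟨Y⟩
    exact congrArg (toQuot g).map (whiskerLeft_id X Y)
  id_whiskerRight := by
    rintro ⟨X⟩ ⟨Y⟩
    exact congrArg (toQuot g).map (id_whiskerRight X Y)
  associator_naturality := by
    rintro ⟨X₁⟩ ⟨X₂⟩ ⟨X₃⟩ ⟨Y₁⟩ ⟨Y₂⟩ ⟨Y₃⟩ ⟨f₁⟩ ⟨f₂⟩ ⟨f₃⟩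
    have h := congrArg (toQuot g).map (associator_naturality f₁ f₂ f₃)
    rw [Functor.map_comp, Functor.map_comp, ← toQuot_tensor, ← toQuot_tensor, ← toQuot_tensor,
      ← toQuot_tensor] at h
    exact h
  leftUnitor_naturality := by
    rintro ⟨X⟩ ⟨Y⟩ ⟨f⟩
    exact congrArg (toQuot g).map (leftUnitor_naturality f)
  rightUnitor_naturality := by
    rintro ⟨X⟩ ⟨Y⟩ ⟨f⟩
    exact congrArg (toQuot g).map (rightUnitor_naturality f)
  pentagon := by
    rintro ⟨W⟩ ⟨X⟩ ⟨Y⟩ ⟨Z⟩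
    exact congrArg (toQuot g).map (pentagon W X Y Z)
  triangle := by
    rintro ⟨X⟩ ⟨Y⟩
    exact congrArg (toQuot g).map (triangle X Y)

instance : MonoidalPreadditive (TensorQuotient g) where
  whiskerLeft_zero := by
    rintro ⟨X⟩ ⟨Y⟩ ⟨Z⟩
    exact congrArg (toQuot g).map (MonoidalPreadditive.whiskerLeft_zero (X := X) (Y := Y) (Z := Z))
  zero_whiskerRight := by
    rintro ⟨X⟩ ⟨Y⟩ ⟨Z⟩
    exact congrArg (toQuot g).map (MonoidalPreadditive.zero_whiskerRight (X := X) (Y := Y) (Z := Z))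
  whiskerLeft_add := by
    rintro ⟨X⟩ ⟨Y⟩ ⟨Z⟩ ⟨f⟩ ⟨h⟩
    exact congrArg (toQuot g).map (MonoidalPreadditive.whiskerLeft_add (X := X) f h)
  add_whiskerRight := by
    rintro ⟨X⟩ ⟨Y⟩ ⟨Z⟩ ⟨f⟩ ⟨h⟩
    exact congrArg (toQuot g).map (MonoidalPreadditive.add_whiskerRight (X := X) f h)

instance : MonoidalLinear ℂ (TensorQuotient g) where
  whiskerLeft_smul := by
    rintro ⟨X⟩ ⟨Y⟩ ⟨Z⟩ c ⟨f⟩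
    exact congrArg (toQuot g).map (MonoidalLinear.whiskerLeft_smul X c f)
  smul_whiskerRight := by
    rintro c ⟨Y⟩ ⟨Z⟩ ⟨f⟩ ⟨X⟩
    exact congrArg (toQuot g).map (MonoidalLinear.smul_whiskerRight c f X)

instance [BraidedCategory C] : BraidedCategory (TensorQuotient g) where
  braiding X Y := (toQuot g).mapIso (β_ X.as Y.as)
  braiding_naturality_right := by
    rintro ⟨X⟩ ⟨Y⟩ ⟨Z⟩ ⟨f⟩
    exact congrArg (toQuot g).map (BraidedCategory.braiding_naturality_right X f)
  braiding_naturality_left := by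
    rintro ⟨X⟩ ⟨Y⟩ ⟨f⟩ ⟨Z⟩
    exact congrArg (toQuot g).map (BraidedCategory.braiding_naturality_left f Z)
  hexagon_forward := by
    rintro ⟨X⟩ ⟨Y⟩ ⟨Z⟩
    exact congrArg (toQuot g).map (BraidedCategory.hexagon_forward X Y Z)
  hexagon_reverse := by
    rintro ⟨X⟩ ⟨Y⟩ ⟨Z⟩
    exact congrArg (toQuot g).map (BraidedCategory.hexagon_reverse X Y Z)

end TensorQuotient

section AdditiveCompletion
set_option linter.unusedSectionVars false
set_option linter.unusedVariables false
universe v u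
variable {C : Type u} [Category.{v} C] [Preadditive C]

instance [Linear ℂ C] : Linear ℂ (Mat_ C) where
  homModule M N := inferInstanceAs (Module ℂ (∀ i j, M.X i ⟶ N.X j))
  smul_comp M N K r f g := Mat_.hom_ext _ _ fun i k => by
    change ∑ j, (r • f i j) ≫ g j k = r • ∑ j, f i j ≫ g j k
    simp [Finset.smul_sum]
  comp_smul M N K f r g := Mat_.hom_ext _ _ fun i k => by
    change ∑ j, f i j ≫ (r • g j k) = r • ∑ j, f i j ≫ g j k
    simp [Finset.smul_sum]

open scoped Classical in
/-- The isomorphism of formal direct sums given by a bijection of the index sets and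
isomorphisms of corresponding summands. -/
def relabel {M N : Mat_ C} (e : M.ι ≃ N.ι) (φ : ∀ i, M.X i ≅ N.X (e i)) : M ⟶ N :=
  fun i j => if h : e i = j then (φ i).hom ≫ eqToHom (congrArg N.X h) else 0

open scoped Classical in
/-- The inverse of `relabel`. -/
def relabelInv {M N : Mat_ C} (e : M.ι ≃ N.ι) (φ : ∀ i, M.X i ≅ N.X (e i)) : N ⟶ M :=
  fun j i => if h : e i = j then eqToHom (congrArg N.X h).symm ≫ (φ i).inv else 0

theorem relabel_comp {M N K : Mat_ C} (e : M.ι ≃ N.ι) (φ : ∀ i, M.X i ≅ N.X (e i)) (f : N ⟶ K)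
    (i : M.ι) (k : K.ι) : (relabel e φ ≫ f) i k = (φ i).hom ≫ f (e i) k := by
  change ∑ j, (relabel e φ) i j ≫ f j k = _
  rw [Finset.sum_eq_single (e i)]
  · simp [relabel]
  · intro j _ hj; simp [relabel, hj.symm]
  · simp

theorem comp_relabel {M N K : Mat_ C} (e : M.ι ≃ N.ι) (φ : ∀ i, M.X i ≅ N.X (e i)) (f : K ⟶ M)
    (k : K.ι) (i : M.ι) : (f ≫ relabel e φ) k (e i) = f k i ≫ (φ i).hom := by
  change ∑ j, f k j ≫ (relabel e φ) j (e i) = _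
  rw [Finset.sum_eq_single i]
  · simp [relabel]
  · intro j _ hj; simp [relabel, hj]
  · simp

/-- `relabel` as an isomorphism. -/
def relabelIso {M N : Mat_ C} (e : M.ι ≃ N.ι) (φ : ∀ i, M.X i ≅ N.X (e i)) : M ≅ N where
  hom := relabel e φ
  inv := relabelInv e φ
  hom_inv_id := Mat_.hom_ext _ _ fun i j => by
    rw [relabel_comp]
    by_cases h : i = j
    · subst h; simp [relabelInv]
    · have h' : ¬ e j = e i := fun h' => h (e.injective h').symm
      rw [Mat_.id_apply_of_ne _ _ _ h]
      simp [relabelInv, h']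
  inv_hom_id := Mat_.hom_ext _ _ fun i j => by
    obtain ⟨i, rfl⟩ := e.surjective i
    obtain ⟨j, rfl⟩ := e.surjective j
    rw [comp_relabel]
    by_cases h : i = j
    · subst h; simp [relabelInv]
    · have h' : ¬ e i = e j := fun h' => h (e.injective h')
      rw [Mat_.id_apply_of_ne _ _ _ h']
      simp [relabelInv, Ne.symm h]

theorem relabel_congr {M N : Mat_ C} {e e' : M.ι ≃ N.ι} {φ : ∀ i, M.X i ≅ N.X (e i)}
    {φ' : ∀ i, M.X i ≅ N.X (e' i)} (h : e = e')
    (hφ : ∀ i, (φ i).hom ≫ eqToHom (by rw [h]) = (φ' i).hom) : relabel e φ = relabel e' φ' := by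
  subst h
  have : φ = φ' := funext fun i => Iso.ext (by simpa using hφ i)
  rw [this]

theorem relabel_apply {M N : Mat_ C} (e : M.ι ≃ N.ι) (φ : ∀ i, M.X i ≅ N.X (e i)) (i : M.ι) :
    relabel e φ i (e i) = (φ i).hom := by simp [relabel]

theorem relabel_apply_ne {M N : Mat_ C} (e : M.ι ≃ N.ι) (φ : ∀ i, M.X i ≅ N.X (e i)) (i : M.ι)
    (j : N.ι) (h : e i ≠ j) : relabel e φ i j = 0 := by simp [relabel, h]

theorem eq_relabel {M N : Mat_ C} {f : M ⟶ N} {e : M.ι ≃ N.ι} {φ : ∀ i, M.X i ≅ N.X (e i)}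
    (h : ∀ i, f i (e i) = (φ i).hom) (h' : ∀ i i', i ≠ i' → f i (e i') = 0) : f = relabel e φ :=
  Mat_.hom_ext _ _ fun i j => by
    obtain ⟨j, rfl⟩ := e.surjective j
    by_cases hij : i = j
    · subst hij; rw [h, relabel_apply]
    · rw [h' _ _ hij, relabel_apply_ne _ _ _ _ (fun h => hij (e.injective h))]

theorem relabel_trans {M N K : Mat_ C} {f : M ⟶ N} {g : N ⟶ K} {e : M.ι ≃ N.ι}
    {φ : ∀ i, M.X i ≅ N.X (e i)} {e' : N.ι ≃ K.ι} {φ' : ∀ i, N.X i ≅ K.X (e' i)}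
    (hf : f = relabel e φ) (hg : g = relabel e' φ') :
    f ≫ g = relabel (e.trans e') (fun i => φ i ≪≫ φ' (e i)) := by
  subst hf hg
  refine eq_relabel (fun i => ?_) (fun i j h => ?_)
  · rw [relabel_comp]
    exact congrArg _ (relabel_apply e' φ' (e i))
  · rw [relabel_comp]
    exact (congrArg _ (relabel_apply_ne e' φ' (e i) (e' (e j))
      (fun h' => h (e.injective (e'.injective h'))))).trans Limits.comp_zero

theorem relabel_ext {M N : Mat_ C} {f g : M ⟶ N} {e e' : M.ι ≃ N.ι}
    {φ : ∀ i, M.X i ≅ N.X (e i)} {φ' : ∀ i, M.X i ≅ N.X (e' i)} (hf : f = relabel e φ)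
    (hg : g = relabel e' φ') (h : e = e')
    (hφ : ∀ i, (φ i).hom ≫ eqToHom (by rw [h]) = (φ' i).hom) : f = g := by
  rw [hf, hg, relabel_congr h hφ]

theorem relabel_naturality {M N M' N' : Mat_ C} (e : M.ι ≃ N.ι) (φ : ∀ i, M.X i ≅ N.X (e i))
    (e' : M'.ι ≃ N'.ι) (φ' : ∀ i, M'.X i ≅ N'.X (e' i)) (f : M ⟶ M') (g : N ⟶ N')
    (H : ∀ i j, f i j ≫ (φ' j).hom = (φ i).hom ≫ g (e i) (e' j)) :
    f ≫ relabel e' φ' = relabel e φ ≫ g := Mat_.hom_ext _ _ fun i j => by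
  obtain ⟨j, rfl⟩ := e'.surjective j
  rw [comp_relabel, relabel_comp]
  exact H i j

variable [MonoidalCategory C]

/-- The tensor product of formal direct sums. -/
def matTensor (M N : Mat_ C) : Mat_ C := ⟨M.ι × N.ι, fun p => M.X p.1 ⊗ N.X p.2⟩

/-- The tensor product (Kronecker product) of matrices. -/
def matTensorHom {M N M' N' : Mat_ C} (f : M ⟶ M') (g : N ⟶ N') :
    matTensor M N ⟶ matTensor M' N' := fun p q => f p.1 q.1 ⊗ₘ g p.2 q.2

/-- The associator. -/
def matAssoc (M N K : Mat_ C) : matTensor (matTensor M N) K ≅ matTensor M (matTensor N K) :=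
  relabelIso (M := matTensor (matTensor M N) K) (N := matTensor M (matTensor N K))
    (Equiv.prodAssoc _ _ _) (fun p => α_ (M.X p.1.1) (N.X p.1.2) (K.X p.2))

/-- The unit object. -/
def matUnit : Mat_ C := ⟨PUnit, fun _ => 𝟙_ C⟩

/-- The left unitor. -/
def matLeft (M : Mat_ C) : matTensor matUnit M ≅ M :=
  relabelIso (M := matTensor matUnit M) (Equiv.punitProd _) (fun p => λ_ (M.X p.2))

/-- The right unitor. -/
def matRight (M : Mat_ C) : matTensor M matUnit ≅ M :=
  relabelIso (M := matTensor M matUnit) (Equiv.prodPUnit _) (fun p => ρ_ (M.X p.1))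

/-- The braiding. -/
def matBraid [BraidedCategory C] (M N : Mat_ C) : matTensor M N ≅ matTensor N M :=
  relabelIso (M := matTensor M N) (N := matTensor N M) (Equiv.prodComm _ _)
    (fun p => β_ (M.X p.1) (N.X p.2))

instance : MonoidalCategoryStruct (Mat_ C) where
  tensorObj := matTensor
  tensorHom := matTensorHom
  whiskerLeft M _ _ f := matTensorHom (𝟙 M) f
  whiskerRight f M := matTensorHom f (𝟙 M)
  tensorUnit := matUnit
  associator := matAssoc
  leftUnitor := matLeft
  rightUnitor := matRight

variable [MonoidalPreadditive C]

theorem matTensor_id (M N : Mat_ C) : matTensorHom (𝟙 M) (𝟙 N) = 𝟙 (matTensor M N) :=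
  Mat_.hom_ext _ _ fun i j => by
    change (𝟙 M : Mat_.Hom M M) i.1 j.1 ⊗ₘ (𝟙 N : Mat_.Hom N N) i.2 j.2 = _
    by_cases h : i = j
    · subst h
      rw [Mat_.id_apply_self, Mat_.id_apply_self]
      exact (id_tensorHom_id _ _).trans (Mat_.id_apply_self (matTensor M N) i).symm
    · refine Eq.trans ?_ (Mat_.id_apply_of_ne (matTensor M N) i j h).symm
      by_cases h1 : i.1 = j.1
      · have h2 : i.2 ≠ j.2 := fun h2 => h (Prod.ext h1 h2)
        rw [Mat_.id_apply_of_ne _ _ _ h2, MonoidalPreadditive.tensor_zero]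
        rfl
      · rw [Mat_.id_apply_of_ne _ _ _ h1, MonoidalPreadditive.zero_tensor]
        rfl

theorem relabel_wl (K : Mat_ C) {M N : Mat_ C} (e : M.ι ≃ N.ι) (φ : ∀ i, M.X i ≅ N.X (e i)) :
    matTensorHom (𝟙 K) (relabel e φ) = relabel (M := matTensor K M) (N := matTensor K N)
      ((Equiv.refl K.ι).prodCongr e) (fun p => whiskerLeftIso (K.X p.1) (φ p.2)) := by
  refine eq_relabel (fun i => ?_) (fun i j h => ?_)
  · change (𝟙 K : Mat_.Hom K K) i.1 i.1 ⊗ₘ relabel e φ i.2 (e i.2) = K.X i.1 ◁ (φ i.2).hom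
    rw [Mat_.id_apply_self, relabel_apply, id_tensorHom]
  · change (𝟙 K : Mat_.Hom K K) i.1 j.1 ⊗ₘ relabel e φ i.2 (e j.2) = _
    by_cases h1 : i.1 = j.1
    · have h2 : i.2 ≠ j.2 := fun h2 => h (Prod.ext h1 h2)
      rw [relabel_apply_ne _ _ _ _ (fun h => h2 (e.injective h)), MonoidalPreadditive.tensor_zero]
      rfl
    · rw [Mat_.id_apply_of_ne _ _ _ h1, MonoidalPreadditive.zero_tensor]
      rfl

theorem relabel_wr (K : Mat_ C) {M N : Mat_ C} (e : M.ι ≃ N.ι) (φ : ∀ i, M.X i ≅ N.X (e i)) :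
    matTensorHom (relabel e φ) (𝟙 K) = relabel (M := matTensor M K) (N := matTensor N K)
      (e.prodCongr (Equiv.refl K.ι)) (fun p => whiskerRightIso (φ p.1) (K.X p.2)) := by
  refine eq_relabel (fun i => ?_) (fun i j h => ?_)
  · change relabel e φ i.1 (e i.1) ⊗ₘ (𝟙 K : Mat_.Hom K K) i.2 i.2 = (φ i.1).hom ▷ K.X i.2
    rw [Mat_.id_apply_self, relabel_apply, tensorHom_id]
  · change relabel e φ i.1 (e j.1) ⊗ₘ (𝟙 K : Mat_.Hom K K) i.2 j.2 = _
    by_cases h1 : i.2 = j.2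
    · have h2 : i.1 ≠ j.1 := fun h2 => h (Prod.ext h2 h1)
      rw [relabel_apply_ne _ _ _ _ (fun h => h2 (e.injective h)), MonoidalPreadditive.zero_tensor]
      rfl
    · rw [Mat_.id_apply_of_ne _ _ _ h1, MonoidalPreadditive.tensor_zero]
      rfl

theorem matAssoc_wr (M N K L : Mat_ C) : matTensorHom (matAssoc M N K).hom (𝟙 L) =
    relabel (M := matTensor (matTensor (matTensor M N) K) L)
      (N := matTensor (matTensor M (matTensor N K)) L)
      ((Equiv.prodAssoc _ _ _).prodCongr (Equiv.refl _))
      (fun p => whiskerRightIso (α_ (M.X p.1.1.1) (N.X p.1.1.2) (K.X p.1.2)) (L.X p.2)) :=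
  relabel_wr _ _ _

theorem matAssoc_wl (M N K L : Mat_ C) : matTensorHom (𝟙 L) (matAssoc M N K).hom =
    relabel (M := matTensor L (matTensor (matTensor M N) K))
      (N := matTensor L (matTensor M (matTensor N K)))
      ((Equiv.refl _).prodCongr (Equiv.prodAssoc _ _ _))
      (fun p => whiskerLeftIso (L.X p.1) (α_ (M.X p.2.1.1) (N.X p.2.1.2) (K.X p.2.2))) :=
  relabel_wl _ _ _

theorem mat_pentagon (W X Y Z : Mat_ C) :
    matTensorHom (matAssoc W X Y).hom (𝟙 Z) ≫ (matAssoc W (matTensor X Y) Z).hom ≫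
      matTensorHom (𝟙 W) (matAssoc X Y Z).hom =
    (matAssoc (matTensor W X) Y Z).hom ≫ (matAssoc W X (matTensor Y Z)).hom := by
  refine relabel_ext (relabel_trans (matAssoc_wr _ _ _ _) (relabel_trans rfl
    (matAssoc_wl _ _ _ _))) (relabel_trans rfl rfl) rfl fun i => ?_
  exact (Category.comp_id _).trans (MonoidalCategory.pentagon (W.X i.1.1.1) (X.X i.1.1.2)
    (Y.X i.1.2) (Z.X i.2))

theorem mat_triangle (X Y : Mat_ C) : (matAssoc X matUnit Y).hom ≫
    matTensorHom (𝟙 X) (matLeft Y).hom = matTensorHom (matRight X).hom (𝟙 Y) := by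
  refine relabel_ext (relabel_trans rfl (relabel_wl _ _ _)) (relabel_wr _ _ _) rfl fun i => ?_
  exact (Category.comp_id _).trans (MonoidalCategory.triangle (X.X i.1.1) (Y.X i.2))

theorem matBraid_wr [BraidedCategory C] (M N L : Mat_ C) :
    matTensorHom (matBraid M N).hom (𝟙 L) =
    relabel (M := matTensor (matTensor M N) L) (N := matTensor (matTensor N M) L)
      ((Equiv.prodComm _ _).prodCongr (Equiv.refl _))
      (fun p => whiskerRightIso (β_ (M.X p.1.1) (N.X p.1.2)) (L.X p.2)) :=
  relabel_wr _ _ _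

theorem matBraid_wl [BraidedCategory C] (M N L : Mat_ C) :
    matTensorHom (𝟙 L) (matBraid M N).hom =
    relabel (M := matTensor L (matTensor M N)) (N := matTensor L (matTensor N M))
      ((Equiv.refl _).prodCongr (Equiv.prodComm _ _))
      (fun p => whiskerLeftIso (L.X p.1) (β_ (M.X p.2.1) (N.X p.2.2))) :=
  relabel_wl _ _ _

theorem matAssoc_inv (X Y Z : Mat_ C) : (matAssoc X Y Z).inv =
    relabel (M := matTensor X (matTensor Y Z)) (N := matTensor (matTensor X Y) Z)
      (Equiv.prodAssoc _ _ _).symm (fun p => (α_ (X.X p.1) (Y.X p.2.1) (Z.X p.2.2)).symm) := by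
  rw [← cancel_epi (matAssoc X Y Z).hom, Iso.hom_inv_id]
  refine relabel_ext (e := Equiv.refl _) (φ := fun p => Iso.refl _)
    (eq_relabel (fun i => Mat_.id_apply_self _ _) (fun i j h => Mat_.id_apply_of_ne _ _ _ h))
    (relabel_trans rfl rfl) rfl fun i => ?_
  exact (Category.comp_id _).trans (α_ (X.X i.1.1) (Y.X i.1.2) (Z.X i.2)).hom_inv_id.symm

theorem mat_hexagon_forward [BraidedCategory C] (X Y Z : Mat_ C) :
    (matAssoc X Y Z).hom ≫ (matBraid X (matTensor Y Z)).hom ≫ (matAssoc Y Z X).hom =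
    matTensorHom (matBraid X Y).hom (𝟙 Z) ≫ (matAssoc Y X Z).hom ≫
      matTensorHom (𝟙 Y) (matBraid X Z).hom := by
  refine relabel_ext (relabel_trans rfl (relabel_trans rfl rfl)) (relabel_trans
    (matBraid_wr _ _ _) (relabel_trans rfl (matBraid_wl _ _ _))) rfl fun i => ?_
  exact (Category.comp_id _).trans (BraidedCategory.hexagon_forward (X.X i.1.1) (Y.X i.1.2)
    (Z.X i.2))

theorem mat_hexagon_reverse [BraidedCategory C] (X Y Z : Mat_ C) :
    (matAssoc X Y Z).inv ≫ (matBraid (matTensor X Y) Z).hom ≫ (matAssoc Z X Y).inv =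
    matTensorHom (𝟙 X) (matBraid Y Z).hom ≫ (matAssoc X Z Y).inv ≫
      matTensorHom (matBraid X Z).hom (𝟙 Y) := by
  refine relabel_ext (relabel_trans (matAssoc_inv _ _ _) (relabel_trans rfl
    (matAssoc_inv _ _ _))) (relabel_trans (matBraid_wl _ _ _) (relabel_trans
    (matAssoc_inv _ _ _) (matBraid_wr _ _ _))) rfl fun i => ?_
  exact (Category.comp_id _).trans (BraidedCategory.hexagon_reverse (X.X i.1) (Y.X i.2.1)
    (Z.X i.2.2))

theorem matUnit_id (i j : PUnit) :
    (𝟙 (matUnit : Mat_ C) : Mat_.Hom _ _) i j = 𝟙 (𝟙_ C) := Mat_.id_apply_self _ _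

instance : MonoidalCategory (Mat_ C) := MonoidalCategory.ofTensorHom
  (id_tensorHom_id := matTensor_id)
  (id_tensorHom := fun _ _ _ _ => rfl)
  (tensorHom_id := fun _ _ => rfl)
  (tensorHom_comp_tensorHom := fun {X₁ Y₁ Z₁ X₂ Y₂ Z₂} f₁ f₂ g₁ g₂ => Mat_.hom_ext _ _ fun i k => by
    change ∑ j : Y₁.ι × Y₂.ι, (f₁ i.1 j.1 ⊗ₘ f₂ i.2 j.2) ≫ (g₁ j.1 k.1 ⊗ₘ g₂ j.2 k.2) =
      (∑ j, f₁ i.1 j ≫ g₁ j k.1) ⊗ₘ (∑ j, f₂ i.2 j ≫ g₂ j k.2)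
    rw [sum_tensor, Fintype.sum_prod_type]
    refine Finset.sum_congr rfl fun a _ => ?_
    rw [tensor_sum]
    refine Finset.sum_congr rfl fun b _ => ?_
    rw [tensorHom_comp_tensorHom])
  (associator_naturality := fun f₁ f₂ f₃ => relabel_naturality _ _ _ _ _ _ fun i j =>
    MonoidalCategory.associator_naturality _ _ _)
  (leftUnitor_naturality := fun {M N} f => relabel_naturality _ _ _ _ _ _ fun i j => by
    have e (g : M.X i.2 ⟶ N.X j.2) : (𝟙 (𝟙_ C) ⊗ₘ g) ≫ (λ_ _).hom = (λ_ _).hom ≫ g := by simp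
    exact (congrArg (fun x => (x ⊗ₘ f i.2 j.2) ≫ (λ_ _).hom) (matUnit_id i.1 j.1)).trans (e _))
  (rightUnitor_naturality := fun {M N} f => relabel_naturality _ _ _ _ _ _ fun i j => by
    have e (g : M.X i.1 ⟶ N.X j.1) : (g ⊗ₘ 𝟙 (𝟙_ C)) ≫ (ρ_ _).hom = (ρ_ _).hom ≫ g := by simp
    exact (congrArg (fun x => (f i.1 j.1 ⊗ₘ x) ≫ (ρ_ _).hom) (matUnit_id i.2 j.2)).trans (e _))
  (pentagon := mat_pentagon)
  (triangle := mat_triangle)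

instance : MonoidalPreadditive (Mat_ C) where
  whiskerLeft_zero := Mat_.hom_ext _ _ fun _ _ => MonoidalPreadditive.tensor_zero _
  zero_whiskerRight := Mat_.hom_ext _ _ fun _ _ => MonoidalPreadditive.zero_tensor _
  whiskerLeft_add {X _ _} f g := Mat_.hom_ext _ _ fun i j =>
    MonoidalPreadditive.tensor_add ((𝟙 X : Mat_.Hom X X) i.1 j.1) (f i.2 j.2) (g i.2 j.2)
  add_whiskerRight {X _ _} f g := Mat_.hom_ext _ _ fun i j =>
    MonoidalPreadditive.add_tensor (f i.1 j.1) (g i.1 j.1) ((𝟙 X : Mat_.Hom X X) i.2 j.2)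

theorem smul_tensor [Linear ℂ C] [MonoidalLinear ℂ C] {X Y X' Y' : C} (c : ℂ) (f : X ⟶ Y)
    (g : X' ⟶ Y') : (c • f) ⊗ₘ g = c • (f ⊗ₘ g) := by
  simp [MonoidalCategory.tensorHom_def]

theorem tensor_smul [Linear ℂ C] [MonoidalLinear ℂ C] {X Y X' Y' : C} (c : ℂ) (f : X ⟶ Y)
    (g : X' ⟶ Y') : f ⊗ₘ (c • g) = c • (f ⊗ₘ g) := by
  simp [MonoidalCategory.tensorHom_def]

instance [Linear ℂ C] [MonoidalLinear ℂ C] : MonoidalLinear ℂ (Mat_ C) where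
  whiskerLeft_smul X _ _ c f := Mat_.hom_ext _ _ fun i j =>
    tensor_smul c ((𝟙 X : Mat_.Hom X X) i.1 j.1) (f i.2 j.2)
  smul_whiskerRight c _ _ f X := Mat_.hom_ext _ _ fun i j =>
    smul_tensor c (f i.1 j.1) ((𝟙 X : Mat_.Hom X X) i.2 j.2)

instance [BraidedCategory C] : BraidedCategory (Mat_ C) where
  braiding := matBraid
  braiding_naturality_right X Y Z f := relabel_naturality _ _ _ _ _ _ fun i j =>
    BraidedCategory.braiding_naturality ((𝟙 X : Mat_.Hom X X) i.1 j.1) (f i.2 j.2)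
  braiding_naturality_left f Z := relabel_naturality _ _ _ _ _ _ fun i j =>
    BraidedCategory.braiding_naturality (f i.1 j.1) ((𝟙 Z : Mat_.Hom Z Z) i.2 j.2)
  hexagon_forward := mat_hexagon_forward
  hexagon_reverse := mat_hexagon_reverse
end AdditiveCompletion

section IdempotentCompletion
set_option linter.unusedVariables false
set_option linter.unusedSectionVars false
open Idempotents
universe v u
variable {C : Type u} [Category.{v} C]

instance [Preadditive C] [Linear ℂ C] : Linear ℂ (Karoubi C) where
  homModule P Q :=
    { smul := fun a f => ⟨a • f.f, by
        rw [Linear.smul_comp, Linear.comp_smul, f.comm]⟩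
      one_smul := fun f => Karoubi.hom_ext _ _ (one_smul ℂ f.f)
      mul_smul := fun a b f => Karoubi.hom_ext _ _ (mul_smul a b f.f)
      smul_zero := fun a => Karoubi.hom_ext _ _ (smul_zero a)
      smul_add := fun a f g => Karoubi.hom_ext _ _ (smul_add a f.f g.f)
      add_smul := fun a b f => Karoubi.hom_ext _ _ (add_smul a b f.f)
      zero_smul := fun f => Karoubi.hom_ext _ _ (zero_smul ℂ f.f) }
  smul_comp X Y Z r f g := Karoubi.hom_ext _ _ (Linear.smul_comp _ _ _ r f.f g.f)
  comp_smul X Y Z f r g := Karoubi.hom_ext _ _ (Linear.comp_smul _ _ _ f.f r g.f)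

/-- An isomorphism that intertwines two idempotents induces an isomorphism of their images. -/
def karoubiIso (P Q : Karoubi C) (a : P.X ≅ Q.X) (h : P.p ≫ a.hom = a.hom ≫ Q.p) : P ≅ Q where
  hom := ⟨P.p ≫ a.hom, by rw [Category.assoc, ← h, P.idem_assoc, P.idem_assoc]⟩
  inv := ⟨Q.p ≫ a.inv, by
    have h' : Q.p ≫ a.inv = a.inv ≫ P.p := by
      rw [Iso.eq_inv_comp, ← Category.assoc, ← h, Category.assoc, Iso.hom_inv_id, Category.comp_id]
    rw [Category.assoc, ← h', Q.idem_assoc, Q.idem_assoc]⟩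
  hom_inv_id := Karoubi.hom_ext _ _ (by
    change (P.p ≫ a.hom) ≫ Q.p ≫ a.inv = P.p
    rw [h, Category.assoc, Q.idem_assoc, ← Category.assoc, ← h, Category.assoc, Iso.hom_inv_id,
      Category.comp_id])
  inv_hom_id := Karoubi.hom_ext _ _ (by
    change (Q.p ≫ a.inv) ≫ P.p ≫ a.hom = Q.p
    rw [h, Category.assoc, Iso.inv_hom_id_assoc, Q.idem])

variable [MonoidalCategory C]

/-- The tensor product on objects of the idempotent completion: `(X, p) ⊗ (Y, q)` is
`(X ⊗ Y, p ⊗ q)`. -/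
def karoubiTensor (P Q : Karoubi C) : Karoubi C where
  X := P.X ⊗ Q.X
  p := P.p ⊗ₘ Q.p
  idem := by rw [tensorHom_comp_tensorHom, P.idem, Q.idem]

/-- The tensor product on morphisms of the idempotent completion. -/
def karoubiTensorHom {P Q P' Q' : Karoubi C} (f : P ⟶ P') (g : Q ⟶ Q') :
    karoubiTensor P Q ⟶ karoubiTensor P' Q' where
  f := f.f ⊗ₘ g.f
  comm := by
    change (P.p ⊗ₘ Q.p) ≫ (f.f ⊗ₘ g.f) ≫ (P'.p ⊗ₘ Q'.p) = (f.f ⊗ₘ g.f)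
    rw [tensorHom_comp_tensorHom, tensorHom_comp_tensorHom, f.comm, g.comm]

instance : MonoidalCategoryStruct (Karoubi C) where
  tensorObj := karoubiTensor
  tensorHom := karoubiTensorHom
  whiskerLeft P _ _ f := karoubiTensorHom (𝟙 P) f
  whiskerRight f P := karoubiTensorHom f (𝟙 P)
  tensorUnit := ⟨𝟙_ C, 𝟙 _, Category.comp_id _⟩
  associator P Q R := karoubiIso (karoubiTensor (karoubiTensor P Q) R)
    (karoubiTensor P (karoubiTensor Q R)) (α_ P.X Q.X R.X)
    (MonoidalCategory.associator_naturality P.p Q.p R.p)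
  leftUnitor P := karoubiIso (karoubiTensor ⟨𝟙_ C, 𝟙 _, Category.comp_id _⟩ P) P (λ_ P.X) (by
    change (𝟙 _ ⊗ₘ P.p) ≫ _ = _
    rw [id_tensorHom]; exact MonoidalCategory.leftUnitor_naturality P.p)
  rightUnitor P := karoubiIso (karoubiTensor P ⟨𝟙_ C, 𝟙 _, Category.comp_id _⟩) P (ρ_ P.X) (by
    change (P.p ⊗ₘ 𝟙 _) ≫ _ = _
    rw [tensorHom_id]; exact MonoidalCategory.rightUnitor_naturality P.p)

theorem pentagon_idem {W X Y Z : C} {w : W ⟶ W} {x : X ⟶ X} {y : Y ⟶ Y} {z : Z ⟶ Z}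
    (hw : w ≫ w = w) (hx : x ≫ x = x) (hy : y ≫ y = y) (hz : z ≫ z = z) :
    ((((w ⊗ₘ x) ⊗ₘ y) ≫ (α_ W X Y).hom) ⊗ₘ z) ≫
      (((w ⊗ₘ (x ⊗ₘ y)) ⊗ₘ z) ≫ (α_ W (X ⊗ Y) Z).hom) ≫
        (w ⊗ₘ (((x ⊗ₘ y) ⊗ₘ z) ≫ (α_ X Y Z).hom)) =
    ((((w ⊗ₘ x) ⊗ₘ y) ⊗ₘ z) ≫ (α_ (W ⊗ X) Y Z).hom) ≫
      (((w ⊗ₘ x) ⊗ₘ (y ⊗ₘ z)) ≫ (α_ W X (Y ⊗ Z)).hom) := by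
  have e1 : ((((w ⊗ₘ x) ⊗ₘ y) ≫ (α_ W X Y).hom) ⊗ₘ z) =
      (((w ⊗ₘ x) ⊗ₘ y) ⊗ₘ z) ≫ ((α_ W X Y).hom ▷ Z) := by
    rw [← tensorHom_id, tensorHom_comp_tensorHom, Category.comp_id]
  have e2 : (w ⊗ₘ (((x ⊗ₘ y) ⊗ₘ z) ≫ (α_ X Y Z).hom)) =
      (w ⊗ₘ ((x ⊗ₘ y) ⊗ₘ z)) ≫ (W ◁ (α_ X Y Z).hom) := by
    rw [← id_tensorHom, tensorHom_comp_tensorHom, Category.comp_id]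
  have e3 : (((w ⊗ₘ x) ⊗ₘ y) ⊗ₘ z) ≫ ((α_ W X Y).hom ▷ Z) =
      ((α_ W X Y).hom ▷ Z) ≫ ((w ⊗ₘ (x ⊗ₘ y)) ⊗ₘ z) := by
    rw [← tensorHom_id, tensorHom_comp_tensorHom, tensorHom_comp_tensorHom, Category.comp_id,
      Category.id_comp, MonoidalCategory.associator_naturality]
  have e4 : ((w ⊗ₘ (x ⊗ₘ y)) ⊗ₘ z) ≫ ((w ⊗ₘ (x ⊗ₘ y)) ⊗ₘ z) = ((w ⊗ₘ (x ⊗ₘ y)) ⊗ₘ z) := by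
    simp only [tensorHom_comp_tensorHom, hw, hx, hy, hz]
  have e5 : (w ⊗ₘ ((x ⊗ₘ y) ⊗ₘ z)) ≫ (w ⊗ₘ ((x ⊗ₘ y) ⊗ₘ z)) = (w ⊗ₘ ((x ⊗ₘ y) ⊗ₘ z)) := by
    simp only [tensorHom_comp_tensorHom, hw, hx, hy, hz]
  have e6 : ((w ⊗ₘ x) ⊗ₘ (y ⊗ₘ z)) ≫ ((w ⊗ₘ x) ⊗ₘ (y ⊗ₘ z)) = ((w ⊗ₘ x) ⊗ₘ (y ⊗ₘ z)) := by
    simp only [tensorHom_comp_tensorHom, hw, hx, hy, hz]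
  have e7 := MonoidalCategory.associator_naturality (w ⊗ₘ x) y z
  have e8 := MonoidalCategory.associator_naturality w (x ⊗ₘ y) z
  rw [e1, e2, e3, e7]
  simp only [Category.assoc]
  rw [reassoc_of% e4, reassoc_of% e6, ← reassoc_of% e8, reassoc_of% e4, ← reassoc_of% e3,
    ← reassoc_of% e7, pentagon]

theorem triangle_idem {X Y : C} {x : X ⟶ X} {y : Y ⟶ Y} (hx : x ≫ x = x) (hy : y ≫ y = y) :
    (((x ⊗ₘ 𝟙 (𝟙_ C)) ⊗ₘ y) ≫ (α_ X (𝟙_ C) Y).hom) ≫ (x ⊗ₘ ((𝟙 (𝟙_ C) ⊗ₘ y) ≫ (λ_ Y).hom)) =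
      (((x ⊗ₘ 𝟙 (𝟙_ C)) ≫ (ρ_ X).hom) ⊗ₘ y) := by
  have e1 : (x ⊗ₘ ((𝟙 (𝟙_ C) ⊗ₘ y) ≫ (λ_ Y).hom)) =
      (x ⊗ₘ (𝟙 (𝟙_ C) ⊗ₘ y)) ≫ (X ◁ (λ_ Y).hom) := by
    rw [← id_tensorHom X, tensorHom_comp_tensorHom, Category.comp_id]
  have e2 : (((x ⊗ₘ 𝟙 (𝟙_ C)) ≫ (ρ_ X).hom) ⊗ₘ y) =
      ((x ⊗ₘ 𝟙 (𝟙_ C)) ⊗ₘ y) ≫ ((ρ_ X).hom ▷ Y) := by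
    rw [← tensorHom_id (ρ_ X).hom, tensorHom_comp_tensorHom, Category.comp_id]
  have e3 := MonoidalCategory.associator_naturality x (𝟙 (𝟙_ C)) y
  have e4 : ((x ⊗ₘ 𝟙 (𝟙_ C)) ⊗ₘ y) ≫ ((x ⊗ₘ 𝟙 (𝟙_ C)) ⊗ₘ y) = ((x ⊗ₘ 𝟙 (𝟙_ C)) ⊗ₘ y) := by
    simp only [tensorHom_comp_tensorHom, hx, hy, Category.comp_id]
  rw [e1, e2, Category.assoc, ← reassoc_of% e3, reassoc_of% e4, triangle]

instance : MonoidalCategory (Karoubi C) where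
  tensorHom_def {X₁ Y₁ X₂ Y₂} f g := Karoubi.hom_ext _ _ (by
    change (f.f ⊗ₘ g.f) = (f.f ⊗ₘ X₂.p) ≫ (Y₁.p ⊗ₘ g.f)
    rw [tensorHom_comp_tensorHom, Karoubi.comp_p, Karoubi.p_comp])
  id_tensorHom_id P Q := rfl
  tensorHom_comp_tensorHom f₁ f₂ g₁ g₂ := Karoubi.hom_ext _ _
    (tensorHom_comp_tensorHom f₁.f f₂.f g₁.f g₂.f)
  whiskerLeft_id P Q := rfl
  id_whiskerRight P Q := rfl
  associator_naturality {X₁ X₂ X₃ Y₁ Y₂ Y₃} f₁ f₂ f₃ := Karoubi.hom_ext _ _ (by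
    change ((f₁.f ⊗ₘ f₂.f) ⊗ₘ f₃.f) ≫ ((Y₁.p ⊗ₘ Y₂.p) ⊗ₘ Y₃.p) ≫ (α_ _ _ _).hom =
      (((X₁.p ⊗ₘ X₂.p) ⊗ₘ X₃.p) ≫ (α_ _ _ _).hom) ≫ (f₁.f ⊗ₘ (f₂.f ⊗ₘ f₃.f))
    rw [Category.assoc, ← MonoidalCategory.associator_naturality, ← Category.assoc,
      ← Category.assoc]
    simp only [tensorHom_comp_tensorHom, Karoubi.comp_p, Karoubi.p_comp])
  leftUnitor_naturality {X Y} f := Karoubi.hom_ext _ _ (by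
    change (𝟙 (𝟙_ C) ⊗ₘ f.f) ≫ (𝟙 (𝟙_ C) ⊗ₘ Y.p) ≫ (λ_ Y.X).hom =
      ((𝟙 (𝟙_ C) ⊗ₘ X.p) ≫ (λ_ X.X).hom) ≫ f.f
    simp)
  rightUnitor_naturality {X Y} f := Karoubi.hom_ext _ _ (by
    change (f.f ⊗ₘ 𝟙 (𝟙_ C)) ≫ (Y.p ⊗ₘ 𝟙 (𝟙_ C)) ≫ (ρ_ Y.X).hom =
      ((X.p ⊗ₘ 𝟙 (𝟙_ C)) ≫ (ρ_ X.X).hom) ≫ f.f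
    simp)
  pentagon W X Y Z := Karoubi.hom_ext _ _ (pentagon_idem W.idem X.idem Y.idem Z.idem)
  triangle X Y := Karoubi.hom_ext _ _ (triangle_idem X.idem Y.idem)

section
variable [Preadditive C] [MonoidalPreadditive C]

instance : MonoidalPreadditive (Karoubi C) where
  whiskerLeft_zero {X Y Z} := Karoubi.hom_ext _ _ (MonoidalPreadditive.tensor_zero X.p)
  zero_whiskerRight {X Y Z} := Karoubi.hom_ext _ _ (MonoidalPreadditive.zero_tensor X.p)
  whiskerLeft_add {X Y Z} f g :=
    Karoubi.hom_ext _ _ (MonoidalPreadditive.tensor_add X.p f.f g.f)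
  add_whiskerRight {X Y Z} f g :=
    Karoubi.hom_ext _ _ (MonoidalPreadditive.add_tensor f.f g.f X.p)

variable [Linear ℂ C] [MonoidalLinear ℂ C]

instance : MonoidalLinear ℂ (Karoubi C) where
  whiskerLeft_smul X _ _ c f := Karoubi.hom_ext _ _ (tensor_smul c X.p f.f)
  smul_whiskerRight c _ _ f X := Karoubi.hom_ext _ _ (smul_tensor c f.f X.p)
end

theorem braid_nat [BraidedCategory C] {X Y X' Y' : C} (f : X ⟶ X') (g : Y ⟶ Y') :
    (f ⊗ₘ g) ≫ (β_ X' Y').hom = (β_ X Y).hom ≫ (g ⊗ₘ f) :=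
  BraidedCategory.braiding_naturality f g

theorem hexagon_forward_idem [BraidedCategory C] {X Y Z : C} {x : X ⟶ X} {y : Y ⟶ Y} {z : Z ⟶ Z}
    (hx : x ≫ x = x) (hy : y ≫ y = y) (hz : z ≫ z = z) :
    (((x ⊗ₘ y) ⊗ₘ z) ≫ (α_ X Y Z).hom) ≫ ((x ⊗ₘ (y ⊗ₘ z)) ≫ (β_ X (Y ⊗ Z)).hom) ≫
      (((y ⊗ₘ z) ⊗ₘ x) ≫ (α_ Y Z X).hom) =
    (((x ⊗ₘ y) ≫ (β_ X Y).hom) ⊗ₘ z) ≫ (((y ⊗ₘ x) ⊗ₘ z) ≫ (α_ Y X Z).hom) ≫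
      (y ⊗ₘ ((x ⊗ₘ z) ≫ (β_ X Z).hom)) := by
  have e1 : (((x ⊗ₘ y) ≫ (β_ X Y).hom) ⊗ₘ z) = ((x ⊗ₘ y) ⊗ₘ z) ≫ ((β_ X Y).hom ▷ Z) := by
    rw [← tensorHom_id, tensorHom_comp_tensorHom, Category.comp_id]
  have e2 : (y ⊗ₘ ((x ⊗ₘ z) ≫ (β_ X Z).hom)) = (y ⊗ₘ (x ⊗ₘ z)) ≫ (Y ◁ (β_ X Z).hom) := by
    rw [← id_tensorHom, tensorHom_comp_tensorHom, Category.comp_id]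
  have e3 : ((x ⊗ₘ y) ⊗ₘ z) ≫ ((β_ X Y).hom ▷ Z) = ((β_ X Y).hom ▷ Z) ≫ ((y ⊗ₘ x) ⊗ₘ z) := by
    rw [← tensorHom_id, tensorHom_comp_tensorHom, tensorHom_comp_tensorHom, Category.comp_id,
      Category.id_comp, braid_nat]
  have i1 : ((y ⊗ₘ x) ⊗ₘ z) ≫ ((y ⊗ₘ x) ⊗ₘ z) = ((y ⊗ₘ x) ⊗ₘ z) := by
    simp only [tensorHom_comp_tensorHom, hx, hy, hz]
  have i2 : ((x ⊗ₘ y) ⊗ₘ z) ≫ ((x ⊗ₘ y) ⊗ₘ z) = ((x ⊗ₘ y) ⊗ₘ z) := by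
    simp only [tensorHom_comp_tensorHom, hx, hy, hz]
  have a1 := MonoidalCategory.associator_naturality x y z
  have a2 := MonoidalCategory.associator_naturality y x z
  have b1 := braid_nat x (y ⊗ₘ z)
  rw [e1, e2]
  simp only [Category.assoc]
  rw [← reassoc_of% b1, ← reassoc_of% a1, ← reassoc_of% a1, reassoc_of% i2, reassoc_of% i2,
    ← reassoc_of% a2, ← reassoc_of% e3, ← reassoc_of% e3, reassoc_of% i2, reassoc_of% i2,
    BraidedCategory.hexagon_forward]

theorem hexagon_reverse_idem [BraidedCategory C] {X Y Z : C} {x : X ⟶ X} {y : Y ⟶ Y} {z : Z ⟶ Z}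
    (hx : x ≫ x = x) (hy : y ≫ y = y) (hz : z ≫ z = z) :
    ((x ⊗ₘ (y ⊗ₘ z)) ≫ (α_ X Y Z).inv) ≫ (((x ⊗ₘ y) ⊗ₘ z) ≫ (β_ (X ⊗ Y) Z).hom) ≫
      ((z ⊗ₘ (x ⊗ₘ y)) ≫ (α_ Z X Y).inv) =
    (x ⊗ₘ ((y ⊗ₘ z) ≫ (β_ Y Z).hom)) ≫ ((x ⊗ₘ (z ⊗ₘ y)) ≫ (α_ X Z Y).inv) ≫
      (((x ⊗ₘ z) ≫ (β_ X Z).hom) ⊗ₘ y) := by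
  have e1 : (((x ⊗ₘ z) ≫ (β_ X Z).hom) ⊗ₘ y) = ((x ⊗ₘ z) ⊗ₘ y) ≫ ((β_ X Z).hom ▷ Y) := by
    rw [← tensorHom_id, tensorHom_comp_tensorHom, Category.comp_id]
  have e2 : (x ⊗ₘ ((y ⊗ₘ z) ≫ (β_ Y Z).hom)) = (x ⊗ₘ (y ⊗ₘ z)) ≫ (X ◁ (β_ Y Z).hom) := by
    rw [← id_tensorHom, tensorHom_comp_tensorHom, Category.comp_id]
  have e3 : (x ⊗ₘ (y ⊗ₘ z)) ≫ (X ◁ (β_ Y Z).hom) = (X ◁ (β_ Y Z).hom) ≫ (x ⊗ₘ (z ⊗ₘ y)) := by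
    rw [← id_tensorHom, tensorHom_comp_tensorHom, tensorHom_comp_tensorHom, Category.comp_id,
      Category.id_comp, braid_nat]
  have i2 : (x ⊗ₘ (y ⊗ₘ z)) ≫ (x ⊗ₘ (y ⊗ₘ z)) = (x ⊗ₘ (y ⊗ₘ z)) := by
    simp only [tensorHom_comp_tensorHom, hx, hy, hz]
  have a1 := associator_inv_naturality x y z
  have a2 := associator_inv_naturality x z y
  have b1 := braid_nat (x ⊗ₘ y) z
  rw [e1, e2]
  simp only [Category.assoc]
  rw [← reassoc_of% b1, ← reassoc_of% a1, ← reassoc_of% a1, reassoc_of% i2, reassoc_of% i2,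
    ← reassoc_of% a2, ← reassoc_of% e3, ← reassoc_of% e3, reassoc_of% i2, reassoc_of% i2,
    BraidedCategory.hexagon_reverse]

instance [BraidedCategory C] : BraidedCategory (Karoubi C) where
  braiding P Q := karoubiIso (P ⊗ Q) (Q ⊗ P) (β_ P.X Q.X) (braid_nat P.p Q.p)
  braiding_naturality_right X Y Z f := Karoubi.hom_ext _ _ (by
    change (X.p ⊗ₘ f.f) ≫ (X.p ⊗ₘ Z.p) ≫ (β_ X.X Z.X).hom =
      ((X.p ⊗ₘ Y.p) ≫ (β_ X.X Y.X).hom) ≫ (f.f ⊗ₘ X.p)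
    rw [Category.assoc, ← braid_nat, ← Category.assoc, ← Category.assoc]
    simp only [tensorHom_comp_tensorHom, Karoubi.comp_p, Karoubi.p_comp])
  braiding_naturality_left {X Y} f Z := Karoubi.hom_ext _ _ (by
    change (f.f ⊗ₘ Z.p) ≫ (Y.p ⊗ₘ Z.p) ≫ (β_ Y.X Z.X).hom =
      ((X.p ⊗ₘ Z.p) ≫ (β_ X.X Z.X).hom) ≫ (Z.p ⊗ₘ f.f)
    rw [Category.assoc, ← braid_nat, ← Category.assoc, ← Category.assoc]
    simp only [tensorHom_comp_tensorHom, Karoubi.comp_p, Karoubi.p_comp])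
  hexagon_forward X Y Z := Karoubi.hom_ext _ _ (hexagon_forward_idem X.idem Y.idem Z.idem)
  hexagon_reverse X Y Z := Karoubi.hom_ext _ _ (hexagon_reverse_idem X.idem Y.idem Z.idem)
end IdempotentCompletion

section Diagrams

/-- Expressions for planar diagrams, read upwards from `m` dots on the bottom to `n` dots on the
top: vertical strands, the cup, the cap, vertical stacking (the first argument at the bottom) and
horizontal juxtaposition. -/
inductive DiagramTerm : ℕ → ℕ → Type
  | id (n : ℕ) : DiagramTerm n n
  | cup : DiagramTerm 0 2
  | cap : DiagramTerm 2 0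
  | comp {l m n : ℕ} (f : DiagramTerm l m) (g : DiagramTerm m n) : DiagramTerm l n
  | tensor {m n m' n' : ℕ} (f : DiagramTerm m n) (g : DiagramTerm m' n') :
      DiagramTerm (m + m') (n + n')

namespace DiagramTerm

/-- Transport along equalities of the numbers of dots. -/
def cast {m n m' n' : ℕ} (hm : m = m') (hn : n = n') (f : DiagramTerm m n) : DiagramTerm m' n' :=
  hm ▸ hn ▸ f

/-- Planar isotopy of diagrams: the congruence generated by the axioms of a strict monoidal
category (identities, associativity of stacking and of juxtaposition, independence of the heights
of horizontally separated pieces) and the two straightenings of a zigzag. No relation is imposed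
on closed loops. -/
inductive Isotopic : ∀ {m n : ℕ}, DiagramTerm m n → DiagramTerm m n → Prop
  | refl {m n} (f : DiagramTerm m n) : Isotopic f f
  | symm {m n} {f g : DiagramTerm m n} : Isotopic f g → Isotopic g f
  | trans {m n} {f g h : DiagramTerm m n} : Isotopic f g → Isotopic g h → Isotopic f h
  | comp {l m n} {f f' : DiagramTerm l m} {g g' : DiagramTerm m n} :
      Isotopic f f' → Isotopic g g' → Isotopic (f.comp g) (f'.comp g')
  | tensor {m n m' n'} {f f' : DiagramTerm m n} {g g' : DiagramTerm m' n'} :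
      Isotopic f f' → Isotopic g g' → Isotopic (f.tensor g) (f'.tensor g')
  | id_comp {m n} (f : DiagramTerm m n) : Isotopic ((id m).comp f) f
  | comp_id {m n} (f : DiagramTerm m n) : Isotopic (f.comp (id n)) f
  | comp_assoc {k l m n} (f : DiagramTerm k l) (g : DiagramTerm l m) (h : DiagramTerm m n) :
      Isotopic ((f.comp g).comp h) (f.comp (g.comp h))
  | id_tensor_id (m n : ℕ) : Isotopic ((id m).tensor (id n)) (id (m + n))
  | interchange {l m n l' m' n'} (f : DiagramTerm l m) (f' : DiagramTerm l' m')
      (g : DiagramTerm m n) (g' : DiagramTerm m' n') :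
      Isotopic ((f.tensor f').comp (g.tensor g')) ((f.comp g).tensor (f'.comp g'))
  | tensor_assoc {a b c a' b' c'} (f : DiagramTerm a a') (g : DiagramTerm b b')
      (h : DiagramTerm c c') :
      Isotopic (((f.tensor g).tensor h).cast (Nat.add_assoc a b c) (Nat.add_assoc a' b' c'))
        (f.tensor (g.tensor h))
  | empty_tensor {m n} (f : DiagramTerm m n) :
      Isotopic (((id 0).tensor f).cast (Nat.zero_add m) (Nat.zero_add n)) f
  | tensor_empty {m n} (f : DiagramTerm m n) : Isotopic (f.tensor (id 0)) f
  | zigzag_left : Isotopic ((cup.tensor (id 1)).comp ((id 1).tensor cap)) (id 1)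
  | zigzag_right : Isotopic (((id 1).tensor cup).comp (cap.tensor (id 1))) (id 1)

/-- Planar isotopy as a setoid. -/
instance isotopy (m n : ℕ) : Setoid (DiagramTerm m n) :=
  ⟨Isotopic, Isotopic.refl, Isotopic.symm, Isotopic.trans⟩

end DiagramTerm

open DiagramTerm

/-- Planar diagrams from `m` dots to `n` dots, up to planar isotopy. -/
def Diagram (m n : ℕ) : Type := _root_.Quotient (isotopy m n)

namespace Diagram

/-- Vertical stacking, the first argument at the bottom. -/
def comp {l m n : ℕ} : Diagram l m → Diagram m n → Diagram l n :=
  Quotient.map₂ DiagramTerm.comp fun _ _ h _ _ h' => Isotopic.comp h h'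

/-- Horizontal juxtaposition. -/
def tensor {m n m' n' : ℕ} : Diagram m n → Diagram m' n' → Diagram (m + m') (n + n') :=
  Quotient.map₂ DiagramTerm.tensor fun _ _ h _ _ h' => Isotopic.tensor h h'

end Diagram

/-- The category of planar diagrams; its objects are the natural numbers (wrapped, since `ℕ`
already carries the category structure of its order). -/
structure DiagramCat where
  /-- the number of dots -/
  dots : ℕ

namespace DiagramCat

instance : Category DiagramCat where
  Hom X Y := Diagram X.dots Y.dots
  id X := ⟦DiagramTerm.id X.dots⟧
  comp f g := Diagram.comp f g
  id_comp := by rintro X Y ⟨f⟩; exact Quotient.sound (Isotopic.id_comp f)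
  comp_id := by rintro X Y ⟨f⟩; exact Quotient.sound (Isotopic.comp_id f)
  assoc := by rintro W X Y Z ⟨f⟩ ⟨g⟩ ⟨h⟩; exact Quotient.sound (Isotopic.comp_assoc f g h)

/-- The diagram represented by an expression. -/
def ofTerm {m n : ℕ} (f : DiagramTerm m n) : (⟨m⟩ : DiagramCat) ⟶ ⟨n⟩ := (⟦f⟧ : Diagram m n)

/-- Equal numbers of dots give isomorphic objects. -/
def iso {m n : ℕ} (h : m = n) : (⟨m⟩ : DiagramCat) ≅ ⟨n⟩ := eqToIso (congrArg DiagramCat.mk h)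

instance : MonoidalCategoryStruct DiagramCat where
  tensorObj X Y := ⟨X.dots + Y.dots⟩
  tensorHom f g := Diagram.tensor f g
  whiskerLeft X _ _ f := Diagram.tensor (⟦DiagramTerm.id X.dots⟧ : Diagram X.dots X.dots) f
  whiskerRight f X := Diagram.tensor f (⟦DiagramTerm.id X.dots⟧ : Diagram X.dots X.dots)
  tensorUnit := ⟨0⟩
  associator X Y Z := iso (Nat.add_assoc X.dots Y.dots Z.dots)
  leftUnitor X := iso (Nat.zero_add X.dots)
  rightUnitor X := iso (Nat.add_zero X.dots)

theorem ofTerm_cast {m n m' n' : ℕ} (hm : m = m') (hn : n = n') (f : DiagramTerm m n) :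
    ofTerm (f.cast hm hn) = (iso hm).inv ≫ ofTerm f ≫ (iso hn).hom := by
  subst hm hn
  exact ((Category.id_comp _).trans (Category.comp_id _)).symm

theorem ofTerm_tensor {m n m' n' : ℕ} (f : DiagramTerm m n) (g : DiagramTerm m' n') :
    ofTerm (f.tensor g) = ofTerm f ⊗ₘ ofTerm g := rfl

theorem iso_tensor_id {m n : ℕ} (h : m = n) (k : ℕ) :
    (iso h).hom ⊗ₘ 𝟙 (⟨k⟩ : DiagramCat) = (iso (congrArg (· + k) h)).hom := by
  subst h; exact Quotient.sound (Isotopic.id_tensor_id m k)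

theorem id_tensor_iso {m n : ℕ} (h : m = n) (k : ℕ) :
    𝟙 (⟨k⟩ : DiagramCat) ⊗ₘ (iso h).hom = (iso (congrArg (k + ·) h)).hom := by
  subst h; exact Quotient.sound (Isotopic.id_tensor_id k m)

theorem iso_trans {l m n : ℕ} (h : l = m) (h' : m = n) :
    (iso h).hom ≫ (iso h').hom = (iso (h.trans h')).hom := by
  subst h h'; exact Category.id_comp _

instance : MonoidalCategory DiagramCat := MonoidalCategory.ofTensorHom
  (id_tensorHom_id := fun X Y => Quotient.sound (Isotopic.id_tensor_id X.dots Y.dots))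
  (id_tensorHom := fun _ _ _ _ => rfl)
  (tensorHom_id := fun _ _ => rfl)
  (tensorHom_comp_tensorHom := by
    rintro X₁ Y₁ Z₁ X₂ Y₂ Z₂ ⟨f₁⟩ ⟨f₂⟩ ⟨g₁⟩ ⟨g₂⟩
    exact Quotient.sound (Isotopic.interchange f₁ f₂ g₁ g₂))
  (associator_naturality := by
    rintro ⟨x₁⟩ ⟨x₂⟩ ⟨x₃⟩ ⟨y₁⟩ ⟨y₂⟩ ⟨y₃⟩ ⟨f₁⟩ ⟨f₂⟩ ⟨f₃⟩
    have h : ofTerm _ = ofTerm _ := Quotient.sound (Isotopic.tensor_assoc f₁ f₂ f₃)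
    rw [ofTerm_cast, Iso.inv_comp_eq] at h
    exact h)
  (leftUnitor_naturality := by
    rintro ⟨x⟩ ⟨y⟩ ⟨f⟩
    have h : ofTerm _ = ofTerm _ := Quotient.sound (Isotopic.empty_tensor f)
    rw [ofTerm_cast, Iso.inv_comp_eq] at h
    exact h)
  (rightUnitor_naturality := by
    rintro ⟨x⟩ ⟨y⟩ ⟨f⟩
    have h : ofTerm _ = ofTerm _ := Quotient.sound (Isotopic.tensor_empty f)
    have h' : ofTerm (f.tensor (DiagramTerm.id 0)) ≫ 𝟙 _ = 𝟙 _ ≫ ofTerm f :=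
      (Category.comp_id _).trans (h.trans (Category.id_comp _).symm)
    exact h')
  (pentagon := by
    rintro ⟨w⟩ ⟨x⟩ ⟨y⟩ ⟨z⟩
    change ((iso _).hom ⊗ₘ 𝟙 (⟨z⟩ : DiagramCat)) ≫ (iso _).hom ≫
      (𝟙 (⟨w⟩ : DiagramCat) ⊗ₘ (iso _).hom) = (iso _).hom ≫ (iso _).hom
    rw [iso_tensor_id, id_tensor_iso]
    exact (congrArg _ (iso_trans _ _)).trans ((iso_trans _ _).trans (iso_trans _ _).symm))
  (triangle := by
    rintro ⟨x⟩ ⟨y⟩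
    change (iso _).hom ≫ (𝟙 (⟨x⟩ : DiagramCat) ⊗ₘ (iso _).hom) =
      (iso _).hom ⊗ₘ 𝟙 (⟨y⟩ : DiagramCat)
    rw [iso_tensor_id, id_tensor_iso]
    exact iso_trans _ _)

/-- The cup, a diagram from no dots to two dots. -/
def cup : 𝟙_ DiagramCat ⟶ (⟨1⟩ ⊗ ⟨1⟩ : DiagramCat) := ofTerm DiagramTerm.cup

/-- The cap, a diagram from two dots to no dots. -/
def cap : (⟨1⟩ ⊗ ⟨1⟩ : DiagramCat) ⟶ 𝟙_ DiagramCat := ofTerm DiagramTerm.cap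

end DiagramCat
end Diagrams

section Kauffman
set_option linter.unusedSectionVars false
universe v u

section
variable {C : Type u} [Category.{v} C] [MonoidalCategory C] {A M N B M' N' : C}

theorem hb_unit (b : A ⊗ M ⟶ M ⊗ A) :
    (A ◁ (ρ_ M).hom) ≫ b ≫ ((ρ_ M).inv ▷ A) =
      (α_ A M (𝟙_ C)).inv ≫ b ▷ (𝟙_ C) ≫ (α_ M A (𝟙_ C)).hom ≫
        M ◁ ((ρ_ A).hom ≫ (λ_ A).inv) ≫ (α_ M (𝟙_ C) A).inv := by
  monoidal

theorem hb_succ (b : A ⊗ M ⟶ M ⊗ A) (b' : A ⊗ N ⟶ N ⊗ A) (s : A ⊗ B ⟶ B ⊗ A) :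
    (A ◁ (α_ M N B).inv) ≫
      ((α_ A (M ⊗ N) B).inv ≫
        (((α_ A M N).inv ≫ b ▷ N ≫ (α_ M A N).hom ≫ M ◁ b' ≫ (α_ M N A).inv) ▷ B) ≫
          (α_ (M ⊗ N) A B).hom ≫ (M ⊗ N) ◁ s ≫ (α_ (M ⊗ N) B A).inv) ≫ ((α_ M N B).hom ▷ A) =
    (α_ A M (N ⊗ B)).inv ≫ b ▷ (N ⊗ B) ≫ (α_ M A (N ⊗ B)).hom ≫
      M ◁ ((α_ A N B).inv ≫ b' ▷ B ≫ (α_ N A B).hom ≫ N ◁ s ≫ (α_ N B A).inv) ≫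
        (α_ M (N ⊗ B) A).inv := by
  monoidal

/-- Naturality of a half-braiding in a tensor product. -/
theorem hb_nat_tensor {b : A ⊗ M ⟶ M ⊗ A} {b' : A ⊗ N ⟶ N ⊗ A} {d : A ⊗ M' ⟶ M' ⊗ A}
    {d' : A ⊗ N' ⟶ N' ⊗ A} {f : M ⟶ M'} {g : N ⟶ N'} (hf : A ◁ f ≫ d = b ≫ f ▷ A)
    (hg : A ◁ g ≫ d' = b' ≫ g ▷ A) :
    A ◁ (f ⊗ₘ g) ≫ ((α_ A M' N').inv ≫ d ▷ N' ≫ (α_ M' A N').hom ≫ M' ◁ d' ≫ (α_ M' N' A).inv) =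
      ((α_ A M N).inv ≫ b ▷ N ≫ (α_ M A N).hom ≫ M ◁ b' ≫ (α_ M N A).inv) ≫ (f ⊗ₘ g) ▷ A := by
  calc _ = (α_ A M N).inv ≫ (A ⊗ M) ◁ g ≫ (A ◁ f ≫ d) ▷ N' ≫ (α_ M' A N').hom ≫ M' ◁ d' ≫
            (α_ M' N' A).inv := by
        rw [MonoidalCategory.tensorHom_def']; simp
    _ = (α_ A M N).inv ≫ ((A ⊗ M) ◁ g ≫ b ▷ N') ≫ f ▷ A ▷ N' ≫ (α_ M' A N').hom ≫ M' ◁ d' ≫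
            (α_ M' N' A).inv := by
        rw [hf]; simp
    _ = (α_ A M N).inv ≫ b ▷ N ≫ (M ⊗ A) ◁ g ≫ (α_ M A N').hom ≫ (f ▷ (A ⊗ N') ≫ M' ◁ d') ≫
            (α_ M' N' A).inv := by
        rw [whisker_exchange]; simp
    _ = (α_ A M N).inv ≫ b ▷ N ≫ (α_ M A N).hom ≫ M ◁ (A ◁ g ≫ d') ≫ f ▷ (N' ⊗ A) ≫
            (α_ M' N' A).inv := by
        rw [← whisker_exchange]; simp
    _ = _ := by
        rw [hg, MonoidalCategory.tensorHom_def']; simp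

/-- Naturality, in its first variable, of a braiding with a tensor product. -/
theorem hb_nat_tensor' {P Q : C} {f : P ⟶ Q} {b : P ⊗ M ⟶ M ⊗ P} {b' : P ⊗ N ⟶ N ⊗ P}
    {d : Q ⊗ M ⟶ M ⊗ Q} {d' : Q ⊗ N ⟶ N ⊗ Q} (hM : f ▷ M ≫ d = b ≫ M ◁ f)
    (hN : f ▷ N ≫ d' = b' ≫ N ◁ f) :
    f ▷ (M ⊗ N) ≫ ((α_ Q M N).inv ≫ d ▷ N ≫ (α_ M Q N).hom ≫ M ◁ d' ≫ (α_ M N Q).inv) =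
      ((α_ P M N).inv ≫ b ▷ N ≫ (α_ M P N).hom ≫ M ◁ b' ≫ (α_ M N P).inv) ≫ (M ⊗ N) ◁ f := by
  calc _ = (α_ P M N).inv ≫ (f ▷ M ≫ d) ▷ N ≫ (α_ M Q N).hom ≫ M ◁ d' ≫ (α_ M N Q).inv := by
        simp
    _ = (α_ P M N).inv ≫ b ▷ N ≫ (α_ M P N).hom ≫ M ◁ (f ▷ N ≫ d') ≫ (α_ M N Q).inv := by
        rw [hM]; simp
    _ = _ := by rw [hN]; simp

end

variable {C : Type u} [Category.{v} C] [Preadditive C] [Linear ℂ C] [MonoidalCategory C]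
  [MonoidalPreadditive C] [MonoidalLinear ℂ C] {A : C}

/-- The crossing `t • 1 + t⁻¹ • (cup ∘ cap)`. -/
def crossing (t : ℂ) (η : 𝟙_ C ⟶ A ⊗ A) (ε : A ⊗ A ⟶ 𝟙_ C) : A ⊗ A ⟶ A ⊗ A :=
  t • 𝟙 (A ⊗ A) + t⁻¹ • (ε ≫ η)

theorem crossing_inv {t : ℂ} (ht : t ≠ 0) {η : 𝟙_ C ⟶ A ⊗ A} {ε : A ⊗ A ⟶ 𝟙_ C}
    (hl : η ≫ ε = (-t ^ 2 - (t⁻¹) ^ 2) • 𝟙 (𝟙_ C)) :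
    crossing t η ε ≫ crossing t⁻¹ η ε = 𝟙 _ := by
  have h : (ε ≫ η) ≫ (ε ≫ η) = (-t ^ 2 - (t⁻¹) ^ 2) • (ε ≫ η) := by
    rw [Category.assoc, reassoc_of% hl, Linear.smul_comp, Linear.comp_smul, Category.id_comp]
  simp only [crossing, Preadditive.add_comp, Preadditive.comp_add, Linear.smul_comp,
    Linear.comp_smul, Category.id_comp, Category.comp_id, h, smul_smul, smul_add]
  match_scalars <;> field_simp
  ring

/-- The crossing as an isomorphism. -/
def crossingIso (t : ℂ) (ht : t ≠ 0) (η : 𝟙_ C ⟶ A ⊗ A) (ε : A ⊗ A ⟶ 𝟙_ C)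
    (hl : η ≫ ε = (-t ^ 2 - (t⁻¹) ^ 2) • 𝟙 (𝟙_ C)) : A ⊗ A ≅ A ⊗ A where
  hom := crossing t η ε
  inv := crossing t⁻¹ η ε
  hom_inv_id := crossing_inv ht hl
  inv_hom_id := by
    have h := crossing_inv (inv_ne_zero ht) (η := η) (ε := ε) (by
      rw [hl, inv_inv]; congr 1; ring)
    rwa [inv_inv] at h

theorem crossing_wl (t : ℂ) (η : 𝟙_ C ⟶ A ⊗ A) (ε : A ⊗ A ⟶ 𝟙_ C) :
    A ◁ crossing t η ε = t • 𝟙 _ + t⁻¹ • (A ◁ ε ≫ A ◁ η) := by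
  simp [crossing]

theorem crossing_wr (t : ℂ) (η : 𝟙_ C ⟶ A ⊗ A) (ε : A ⊗ A ⟶ 𝟙_ C) :
    crossing t η ε ▷ A = t • 𝟙 _ + t⁻¹ • (ε ▷ A ≫ η ▷ A) := by
  simp [crossing]

/-- Two-layer expansion of a pair of crossings. -/
theorem expand_two {X Y Z W : C} (t : ℂ) (ht : t ≠ 0) (x : X ⟶ Y) (p : Y ⟶ Y) (a : Y ≅ Z)
    (q : Z ⟶ Z) (y : Z ⟶ W) (r : X ⟶ W) (hp : x ≫ p ≫ a.hom ≫ y = r)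
    (hq : x ≫ a.hom ≫ q ≫ y = (-t ^ 2 - (t⁻¹) ^ 2) • (x ≫ a.hom ≫ y))
    (hpq : x ≫ p ≫ a.hom ≫ q ≫ y = x ≫ a.hom ≫ y) :
    x ≫ (t • 𝟙 _ + t⁻¹ • p) ≫ a.hom ≫ (t • 𝟙 _ + t⁻¹ • q) ≫ y = r := by
  simp only [Preadditive.add_comp, Preadditive.comp_add, Linear.smul_comp,
    Linear.comp_smul, Category.id_comp, hp, hq, hpq, smul_smul, smul_add]
  match_scalars <;> field_simp
  ring

theorem expand_two' {X Y Z W : C} (t : ℂ) (ht : t ≠ 0) (x : X ⟶ Y) (p : Y ⟶ Y) (a : Y ≅ Z)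
    (q : Z ⟶ Z) (y : Z ⟶ W) (r : X ⟶ W) (hq : x ≫ a.hom ≫ q ≫ y = r)
    (hp : x ≫ p ≫ a.hom ≫ y = (-t ^ 2 - (t⁻¹) ^ 2) • (x ≫ a.hom ≫ y))
    (hpq : x ≫ p ≫ a.hom ≫ q ≫ y = x ≫ a.hom ≫ y) :
    x ≫ (t • 𝟙 _ + t⁻¹ • p) ≫ a.hom ≫ (t • 𝟙 _ + t⁻¹ • q) ≫ y = r := by
  simp only [Preadditive.add_comp, Preadditive.comp_add, Linear.smul_comp,
    Linear.comp_smul, Category.id_comp, hp, hq, hpq, smul_smul, smul_add]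
  match_scalars <;> field_simp
  ring

variable {t : ℂ} {η : 𝟙_ C ⟶ A ⊗ A} {ε : A ⊗ A ⟶ 𝟙_ C}

theorem cup_slide (ht : t ≠ 0) (hl : η ≫ ε = (-t ^ 2 - (t⁻¹) ^ 2) • 𝟙 (𝟙_ C))
    (z₁ : A ◁ η ≫ (α_ A A A).inv ≫ ε ▷ A = (ρ_ A).hom ≫ (λ_ A).inv)
    (z₂ : η ▷ A ≫ (α_ A A A).hom ≫ A ◁ ε = (λ_ A).hom ≫ (ρ_ A).inv) :
    A ◁ η ≫ (α_ A A A).inv ≫ crossing t η ε ▷ A ≫ (α_ A A A).hom ≫ A ◁ crossing t η ε ≫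
      (α_ A A A).inv = ((ρ_ A).hom ≫ (λ_ A).inv) ≫ η ▷ A := by
  have hl' : A ◁ η ≫ A ◁ ε = (-t ^ 2 - (t⁻¹) ^ 2) • 𝟙 _ := by
    rw [← MonoidalCategory.whiskerLeft_comp, hl]; simp
  have h := expand_two t ht (A ◁ η ≫ (α_ A A A).inv) (ε ▷ A ≫ η ▷ A) (α_ A A A) (A ◁ ε ≫ A ◁ η)
    (α_ A A A).inv (((ρ_ A).hom ≫ (λ_ A).inv) ≫ η ▷ A)
    (by simp only [Category.assoc, reassoc_of% z₁, Iso.hom_inv_id, Category.comp_id])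
    (by simp only [Category.assoc, Iso.inv_hom_id_assoc, reassoc_of% hl', Linear.smul_comp,
          Category.id_comp])
    (by simp only [Category.assoc, reassoc_of% z₁, reassoc_of% z₂, Iso.inv_hom_id_assoc,
          Iso.hom_inv_id_assoc])
  rw [crossing_wl, crossing_wr]
  simpa only [Category.assoc] using h

theorem cap_slide (ht : t ≠ 0) (hl : η ≫ ε = (-t ^ 2 - (t⁻¹) ^ 2) • 𝟙 (𝟙_ C))
    (z₁ : A ◁ η ≫ (α_ A A A).inv ≫ ε ▷ A = (ρ_ A).hom ≫ (λ_ A).inv)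
    (z₂ : η ▷ A ≫ (α_ A A A).hom ≫ A ◁ ε = (λ_ A).hom ≫ (ρ_ A).inv) :
    ((α_ A A A).inv ≫ crossing t η ε ▷ A ≫ (α_ A A A).hom ≫ A ◁ crossing t η ε ≫
      (α_ A A A).inv) ≫ ε ▷ A = A ◁ ε ≫ (ρ_ A).hom ≫ (λ_ A).inv := by
  have hl' : η ▷ A ≫ ε ▷ A = (-t ^ 2 - (t⁻¹) ^ 2) • 𝟙 _ := by
    rw [← MonoidalCategory.comp_whiskerRight, hl]; simp
  have h := expand_two' t ht (α_ A A A).inv (ε ▷ A ≫ η ▷ A) (α_ A A A) (A ◁ ε ≫ A ◁ η)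
    ((α_ A A A).inv ≫ ε ▷ A) (A ◁ ε ≫ (ρ_ A).hom ≫ (λ_ A).inv)
    (by simp only [Category.assoc, z₁, Iso.inv_hom_id_assoc])
    (by simp only [Category.assoc, Iso.hom_inv_id_assoc, hl', Linear.comp_smul,
          Category.comp_id])
    (by simp only [Category.assoc, z₁, reassoc_of% z₂, Iso.inv_hom_id_assoc]; simp)
  rw [crossing_wl, crossing_wr]
  simpa only [Category.assoc] using h

theorem cup_slide' (ht : t ≠ 0) (hl : η ≫ ε = (-t ^ 2 - (t⁻¹) ^ 2) • 𝟙 (𝟙_ C))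
    (z₁ : A ◁ η ≫ (α_ A A A).inv ≫ ε ▷ A = (ρ_ A).hom ≫ (λ_ A).inv)
    (z₂ : η ▷ A ≫ (α_ A A A).hom ≫ A ◁ ε = (λ_ A).hom ≫ (ρ_ A).inv) :
    η ▷ A ≫ (α_ A A A).hom ≫ A ◁ crossing t η ε ≫ (α_ A A A).inv ≫ crossing t η ε ▷ A ≫
      (α_ A A A).hom = ((λ_ A).hom ≫ (ρ_ A).inv) ≫ A ◁ η := by
  have hl' : η ▷ A ≫ ε ▷ A = (-t ^ 2 - (t⁻¹) ^ 2) • 𝟙 _ := by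
    rw [← MonoidalCategory.comp_whiskerRight, hl]; simp
  have h := expand_two t ht (η ▷ A ≫ (α_ A A A).hom) (A ◁ ε ≫ A ◁ η) (α_ A A A).symm
    (ε ▷ A ≫ η ▷ A) (α_ A A A).hom (((λ_ A).hom ≫ (ρ_ A).inv) ≫ A ◁ η)
    (by simp only [Category.assoc, reassoc_of% z₂, Iso.symm_hom, Iso.inv_hom_id,
          Category.comp_id])
    (by simp only [Category.assoc, Iso.symm_hom, Iso.hom_inv_id_assoc, reassoc_of% hl',
          Linear.smul_comp, Category.id_comp])
    (by simp only [Category.assoc, reassoc_of% z₁, reassoc_of% z₂, Iso.symm_hom,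
          Iso.inv_hom_id_assoc, Iso.hom_inv_id_assoc])
  rw [crossing_wl, crossing_wr]
  simpa only [Category.assoc, Iso.symm_hom] using h

theorem cap_slide' (ht : t ≠ 0) (hl : η ≫ ε = (-t ^ 2 - (t⁻¹) ^ 2) • 𝟙 (𝟙_ C))
    (z₁ : A ◁ η ≫ (α_ A A A).inv ≫ ε ▷ A = (ρ_ A).hom ≫ (λ_ A).inv)
    (z₂ : η ▷ A ≫ (α_ A A A).hom ≫ A ◁ ε = (λ_ A).hom ≫ (ρ_ A).inv) :
    ((α_ A A A).hom ≫ A ◁ crossing t η ε ≫ (α_ A A A).inv ≫ crossing t η ε ▷ A ≫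
      (α_ A A A).hom) ≫ A ◁ ε = ε ▷ A ≫ (λ_ A).hom ≫ (ρ_ A).inv := by
  have hl' : A ◁ η ≫ A ◁ ε = (-t ^ 2 - (t⁻¹) ^ 2) • 𝟙 _ := by
    rw [← MonoidalCategory.whiskerLeft_comp, hl]; simp
  have h := expand_two' t ht (α_ A A A).hom (A ◁ ε ≫ A ◁ η) (α_ A A A).symm (ε ▷ A ≫ η ▷ A)
    ((α_ A A A).hom ≫ A ◁ ε) (ε ▷ A ≫ (λ_ A).hom ≫ (ρ_ A).inv)
    (by simp only [Category.assoc, z₂, Iso.symm_hom, Iso.hom_inv_id_assoc])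
    (by simp only [Category.assoc, Iso.symm_hom, hl', Linear.comp_smul, Category.comp_id,
          Iso.inv_hom_id_assoc])
    (by simp only [Category.assoc, Iso.symm_hom, z₂, reassoc_of% z₁, Iso.hom_inv_id_assoc]; simp)
  rw [crossing_wl, crossing_wr]
  simpa only [Category.assoc, Iso.symm_hom] using h

end Kauffman

section TemperleyLieb

/-- `t = exp (π i / (2 k + 4))`. -/
def rootT (k : ℕ) : ℂ := Complex.exp (Real.pi * Complex.I / (2 * k + 4))

/-- `q = t ^ 2`. -/
def rootQ (k : ℕ) : ℂ := rootT k ^ 2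

/-- The quantum integer `[i] = (q ^ i - q ^ (-i)) / (q - q ^ (-1))`. -/
def qInt (k i : ℕ) : ℂ := (rootQ k ^ i - (rootQ k)⁻¹ ^ i) / (rootQ k - (rootQ k)⁻¹)

/-- The loop value `δ = -q - q⁻¹`. -/
def loopValue (k : ℕ) : ℂ := -rootQ k - (rootQ k)⁻¹

theorem rootT_ne_zero (k : ℕ) : rootT k ≠ 0 := Complex.exp_ne_zero _

theorem loopValue_eq (k : ℕ) : loopValue k = -rootT k ^ 2 - ((rootT k)⁻¹) ^ 2 := by
  rw [loopValue, rootQ, inv_pow]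

/-- The relation "a loop equals `δ`", as an endomorphism of the empty object. -/
def loopRelation (k : ℕ) : 𝟙_ (Linearization DiagramCat) ⟶ 𝟙_ (Linearization DiagramCat) :=
  Linearization.ι (DiagramCat.cup ≫ DiagramCat.cap) - loopValue k • 𝟙 _

/-- `ℂ`-linear combinations of planar diagrams modulo the relation that every loop is equal
to `δ`, before any completion. -/
abbrev PreTL (k : ℕ) : Type := TensorQuotient (loopRelation k)

namespace PreTL
variable {k : ℕ}

/-- The object `n` (that is, `n` strands). -/
def strands (k n : ℕ) : PreTL k := ⟨⟨⟨n⟩⟩⟩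

/-- The morphism given by a planar diagram. -/
def ofDiagram {X Y : DiagramCat} (f : X ⟶ Y) : (⟨⟨X⟩⟩ : PreTL k) ⟶ ⟨⟨Y⟩⟩ :=
  (toQuot (loopRelation k)).map (Linearization.ι f)

theorem ofDiagram_comp {X Y Z : DiagramCat} (f : X ⟶ Y) (g : Y ⟶ Z) :
    (ofDiagram (f ≫ g) : (⟨⟨X⟩⟩ : PreTL k) ⟶ _) = ofDiagram f ≫ ofDiagram g :=
  (congrArg _ (Linearization.ι_comp f g)).trans (Functor.map_comp _ _ _)

theorem ofDiagram_tensor {X Y X' Y' : DiagramCat} (f : X ⟶ Y) (g : X' ⟶ Y') :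
    (ofDiagram (f ⊗ₘ g) : (⟨⟨X ⊗ X'⟩⟩ : PreTL k) ⟶ _) = ofDiagram f ⊗ₘ ofDiagram g :=
  (congrArg _ (Linearization.ι_tensor f g)).trans (toQuot_tensor _ _ _).symm

theorem ofDiagram_wl (Z : DiagramCat) {X Y : DiagramCat} (f : X ⟶ Y) :
    (ofDiagram (Z ◁ f) : (⟨⟨Z ⊗ X⟩⟩ : PreTL k) ⟶ _) = (⟨⟨Z⟩⟩ : PreTL k) ◁ ofDiagram f :=
  congrArg _ (Linearization.ι_wl Z f)

theorem ofDiagram_wr (Z : DiagramCat) {X Y : DiagramCat} (f : X ⟶ Y) :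
    (ofDiagram (f ▷ Z) : (⟨⟨X ⊗ Z⟩⟩ : PreTL k) ⟶ _) = ofDiagram f ▷ (⟨⟨Z⟩⟩ : PreTL k) :=
  congrArg _ (Linearization.ι_wr Z f)

/-- The cup. -/
def cup (k : ℕ) : 𝟙_ (PreTL k) ⟶ strands k 1 ⊗ strands k 1 := ofDiagram DiagramCat.cup

/-- The cap. -/
def cap (k : ℕ) : strands k 1 ⊗ strands k 1 ⟶ 𝟙_ (PreTL k) := ofDiagram DiagramCat.cap

theorem loop (k : ℕ) : cup k ≫ cap k = loopValue k • 𝟙 (𝟙_ (PreTL k)) := by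
  have h : idealRel (loopRelation k) (Linearization.ι (DiagramCat.cup ≫ DiagramCat.cap))
    (loopValue k • 𝟙 (𝟙_ (Linearization DiagramCat))) := TensorIdeal.of
  have h' := toQuot_eq _ h
  exact (ofDiagram_comp _ _).symm.trans h'

theorem assoc_one (m n : ℕ) :
    (α_ (strands k m) (strands k n) (strands k 1)).hom = 𝟙 (strands k (m + n + 1)) := rfl

theorem assoc_one_inv (m n : ℕ) :
    (α_ (strands k m) (strands k n) (strands k 1)).inv = 𝟙 (strands k (m + n + 1)) := rfl

theorem rightUnitor_eq (m : ℕ) : (ρ_ (strands k m)).hom = 𝟙 (strands k m) := rfl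
theorem rightUnitor_inv_eq (m : ℕ) : (ρ_ (strands k m)).inv = 𝟙 (strands k m) := rfl
theorem leftUnitor_one : (λ_ (strands k 1)).hom = 𝟙 (strands k 1) := rfl

theorem zigzag₁ : strands k 1 ◁ cup k ≫ (α_ (strands k 1) (strands k 1) (strands k 1)).inv ≫
    cap k ▷ strands k 1 = (ρ_ (strands k 1)).hom ≫ (λ_ (strands k 1)).inv := by
  have h : DiagramCat.ofTerm _ = DiagramCat.ofTerm _ :=
    Quotient.sound DiagramTerm.Isotopic.zigzag_right
  have h' := congrArg (ofDiagram (k := k)) h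
  refine Eq.trans ?_ (h'.trans ?_)
  · rw [assoc_one_inv]
    erw [Category.id_comp]
    refine Eq.trans ?_ (ofDiagram_comp (k := k) (Y := ⟨3⟩) ((⟨1⟩ : DiagramCat) ◁ DiagramCat.cup) (DiagramCat.cap ▷ (⟨1⟩ : DiagramCat))).symm
    rw [cup, cap]
    erw [ofDiagram_wl, ofDiagram_wr]
    rfl
  · exact (Category.id_comp _).symm

theorem zigzag₂ : cup k ▷ strands k 1 ≫ (α_ (strands k 1) (strands k 1) (strands k 1)).hom ≫
    strands k 1 ◁ cap k = (λ_ (strands k 1)).hom ≫ (ρ_ (strands k 1)).inv := by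
  have h : DiagramCat.ofTerm _ = DiagramCat.ofTerm _ :=
    Quotient.sound DiagramTerm.Isotopic.zigzag_left
  have h' := congrArg (ofDiagram (k := k)) h
  refine Eq.trans ?_ (h'.trans ?_)
  · rw [assoc_one]
    erw [Category.id_comp]
    refine Eq.trans ?_ (ofDiagram_comp (k := k) (Y := ⟨3⟩) (DiagramCat.cup ▷ (⟨1⟩ : DiagramCat)) ((⟨1⟩ : DiagramCat) ◁ DiagramCat.cap)).symm
    rw [cup, cap]
    erw [ofDiagram_wl, ofDiagram_wr]
    rfl
  · exact (Category.id_comp _).symm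

end PreTL
end TemperleyLieb

section Braiding
namespace PreTL
variable {k : ℕ}

/-- The braiding `σ₁,₁ = t • 1 + t⁻¹ • (cup ∘ cap)` of one strand with itself. -/
def crossingOne (k : ℕ) : strands k 1 ⊗ strands k 1 ≅ strands k 1 ⊗ strands k 1 :=
  crossingIso (rootT k) (rootT_ne_zero k) (cup k) (cap k) (by rw [loop, loopValue_eq])

/-- The braiding of one strand with `n` strands, by the hexagon axiom:
`σ₁,ₙ₊₁ = (1ₙ ⊗ σ₁,₁) ∘ (σ₁,ₙ ⊗ 1₁)`. -/
def braidOne (k : ℕ) : (n : ℕ) → (strands k 1 ⊗ strands k n ≅ strands k n ⊗ strands k 1)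
  | 0 => ρ_ (strands k 1) ≪≫ (λ_ (strands k 1)).symm
  | n + 1 => (α_ (strands k 1) (strands k n) (strands k 1)).symm ≪≫
      whiskerRightIso (braidOne k n) (strands k 1) ≪≫
      α_ (strands k n) (strands k 1) (strands k 1) ≪≫
      whiskerLeftIso (strands k n) (crossingOne k) ≪≫
      (α_ (strands k n) (strands k 1) (strands k 1)).symm

theorem braidOne_succ_hom (n : ℕ) : (braidOne k (n + 1)).hom =
    (α_ (strands k 1) (strands k n) (strands k 1)).inv ≫ (braidOne k n).hom ▷ strands k 1 ≫
      (α_ (strands k n) (strands k 1) (strands k 1)).hom ≫ strands k n ◁ (crossingOne k).hom ≫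
      (α_ (strands k n) (strands k 1) (strands k 1)).inv := rfl

theorem id_sandwich {C : Type*} [Category C] [MonoidalCategory C] {A M N : C} (b : A ⊗ M ⟶ N ⊗ A) :
    A ◁ 𝟙 M ≫ b ≫ 𝟙 N ▷ A = b := by simp

theorem braidOne_add (m n : ℕ) : (braidOne k (m + n)).hom =
    (α_ (strands k 1) (strands k m) (strands k n)).inv ≫ (braidOne k m).hom ▷ strands k n ≫
      (α_ (strands k m) (strands k 1) (strands k n)).hom ≫ strands k m ◁ (braidOne k n).hom ≫
      (α_ (strands k m) (strands k n) (strands k 1)).inv := by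
  induction n with
  | zero => exact (id_sandwich (braidOne k m).hom).symm.trans (hb_unit (braidOne k m).hom)
  | succ n ih =>
    have h := hb_succ (braidOne k m).hom (braidOne k n).hom (crossingOne k).hom
    rw [← ih] at h
    exact (id_sandwich (braidOne k (m + n + 1)).hom).symm.trans h

/-- Induction principle for morphisms. -/
theorem hom_induction {P : ∀ {m n : ℕ}, (strands k m ⟶ strands k n) → Prop}
    (h0 : ∀ m n, P (0 : strands k m ⟶ strands k n))
    (ha : ∀ {m n} (f g : strands k m ⟶ strands k n), P f → P g → P (f + g))
    (hs : ∀ {m n} (r : ℂ) (f : strands k m ⟶ strands k n), P f → P (r • f))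
    (hid : ∀ n, P (𝟙 (strands k n)))
    (hcup : P (m := 0) (n := 2) (cup k)) (hcap : P (m := 2) (n := 0) (cap k))
    (hcomp : ∀ {l m n} (f : strands k l ⟶ strands k m) (g : strands k m ⟶ strands k n),
      P f → P g → P (f ≫ g))
    (htensor : ∀ {m n m' n'} (f : strands k m ⟶ strands k n) (g : strands k m' ⟶ strands k n'),
      P f → P g → P (m := m + m') (n := n + n') (f ⊗ₘ g))
    {m n : ℕ} (f : strands k m ⟶ strands k n) : P f := by
  obtain ⟨f, rfl⟩ := toQuot_surj _ f
  induction f using Linearization.hom_induction with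
  | h0 => exact h0 m n
  | ha f g hf hg => exact ha _ _ hf hg
  | hs r f =>
    refine hs r (ofDiagram f) ?_
    obtain ⟨f⟩ := f
    have key : ∀ {m n : ℕ} (f : DiagramTerm m n), P (m := m) (n := n)
        (ofDiagram (DiagramCat.ofTerm f)) := by
      intro m n f
      induction f with
      | id n => exact hid n
      | cup => exact hcup
      | cap => exact hcap
      | comp f g hf hg =>
        have h := hcomp _ _ hf hg
        have e := ofDiagram_comp (k := k) (DiagramCat.ofTerm f) (DiagramCat.ofTerm g)
        exact e.symm ▸ h
      | tensor f g hf hg =>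
        have h := htensor _ _ hf hg
        have e := ofDiagram_tensor (k := k) (DiagramCat.ofTerm f) (DiagramCat.ofTerm g)
        exact e.symm ▸ h
    exact key f

theorem braidOne_one : (braidOne k 1).hom = (crossingOne k).hom := by
  have h {A B : PreTL k} (s : A ⊗ B ⟶ B ⊗ A) : A ◁ (λ_ B).hom ≫ s ≫ (λ_ B).inv ▷ A =
      (α_ A (𝟙_ _) B).inv ≫ ((ρ_ A).hom ≫ (λ_ A).inv) ▷ B ≫ (α_ (𝟙_ _) A B).hom ≫
        𝟙_ _ ◁ s ≫ (α_ (𝟙_ _) B A).inv := by monoidal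
  exact (h (crossingOne k).hom).symm.trans (id_sandwich (crossingOne k).hom)

theorem braidOne_nat {m n : ℕ} (f : strands k m ⟶ strands k n) :
    strands k 1 ◁ f ≫ (braidOne k n).hom = (braidOne k m).hom ≫ f ▷ strands k 1 := by
  induction f using hom_induction with
  | h0 => simp
  | ha f g hf hg => simp [hf, hg]
  | hs r f hf => simp [hf]
  | hid => simp
  | hcup =>
    have h := cup_slide (rootT_ne_zero k) (by rw [loop, loopValue_eq]) (zigzag₁ (k := k)) zigzag₂
    refine Eq.trans ?_ h
    rw [braidOne_add 1 1, braidOne_one]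
    rfl
  | hcap =>
    have h := cap_slide (rootT_ne_zero k) (by rw [loop, loopValue_eq]) (zigzag₁ (k := k)) zigzag₂
    refine Eq.trans ?_ (h.symm.trans ?_)
    · rfl
    rw [braidOne_add 1 1, braidOne_one]
    rfl
  | hcomp f g hf hg =>
    rw [whiskerLeft_comp, Category.assoc, hg, ← Category.assoc, hf, Category.assoc,
      comp_whiskerRight]
  | htensor f g hf hg =>
    have h := hb_nat_tensor hf hg
    rw [← braidOne_add, ← braidOne_add] at h
    exact h

end PreTL
end Braiding

section BraidingTwo
namespace PreTL
variable {k : ℕ}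

/-- The half-braiding of one strand. -/
def halfBraidingOne (k : ℕ) : HalfBraiding (strands k 1) where
  β U := braidOne k U.as.base.dots
  monoidal U V := braidOne_add U.as.base.dots V.as.base.dots
  naturality f := braidOne_nat f

/-- The half-braiding of `n` strands, by the hexagon axiom:
`σₙ₊₁,ᵤ = (σₙ,ᵤ ⊗ 1₁) ∘ (1ₙ ⊗ σ₁,ᵤ)`. -/
def halfBraiding (k : ℕ) : (n : ℕ) → HalfBraiding (strands k n)
  | 0 => Center.tensorUnit.2
  | n + 1 => (Center.tensorObj ⟨strands k n, halfBraiding k n⟩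
      ⟨strands k 1, halfBraidingOne k⟩).2

/-- `n` strands with their half-braiding. -/
def central (k n : ℕ) : Center (PreTL k) := ⟨strands k n, halfBraiding k n⟩

/-- One strand with its half-braiding. -/
def centralOne (k : ℕ) : Center (PreTL k) := ⟨strands k 1, halfBraidingOne k⟩

theorem eq_of_id_comm {C : Type*} [Category C] [MonoidalCategory C] {A U : C}
    (b c : A ⊗ U ⟶ U ⊗ A) (h : 𝟙 A ▷ U ≫ b = c ≫ U ◁ 𝟙 A) : b = c := by
  simpa using h

theorem eq_of_id_comm' {C : Type*} [Category C] [MonoidalCategory C] {A B U : C}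
    (b c : (A ⊗ B) ⊗ U ⟶ U ⊗ (A ⊗ B)) (h : (𝟙 A ▷ B) ▷ U ≫ b = c ≫ U ◁ (𝟙 A ▷ B)) : b = c := by
  simpa using h

theorem id_comm_of_eq {C : Type*} [Category C] [MonoidalCategory C] {A U : C}
    (b c : A ⊗ U ⟶ U ⊗ A) (h : c = b) : 𝟙 A ▷ U ≫ b = c ≫ U ◁ 𝟙 A := by
  simpa using h.symm

theorem halfBraiding_add (m n : ℕ) (U : PreTL k) : ((halfBraiding k (m + n)).β U).hom =
    ((Center.tensorObj (central k m) (central k n)).2.β U).hom := by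
  induction n generalizing U with
  | zero =>
    have h := (Center.rightUnitor (central k m)).hom.comm U
    exact eq_of_id_comm (A := strands k m) (((halfBraiding k m).β U).hom) _ h
  | succ n ih =>
    let f : central k (m + n) ⟶ Center.tensorObj (central k m) (central k n) :=
      ⟨𝟙 (strands k (m + n)), fun U => id_comm_of_eq (A := strands k (m + n)) _ _ (ih U)⟩
    have h := eq_of_id_comm' (A := strands k (m + n)) (B := strands k 1) _ _
      ((Center.whiskerRight f (centralOne k)).comm U)
    have h2 := eq_of_id_comm (A := strands k (m + n + 1)) _ _
      ((Center.associator (central k m) (central k n) (centralOne k)).hom.comm U)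
    exact h.symm.trans h2.symm

theorem halfBraiding_unit {C : Type*} [Category C] [MonoidalCategory C] {A : C}
    (H : HalfBraiding A) : (H.β (𝟙_ C)).hom = (ρ_ A).hom ≫ (λ_ A).inv := by
  have h := H.naturality (λ_ (𝟙_ C)).hom
  have h' : ((α_ A (𝟙_ C) (𝟙_ C)).inv ≫ ((H.β (𝟙_ C)).hom ≫ (λ_ A).hom) ▷ 𝟙_ C) ≫
      (H.β (𝟙_ C)).hom = A ◁ (λ_ (𝟙_ C)).hom ≫ (H.β (𝟙_ C)).hom := by
    rw [h, HalfBraiding.monoidal]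
    monoidal
  rw [cancel_mono, Iso.inv_comp_eq, triangle, ← tensorHom_id, ← tensorHom_id] at h'
  rw [tensorHom_id, tensorHom_id, whiskerRight_iff] at h'
  rw [← h', Category.assoc, Iso.hom_inv_id, Category.comp_id]

theorem halfBraiding_one (U : PreTL k) :
    ((halfBraiding k 1).β U).hom = (braidOne k U.as.base.dots).hom :=
  (eq_of_id_comm (A := strands k 1) ((halfBraidingOne k).β U).hom _
    ((Center.leftUnitor (centralOne k)).hom.comm U)).symm

theorem halfBraiding_two : ((halfBraiding k 2).β (strands k 1)).hom =
    (α_ (strands k 1) (strands k 1) (strands k 1)).hom ≫ strands k 1 ◁ (crossingOne k).hom ≫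
    (α_ (strands k 1) (strands k 1) (strands k 1)).inv ≫ (crossingOne k).hom ▷ strands k 1 ≫
    (α_ (strands k 1) (strands k 1) (strands k 1)).hom := by
  have h := halfBraiding_one (strands k 1)
  rw [← braidOne_one]
  change (α_ (strands k 1) (strands k 1) (strands k 1)).hom ≫ strands k 1 ◁ (braidOne k 1).hom ≫
    (α_ (strands k 1) (strands k 1) (strands k 1)).inv ≫
      ((halfBraiding k 1).β (strands k 1)).hom ▷ strands k 1 ≫
    (α_ (strands k 1) (strands k 1) (strands k 1)).hom = _
  rw [h]
  rfl

theorem halfBraiding_nat_of_one {A B : PreTL k} (f : A ⟶ B) (H : HalfBraiding A)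
    (H' : HalfBraiding B) (h : f ▷ strands k 1 ≫ (H'.β (strands k 1)).hom =
      (H.β (strands k 1)).hom ≫ strands k 1 ◁ f) (p : ℕ) :
    f ▷ strands k p ≫ (H'.β (strands k p)).hom = (H.β (strands k p)).hom ≫ strands k p ◁ f := by
  induction p with
  | zero =>
    have e := halfBraiding_unit H
    have e' := halfBraiding_unit H'
    change f ▷ 𝟙_ _ ≫ (H'.β (𝟙_ _)).hom = (H.β (𝟙_ _)).hom ≫ 𝟙_ _ ◁ f
    rw [e, e']
    simp
  | succ p ih =>
    have e := hb_nat_tensor' ih h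
    rw [← HalfBraiding.monoidal, ← HalfBraiding.monoidal] at e
    exact e

theorem halfBraiding_nat {m n : ℕ} (f : strands k m ⟶ strands k n) (U : PreTL k) :
    f ▷ U ≫ ((halfBraiding k n).β U).hom = ((halfBraiding k m).β U).hom ≫ U ◁ f := by
  induction f using hom_induction generalizing U with
  | h0 => simp
  | ha f g hf hg => simp [hf, hg]
  | hs r f hf => simp [hf]
  | hid => simp
  | hcup =>
    refine halfBraiding_nat_of_one (cup k) (halfBraiding k 0) (halfBraiding k 2) ?_ U.as.base.dots
    have h := cup_slide' (rootT_ne_zero k) (by rw [loop, loopValue_eq]) (zigzag₁ (k := k)) zigzag₂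
    rw [halfBraiding_two]
    exact h
  | hcap =>
    refine halfBraiding_nat_of_one (cap k) (halfBraiding k 2) (halfBraiding k 0) ?_ U.as.base.dots
    have h := cap_slide' (rootT_ne_zero k) (by rw [loop, loopValue_eq]) (zigzag₁ (k := k)) zigzag₂
    rw [halfBraiding_two]
    exact h.symm
  | hcomp f g hf hg =>
    rw [comp_whiskerRight, Category.assoc, hg, ← Category.assoc, hf, Category.assoc,
      whiskerLeft_comp]
  | @htensor m n m' n' f g hf hg =>
    rw [halfBraiding_add, halfBraiding_add]
    exact (Center.tensorHom (X₁ := central k m) (Y₁ := central k n) (X₂ := central k m')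
      (Y₂ := central k n') ⟨f, hf⟩ ⟨g, hg⟩).comm U

theorem hexagon_aux {C : Type*} [Category C] [MonoidalCategory C] {X Y Z : C}
    (b : X ⊗ Y ⟶ Y ⊗ X) (c : X ⊗ Z ⟶ Z ⊗ X) :
    (α_ X Y Z).hom ≫ ((α_ X Y Z).inv ≫ b ▷ Z ≫ (α_ Y X Z).hom ≫ Y ◁ c ≫ (α_ Y Z X).inv) ≫
      (α_ Y Z X).hom = b ▷ Z ≫ (α_ Y X Z).hom ≫ Y ◁ c := by simp

theorem hexagon_aux' {C : Type*} [Category C] [MonoidalCategory C] {X Y Z : C}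
    (b : X ⊗ Z ⟶ Z ⊗ X) (c : Y ⊗ Z ⟶ Z ⊗ Y) :
    (α_ X Y Z).inv ≫ ((α_ X Y Z).hom ≫ X ◁ c ≫ (α_ X Z Y).inv ≫ b ▷ Y ≫ (α_ Z X Y).hom) ≫
      (α_ Z X Y).inv = X ◁ c ≫ (α_ X Z Y).inv ≫ b ▷ Y := by simp

/-- The braiding generated by `σ₁,₁` through the hexagon axioms. -/
instance : BraidedCategory (PreTL k) where
  braiding X Y := (halfBraiding k X.as.base.dots).β Y
  braiding_naturality_right X _ _ f := HalfBraiding.naturality _ f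
  braiding_naturality_left {X Y} f Z :=
    halfBraiding_nat (m := X.as.base.dots) (n := Y.as.base.dots) f Z
  hexagon_forward X Y Z := by
    rw [HalfBraiding.monoidal]
    exact hexagon_aux (X := X) _ _
  hexagon_reverse X Y Z := by
    have h := halfBraiding_add X.as.base.dots Y.as.base.dots Z
    change (α_ X Y Z).inv ≫ ((halfBraiding k (X.as.base.dots + Y.as.base.dots)).β Z).hom ≫
      (α_ Z X Y).inv = _
    rw [h]
    exact hexagon_aux' (X := X) (Y := Y) _ _

theorem braiding_one_one : (β_ (strands k 1) (strands k 1)).hom =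
    rootT k • 𝟙 (strands k 1 ⊗ strands k 1) + (rootT k)⁻¹ • (cap k ≫ cup k) :=
  (halfBraiding_one (strands k 1)).trans braidOne_one

end PreTL
end BraidingTwo

section JonesWenzl

theorem rootQ_pow (k i : ℕ) : rootQ k ^ i = Complex.exp (Real.pi * i / (k + 2) * Complex.I) := by
  rw [rootQ, rootT, ← pow_mul, ← Complex.exp_nat_mul]
  congr 1
  have : (k : ℂ) + 2 ≠ 0 := by exact_mod_cast (by omega : k + 2 ≠ 0)
  have : 2 * (k : ℂ) + 4 ≠ 0 := by exact_mod_cast (by omega : 2 * k + 4 ≠ 0)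
  push_cast
  field_simp
  ring

theorem qInt_num (k i : ℕ) : rootQ k ^ i - (rootQ k)⁻¹ ^ i =
    2 * Complex.I * (Real.sin (Real.pi * i / (k + 2)) : ℝ) := by
  rw [inv_pow, rootQ_pow, ← Complex.exp_neg, Complex.ofReal_sin, Complex.sin]
  push_cast
  rw [neg_mul]
  linear_combination (Complex.exp (Real.pi * i / (k + 2) * Complex.I) -
    Complex.exp (-(Real.pi * i / (k + 2) * Complex.I))) * Complex.I_sq

theorem qInt_num_ne_zero (k i : ℕ) (hi : 1 ≤ i) (hik : i ≤ k + 1) :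
    rootQ k ^ i - (rootQ k)⁻¹ ^ i ≠ 0 := by
  rw [qInt_num]
  refine mul_ne_zero (mul_ne_zero two_ne_zero Complex.I_ne_zero) ?_
  have h1 : (1 : ℝ) ≤ i := by exact_mod_cast hi
  have h2 : (i : ℝ) ≤ k + 1 := by exact_mod_cast hik
  refine Complex.ofReal_ne_zero.2 (Real.sin_pos_of_pos_of_lt_pi (by positivity) ?_).ne'
  rw [div_lt_iff₀ (by positivity)]
  nlinarith [Real.pi_pos]

theorem rootQ_sub_ne_zero (k : ℕ) : rootQ k - (rootQ k)⁻¹ ≠ 0 := by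
  simpa using qInt_num_ne_zero k 1 le_rfl (by omega)

theorem qInt_ne_zero (k i : ℕ) (hi : 1 ≤ i) (hik : i ≤ k + 1) : qInt k i ≠ 0 :=
  div_ne_zero (qInt_num_ne_zero k i hi hik) (rootQ_sub_ne_zero k)

theorem rootQ_ne_zero (k : ℕ) : rootQ k ≠ 0 := pow_ne_zero 2 (rootT_ne_zero k)

theorem qInt_zero (k : ℕ) : qInt k 0 = 0 := by simp [qInt]

theorem qInt_one (k : ℕ) : qInt k 1 = 1 := by
  simpa [qInt] using div_self (rootQ_sub_ne_zero k)

theorem qInt_rec (k i : ℕ) : loopValue k * qInt k (i + 1) + qInt k i = -qInt k (i + 2) := by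
  have h := rootQ_ne_zero k
  have h' := rootQ_sub_ne_zero k
  rw [qInt, qInt, qInt, loopValue, mul_div_assoc', ← add_div, ← neg_div]
  congr 1
  have e : rootQ k * (rootQ k)⁻¹ = 1 := mul_inv_cancel₀ h
  rw [pow_succ, pow_succ, pow_succ, pow_succ]
  linear_combination ((rootQ k)⁻¹ ^ i - rootQ k ^ i) * e

theorem temperleyLieb_aux {C : Type*} [Category C] [MonoidalCategory C] {A : C}
    {η : 𝟙_ C ⟶ A ⊗ A} {ε : A ⊗ A ⟶ 𝟙_ C}
    (z₁ : A ◁ η ≫ (α_ A A A).inv ≫ ε ▷ A = (ρ_ A).hom ≫ (λ_ A).inv)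
    (z₂ : η ▷ A ≫ (α_ A A A).hom ≫ A ◁ ε = (λ_ A).hom ≫ (ρ_ A).inv) :
    A ◁ (ε ≫ η) ≫ (α_ A A A).inv ≫ (ε ≫ η) ▷ A ≫ (α_ A A A).hom ≫ A ◁ (ε ≫ η) =
      A ◁ (ε ≫ η) := by
  simp only [MonoidalCategory.whiskerLeft_comp, comp_whiskerRight, Category.assoc]
  rw [reassoc_of% z₁, reassoc_of% z₂]
  simp

namespace PreTL
variable {k : ℕ}

/-- Juxtaposition of one strand on the right. -/
def addStrand {m n : ℕ} (f : strands k m ⟶ strands k n) :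
    strands k (m + 1) ⟶ strands k (n + 1) := f ▷ strands k 1

theorem addStrand_comp {l m n : ℕ} (f : strands k l ⟶ strands k m)
    (g : strands k m ⟶ strands k n) : addStrand (f ≫ g) = addStrand f ≫ addStrand g :=
  comp_whiskerRight f g _

theorem addStrand_id (n : ℕ) : addStrand (𝟙 (strands k n)) = 𝟙 _ := id_whiskerRight _ _

theorem addStrand_add {m n : ℕ} (f g : strands k m ⟶ strands k n) :
    addStrand (f + g) = addStrand f + addStrand g := MonoidalPreadditive.add_whiskerRight _ _

theorem addStrand_smul {m n : ℕ} (r : ℂ) (f : strands k m ⟶ strands k n) :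
    addStrand (r • f) = r • addStrand f := MonoidalLinear.smul_whiskerRight r f _

/-- `U_{n+1} = 1ₙ ⊗ (cup ∘ cap)` on `n + 2` strands. -/
def hook (k n : ℕ) : strands k (n + 2) ⟶ strands k (n + 2) := strands k n ◁ (cap k ≫ cup k)

theorem hook_sq (n : ℕ) : hook k n ≫ hook k n = loopValue k • hook k n := by
  have h : (cap k ≫ cup k) ≫ (cap k ≫ cup k) = loopValue k • (cap k ≫ cup k) := by
    rw [Category.assoc, ← Category.assoc (cup k), loop, Linear.smul_comp, Linear.comp_smul,
      Category.id_comp]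
  have h' := congrArg (fun x => strands k n ◁ x) h
  simp only [MonoidalLinear.whiskerLeft_smul, MonoidalCategory.whiskerLeft_comp _ (cap k ≫ cup k)] at h'
  exact h'

theorem hook_comm {m n : ℕ} (f : strands k m ⟶ strands k n) :
    addStrand (addStrand f) ≫ hook k n = hook k m ≫ addStrand (addStrand f) := by
  have h : addStrand (addStrand f) = f ▷ (strands k 1 ⊗ strands k 1) := by
    rw [whiskerRight_tensor]
    exact ((Category.id_comp _).trans (Category.comp_id _)).symm
  rw [h]
  exact (whisker_exchange f (cap k ≫ cup k)).symm

theorem hook_succ (n : ℕ) : hook k (n + 1) = strands k n ◁ (strands k 1 ◁ (cap k ≫ cup k)) :=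
  (tensor_whiskerLeft (strands k n) (strands k 1) (cap k ≫ cup k)).trans
    ((Category.id_comp _).trans (Category.comp_id _))

theorem addStrand_hook (n : ℕ) : addStrand (hook k n) =
    strands k n ◁ ((cap k ≫ cup k) ▷ strands k 1) :=
  (whisker_assoc (strands k n) (cap k ≫ cup k) (strands k 1)).trans
    ((Category.id_comp _).trans (Category.comp_id _))

theorem hook_hook (n : ℕ) :
    hook k (n + 1) ≫ addStrand (hook k n) ≫ hook k (n + 1) = hook k (n + 1) := by
  have h := temperleyLieb_aux (zigzag₁ (k := k)) zigzag₂
  have h' := congrArg (fun x => strands k n ◁ x) h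
  have e : (cap k ≫ cup k) ▷ strands k 1 = (α_ (strands k 1) (strands k 1) (strands k 1)).inv ≫
      (cap k ≫ cup k) ▷ strands k 1 ≫ (α_ (strands k 1) (strands k 1) (strands k 1)).hom :=
    ((Category.id_comp _).trans (Category.comp_id _)).symm
  rw [hook_succ, addStrand_hook, e]
  refine Eq.trans ?_ h'
  have w {A M N P Q R : PreTL k} (f : M ⟶ N) (g : N ⟶ P) (h : P ⟶ Q) (i : Q ⟶ R) (j : R ⟶ M) :
      A ◁ f ≫ A ◁ (g ≫ h ≫ i) ≫ A ◁ j = A ◁ (f ≫ g ≫ h ≫ i ≫ j) := by simp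
  exact w _ _ _ _ _

/-- The Jones–Wenzl idempotents: `f₀ = 1`, `f₁ = 1` and
`fₙ = fₙ₋₁ ⊗ 1 + ([n-1]/[n]) (fₙ₋₁ ⊗ 1) ∘ Uₙ₋₁ ∘ (fₙ₋₁ ⊗ 1)` (meaningful for `n ≤ k + 1`). -/
def jonesWenzl (k : ℕ) : (n : ℕ) → (strands k n ⟶ strands k n)
  | 0 => 𝟙 _
  | 1 => 𝟙 _
  | n + 2 => addStrand (jonesWenzl k (n + 1)) + (qInt k (n + 1) / qInt k (n + 2)) •
      (addStrand (jonesWenzl k (n + 1)) ≫ hook k n ≫ addStrand (jonesWenzl k (n + 1)))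

theorem jonesWenzl_aux (n : ℕ) (hn : n ≤ k) :
    jonesWenzl k (n + 1) ≫ jonesWenzl k (n + 1) = jonesWenzl k (n + 1) ∧
    addStrand (jonesWenzl k n) ≫ jonesWenzl k (n + 1) = jonesWenzl k (n + 1) ∧
    jonesWenzl k (n + 1) ≫ addStrand (jonesWenzl k n) = jonesWenzl k (n + 1) ∧
    hook k n ≫ addStrand (jonesWenzl k (n + 1)) ≫ hook k n =
      (-(qInt k (n + 2) / qInt k (n + 1))) •
        (addStrand (addStrand (jonesWenzl k n)) ≫ hook k n) := by
  induction n with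
  | zero =>
    have h := qInt_rec k 0
    rw [qInt_zero] at h
    simp only [jonesWenzl, addStrand_id, Category.id_comp, hook_sq, qInt_one, true_and,
      Nat.zero_add, div_one] at *
    rw [← h]; simp
  | succ n ih =>
    obtain ⟨i2, i3, i3r, i4⟩ := ih (by omega)
    have q1 := qInt_ne_zero k (n + 1) (by omega) (by omega)
    have q2 := qInt_ne_zero k (n + 2) (by omega) (by omega)
    have ig : addStrand (jonesWenzl k (n + 1)) ≫ addStrand (jonesWenzl k (n + 1)) =
      addStrand (jonesWenzl k (n + 1)) := by rw [← addStrand_comp, i2]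
    have i5 := congrArg addStrand i3r
    rw [addStrand_comp] at i5
    refine ⟨?_, ?_, ?_, ?_⟩
    · have e : addStrand (jonesWenzl k (n + 1)) ≫ hook k n ≫ addStrand (jonesWenzl k (n + 1)) ≫
          hook k n ≫ addStrand (jonesWenzl k (n + 1)) = (-(qInt k (n + 2) / qInt k (n + 1))) •
          (addStrand (jonesWenzl k (n + 1)) ≫ hook k n ≫ addStrand (jonesWenzl k (n + 1))) := by
        have h := congrArg (fun x => addStrand (jonesWenzl k (n + 1)) ≫ x ≫
          addStrand (jonesWenzl k (n + 1))) i4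
        simpa only [Category.assoc, Linear.smul_comp, Linear.comp_smul, reassoc_of% i5] using h
      simp only [jonesWenzl, Preadditive.comp_add, Preadditive.add_comp, Linear.comp_smul,
        Linear.smul_comp, Category.assoc, ig, reassoc_of% ig, e, smul_smul, smul_add]
      match_scalars <;> field_simp
      ring
    · simp only [jonesWenzl, Preadditive.comp_add, Linear.comp_smul, ig, reassoc_of% ig]
    · simp only [jonesWenzl, Preadditive.add_comp, Linear.smul_comp, Category.assoc, ig]
    · have c := hook_comm (jonesWenzl k (n + 1))
      have h := hook_hook (k := k) n
      have igg := congrArg addStrand ig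
      rw [addStrand_comp] at igg
      have r := qInt_rec k (n + 1)
      have e1 : hook k (n + 1) ≫ addStrand (addStrand (jonesWenzl k (n + 1))) ≫ hook k (n + 1) =
          loopValue k • (addStrand (addStrand (jonesWenzl k (n + 1))) ≫ hook k (n + 1)) := by
        rw [← reassoc_of% c, hook_sq, Linear.comp_smul]
      have e2 : hook k (n + 1) ≫ addStrand (addStrand (jonesWenzl k (n + 1))) ≫
          addStrand (hook k n) ≫ addStrand (addStrand (jonesWenzl k (n + 1))) ≫ hook k (n + 1) =
          addStrand (addStrand (jonesWenzl k (n + 1))) ≫ hook k (n + 1) := by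
        rw [← reassoc_of% c, c, reassoc_of% h, ← c, reassoc_of% igg]
      rw [jonesWenzl]
      simp only [addStrand_add, addStrand_smul, addStrand_comp, Preadditive.add_comp,
        Preadditive.comp_add, Linear.smul_comp, Linear.comp_smul, Category.assoc, e1, e2]
      rw [← add_smul]
      congr 1
      field_simp
      linear_combination r

theorem jonesWenzl_idem (n : ℕ) (hn : n ≤ k + 1) :
    jonesWenzl k n ≫ jonesWenzl k n = jonesWenzl k n := by
  cases n with
  | zero => exact Category.id_comp _
  | succ n => exact (jonesWenzl_aux n (by omega)).1

end PreTL
end JonesWenzl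

section Twists
universe v u
variable {C : Type u} [Category.{v} C] [MonoidalCategory C] [BraidedCategory C] {X : C}

/-- The left twist `(e ⊗ 1) ∘ (ι ⊗ σ) ∘ (c ⊗ 1)` of a self-dual object `X` of a braided monoidal
category with evaluation `e`, coevaluation `c` and pivotal isomorphism `ι : X → Xᵛᵛ = X`. -/
def leftTwist (e : X ⊗ X ⟶ 𝟙_ C) (c : 𝟙_ C ⟶ X ⊗ X) (ι : X ≅ X) : X ⟶ X :=
  (λ_ X).inv ≫ c ▷ X ≫ (α_ X X X).hom ≫ (ι.hom ⊗ₘ (β_ X X).hom) ≫ (α_ X X X).inv ≫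
    e ▷ X ≫ (λ_ X).hom

/-- The right twist `(1 ⊗ e) ∘ (σ ⊗ ι⁻¹) ∘ (1 ⊗ c)` of a self-dual object `X`. -/
def rightTwist (e : X ⊗ X ⟶ 𝟙_ C) (c : 𝟙_ C ⟶ X ⊗ X) (ι : X ≅ X) : X ⟶ X :=
  (ρ_ X).inv ≫ X ◁ c ≫ (α_ X X X).inv ≫ ((β_ X X).hom ⊗ₘ ι.inv) ≫ (α_ X X X).hom ≫
    X ◁ e ≫ (ρ_ X).hom

end Twists

section Reduced
open Idempotents

/-- The `j` nested caps, from `j + j` dots to no dots (the innermost cap is at the bottom). -/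
def nestedCaps : (j : ℕ) → DiagramTerm (j + j) 0
  | 0 => DiagramTerm.id 0
  | j + 1 => DiagramTerm.comp
      ((DiagramTerm.tensor (DiagramTerm.id j)
        (DiagramTerm.tensor DiagramTerm.cap (DiagramTerm.id j))).cast
          (show j + (2 + j) = (j + 1) + (j + 1) by omega) (show j + (0 + j) = j + j by omega))
      (nestedCaps j)

/-- The `j` nested cups, from no dots to `j + j` dots (the innermost cup is at the top). -/
def nestedCups : (j : ℕ) → DiagramTerm 0 (j + j)
  | 0 => DiagramTerm.id 0
  | j + 1 => DiagramTerm.comp (nestedCups j)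
      ((DiagramTerm.tensor (DiagramTerm.id j)
        (DiagramTerm.tensor DiagramTerm.cup (DiagramTerm.id j))).cast
          (show j + (0 + j) = j + j by omega) (show j + (2 + j) = (j + 1) + (j + 1) by omega))

/-- The Temperley–Lieb category: the additive and idempotent completion of linear combinations of
planar diagrams modulo "loop equals `δ`". -/
abbrev TL (k : ℕ) : Type 1 := Karoubi (Mat_ (PreTL k))

namespace TL

/-- The object of `j` strands in the additive completion. -/
def strands (k j : ℕ) : Mat_ (PreTL k) := (Mat_.embedding (PreTL k)).obj (PreTL.strands k j)

/-- The object `F_j = (j, f_j)`. -/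
def jonesWenzlObj (k j : ℕ) (hj : j ≤ k + 1) : TL k where
  X := strands k j
  p := (Mat_.embedding (PreTL k)).map (PreTL.jonesWenzl k j)
  idem := ((Mat_.embedding (PreTL k)).map_comp _ _).symm.trans
    (congrArg _ (PreTL.jonesWenzl_idem j hj))

/-- The `j` nested caps as a morphism of the additive completion. -/
def caps (k j : ℕ) : strands k j ⊗ strands k j ⟶ 𝟙_ (Mat_ (PreTL k)) :=
  fun _ _ => PreTL.ofDiagram (DiagramCat.ofTerm (nestedCaps j))

/-- The `j` nested cups as a morphism of the additive completion. -/
def cups (k j : ℕ) : 𝟙_ (Mat_ (PreTL k)) ⟶ strands k j ⊗ strands k j :=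
  fun _ _ => PreTL.ofDiagram (DiagramCat.ofTerm (nestedCups j))

/-- The morphism `g φ f : (x, f) ⟶ (y, g)` of the idempotent completion given by `φ : x ⟶ y`. -/
def compress {C : Type*} [Category C] {P Q : Karoubi C} (φ : P.X ⟶ Q.X) : P ⟶ Q where
  f := P.p ≫ φ ≫ Q.p
  comm := by simp only [Category.assoc, Q.idem, P.idem_assoc]

/-- The evaluation `e_j : F_j ⊗ F_j ⟶ 𝟙`. -/
def ev (k j : ℕ) (hj : j ≤ k + 1) : jonesWenzlObj k j hj ⊗ jonesWenzlObj k j hj ⟶ 𝟙_ (TL k) :=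
  compress (caps k j)

/-- The coevaluation `c_j : 𝟙 ⟶ F_j ⊗ F_j`. -/
def coev (k j : ℕ) (hj : j ≤ k + 1) : 𝟙_ (TL k) ⟶ jonesWenzlObj k j hj ⊗ jonesWenzlObj k j hj :=
  compress (cups k j)

end TL

/-- The reduced Temperley–Lieb category: the quotient of `TL` by the tensor ideal generated by
(the identity of) `F_{k+1}`. -/
abbrev ReducedTL (k : ℕ) : Type 1 := TensorQuotient (𝟙 (TL.jonesWenzlObj k (k + 1) le_rfl))

namespace ReducedTL

/-- The quotient functor. -/
abbrev proj (k : ℕ) : TL k ⥤ ReducedTL k := toQuot (𝟙 (TL.jonesWenzlObj k (k + 1) le_rfl))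

/-- The object `F_j` of the reduced category. -/
def jonesWenzlObj (k j : ℕ) (hj : j ≤ k + 1) : ReducedTL k := (proj k).obj (TL.jonesWenzlObj k j hj)

/-- The evaluation of `F_j` in the reduced category. -/
def ev (k j : ℕ) (hj : j ≤ k + 1) :
    jonesWenzlObj k j hj ⊗ jonesWenzlObj k j hj ⟶ 𝟙_ (ReducedTL k) := (proj k).map (TL.ev k j hj)

/-- The coevaluation of `F_j` in the reduced category. -/
def coev (k j : ℕ) (hj : j ≤ k + 1) :
    𝟙_ (ReducedTL k) ⟶ jonesWenzlObj k j hj ⊗ jonesWenzlObj k j hj := (proj k).map (TL.coev k j hj)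

end ReducedTL
end Reduced

end

end TLJ

/-! A twist is a curl, that is, a partial trace of the braiding of an object with itself. For one
strand this is the first Reidemeister move of the Kauffman bracket: closing t·1 + t⁻¹·(cup∘cap)
gives tδ + t⁻¹ = -t³ (`leftTrace_crossing`, `rightTrace_crossing`). For a tensor product closed by
nested caps and cups, the hexagons and naturality alone show that the curl is the product of the two
curls and the double braiding of the factors (`leftCurl_nest`, `rightCurl_nest`). With one strand as
the inner factor and j strands as the outer one, the curl of j+1 strands is -t³ times the curl of j
strands combined with the 2j elementary crossings of the new strand with the others
(`leftCurl_succ`, `rightCurl_succ`).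

The Jones–Wenzl idempotent makes this a scalar. It kills every cup-cap on adjacent strands, so next
to it an elementary crossing acts as t, and f_{j+1} absorbs f_j ⊗ 1. Passing from j to j+1 therefore
multiplies the scalar by -t^{2j+3}, and the product of these factors is (-1)^j t^{j²+2j}.

The evaluation, the coevaluation and all structural isomorphisms of F_j carry further copies of f_j.
Naturality pushes all of them up to the caps, where it must be known that f_j ⊗ f_j may be replaced
by f_j on a single leg, left or right (`jonesWenzl_tensor_caps_left`,
`jonesWenzl_tensor_caps_right`). This holds because f_j is the identity plus an element of the left
ideal generated by the cup-caps, and a cup-cap on the left legs of the nested caps can be pulled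
over to the right legs, where the other f_j kills it. The twist is then f_j ∘ curl ∘ f_j
(`leftTwist_compress`, `rightTwist_compress`).

The computation takes place among linear combinations of diagrams. The additive completion is
handled by one-by-one matrices, and the last quotient by applying the projection functor: the
identity already holds in `TL`. -/

namespace TLJ

noncomputable section

/-! ### Partial traces and curls in monoidal and braided categories -/

section PartialTrace
universe v u
variable {C : Type u} [Category.{v} C] [MonoidalCategory C]

/-- The partial trace over `X` on the left, for an evaluation `e : Y ⊗ X ⟶ 𝟙` and a
coevaluation `c : 𝟙 ⟶ Y ⊗ X`. -/
def leftTrace {X Y Z W : C} (e : Y ⊗ X ⟶ 𝟙_ C) (c : 𝟙_ C ⟶ Y ⊗ X) (g : X ⊗ Z ⟶ X ⊗ W) : Z ⟶ W :=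
  (λ_ Z).inv ≫ c ▷ Z ≫ (α_ Y X Z).hom ≫ Y ◁ g ≫ (α_ Y X W).inv ≫ e ▷ W ≫ (λ_ W).hom

/-- The partial trace over `X` on the right, for an evaluation `e : X ⊗ Y ⟶ 𝟙` and a
coevaluation `c : 𝟙 ⟶ X ⊗ Y`. -/
def rightTrace {X Y Z W : C} (e : X ⊗ Y ⟶ 𝟙_ C) (c : 𝟙_ C ⟶ X ⊗ Y) (g : Z ⊗ X ⟶ W ⊗ X) : Z ⟶ W :=
  (ρ_ Z).inv ≫ Z ◁ c ≫ (α_ Z X Y).inv ≫ g ▷ Y ≫ (α_ W X Y).hom ≫ W ◁ e ≫ (ρ_ W).hom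

/-- The nested evaluation on `(Y₂ ⊗ Y₁) ⊗ (X₁ ⊗ X₂)`. -/
def nestEv {X₁ X₂ Y₁ Y₂ : C} (e₁ : Y₁ ⊗ X₁ ⟶ 𝟙_ C) (e₂ : Y₂ ⊗ X₂ ⟶ 𝟙_ C) :
    (Y₂ ⊗ Y₁) ⊗ (X₁ ⊗ X₂) ⟶ 𝟙_ C :=
  (α_ Y₂ Y₁ (X₁ ⊗ X₂)).hom ≫ Y₂ ◁ ((α_ Y₁ X₁ X₂).inv ≫ e₁ ▷ X₂ ≫ (λ_ X₂).hom) ≫ e₂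

/-- The nested coevaluation on `(Y₂ ⊗ Y₁) ⊗ (X₁ ⊗ X₂)`. -/
def nestCoev {X₁ X₂ Y₁ Y₂ : C} (c₁ : 𝟙_ C ⟶ Y₁ ⊗ X₁) (c₂ : 𝟙_ C ⟶ Y₂ ⊗ X₂) :
    𝟙_ C ⟶ (Y₂ ⊗ Y₁) ⊗ (X₁ ⊗ X₂) :=
  c₂ ≫ Y₂ ◁ ((λ_ X₂).inv ≫ c₁ ▷ X₂ ≫ (α_ Y₁ X₁ X₂).hom) ≫ (α_ Y₂ Y₁ (X₁ ⊗ X₂)).inv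

variable {X Y X₁ X₂ Y₁ Y₂ Z W V : C}

/-- The inner loop, through X₁, can be closed before the outer one, through X₂. Both sides are the
same string diagram, so only coherence is at stake. -/
theorem leftTrace_nest (e₁ : Y₁ ⊗ X₁ ⟶ 𝟙_ C) (e₂ : Y₂ ⊗ X₂ ⟶ 𝟙_ C) (c₁ : 𝟙_ C ⟶ Y₁ ⊗ X₁)
    (c₂ : 𝟙_ C ⟶ Y₂ ⊗ X₂) (g : (X₁ ⊗ X₂) ⊗ Z ⟶ (X₁ ⊗ X₂) ⊗ W) :
    leftTrace (nestEv e₁ e₂) (nestCoev c₁ c₂) g =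
      leftTrace e₂ c₂ (leftTrace e₁ c₁ ((α_ X₁ X₂ Z).inv ≫ g ≫ (α_ X₁ X₂ W).hom)) := by
  simp only [leftTrace, nestEv, nestCoev]
  monoidal

theorem rightTrace_nest (e₁ : Y₁ ⊗ X₁ ⟶ 𝟙_ C) (e₂ : Y₂ ⊗ X₂ ⟶ 𝟙_ C) (c₁ : 𝟙_ C ⟶ Y₁ ⊗ X₁)
    (c₂ : 𝟙_ C ⟶ Y₂ ⊗ X₂) (g : Z ⊗ (Y₂ ⊗ Y₁) ⟶ W ⊗ (Y₂ ⊗ Y₁)) :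
    rightTrace (nestEv e₁ e₂) (nestCoev c₁ c₂) g =
      rightTrace e₂ c₂ (rightTrace e₁ c₁ ((α_ Z Y₂ Y₁).hom ≫ g ≫ (α_ W Y₂ Y₁).inv)) := by
  simp only [rightTrace, nestEv, nestCoev]
  monoidal

variable (e : Y ⊗ X ⟶ 𝟙_ C) (c : 𝟙_ C ⟶ Y ⊗ X)

theorem leftTrace_comp_left (h : Z ⟶ W) (g : X ⊗ W ⟶ X ⊗ V) :
    leftTrace e c (X ◁ h ≫ g) = h ≫ leftTrace e c g := by
  simp only [leftTrace]
  rw [leftUnitor_inv_naturality_assoc, whisker_exchange_assoc]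
  simp

theorem leftTrace_comp_right (g : X ⊗ Z ⟶ X ⊗ W) (h : W ⟶ V) :
    leftTrace e c (g ≫ X ◁ h) = leftTrace e c g ≫ h := by
  simp only [leftTrace, Category.assoc]
  rw [← leftUnitor_naturality, ← whisker_exchange_assoc]
  simp

theorem leftTrace_whisker (g : X ⊗ Z ⟶ X ⊗ W) :
    leftTrace e c ((α_ X Z V).inv ≫ g ▷ V ≫ (α_ X W V).hom) = leftTrace e c g ▷ V := by
  simp only [leftTrace]
  monoidal

theorem rightTrace_comp_left (h : Z ⟶ W) (g : W ⊗ Y ⟶ V ⊗ Y) :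
    rightTrace e c (h ▷ Y ≫ g) = h ≫ rightTrace e c g := by
  simp only [rightTrace]
  rw [rightUnitor_inv_naturality_assoc, ← whisker_exchange_assoc]
  simp

theorem rightTrace_comp_right (g : Z ⊗ Y ⟶ W ⊗ Y) (h : W ⟶ V) :
    rightTrace e c (g ≫ h ▷ Y) = rightTrace e c g ≫ h := by
  simp only [rightTrace, Category.assoc]
  rw [← rightUnitor_naturality, whisker_exchange_assoc]
  simp

theorem rightTrace_whisker (g : Z ⊗ Y ⟶ W ⊗ Y) :
    rightTrace e c ((α_ V Z Y).hom ≫ V ◁ g ≫ (α_ V W Y).inv) = V ◁ rightTrace e c g := by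
  simp only [rightTrace]
  monoidal

/-- The leg X of the evaluation is the strand leaving `g`, so a box on this leg can be pushed back
to the output of `g`. This later frees an idempotent that is stuck at the caps. -/
theorem leftTrace_slide (h : X ⟶ X) (g : X ⊗ Z ⟶ X ⊗ W) :
    leftTrace (Y ◁ h ≫ e) c g = leftTrace e c (g ≫ h ▷ W) := by
  simp only [leftTrace]
  monoidal

theorem rightTrace_slide (h : Y ⟶ Y) (g : Z ⊗ Y ⟶ W ⊗ Y) :
    rightTrace (h ▷ X ≫ e) c g = rightTrace e c (g ≫ W ◁ h) := by
  simp only [rightTrace]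
  monoidal

variable [BraidedCategory C]

/-- The left curl of `X` for an evaluation `Y ⊗ X ⟶ 𝟙` and a coevaluation `𝟙 ⟶ Y ⊗ X`. -/
def leftCurl : X ⟶ X := leftTrace e c (β_ X X).hom

/-- The right curl of `Y` for an evaluation `Y ⊗ X ⟶ 𝟙` and a coevaluation `𝟙 ⟶ Y ⊗ X`. -/
def rightCurl : Y ⟶ Y := rightTrace e c (β_ Y Y).hom

/-- The hexagon splits the braiding of X past X ⊗ W into the self-braiding of X, which the trace
turns into a curl, and the braiding of X past W, which lies outside the loop. -/
theorem leftTrace_braiding :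
    leftTrace e c ((β_ X (X ⊗ W)).hom ≫ (α_ X W X).hom) = leftCurl e c ▷ W ≫ (β_ X W).hom := by
  have h : (β_ X (X ⊗ W)).hom ≫ (α_ X W X).hom =
      ((α_ X X W).inv ≫ (β_ X X).hom ▷ W ≫ (α_ X X W).hom) ≫ X ◁ (β_ X W).hom := by
    have := BraidedCategory.hexagon_forward X X W
    rw [Category.assoc, Category.assoc, ← this, Iso.inv_hom_id_assoc]
  rw [h, leftTrace_comp_right, leftTrace_whisker, leftCurl]

theorem rightTrace_braiding :
    rightTrace e c ((β_ (W ⊗ Y) Y).hom ≫ (α_ Y W Y).inv) =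
      W ◁ rightCurl e c ≫ (β_ W Y).hom := by
  have h : (β_ (W ⊗ Y) Y).hom ≫ (α_ Y W Y).inv =
      ((α_ W Y Y).hom ≫ W ◁ (β_ Y Y).hom ≫ (α_ W Y Y).inv) ≫ (β_ W Y).hom ▷ Y := by
    have := BraidedCategory.hexagon_reverse W Y Y
    rw [Category.assoc, Category.assoc, ← this, Iso.hom_inv_id_assoc]
  rw [h, rightTrace_comp_right, rightTrace_whisker, rightCurl]

/-- This is the balancing law for twists, with the curls proved rather than assumed to satisfy it.
Closing the inner loop X₁ produces a curl and a crossing by `leftTrace_braiding`; naturality of the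
braiding carries these two out of the loop X₂, which is then closed by the same lemma. -/
theorem leftCurl_nest (e₁ : Y₁ ⊗ X₁ ⟶ 𝟙_ C) (e₂ : Y₂ ⊗ X₂ ⟶ 𝟙_ C) (c₁ : 𝟙_ C ⟶ Y₁ ⊗ X₁)
    (c₂ : 𝟙_ C ⟶ Y₂ ⊗ X₂) :
    leftCurl (nestEv e₁ e₂) (nestCoev c₁ c₂) =
      leftCurl e₁ c₁ ▷ X₂ ≫ (β_ X₁ X₂).hom ≫ leftCurl e₂ c₂ ▷ X₁ ≫ (β_ X₂ X₁).hom := by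
  -- The hexagon in the first variable. The outer two factors leave the strand X₁ alone and so come
  -- out of its trace; only the middle factor is really closed.
  have h : (α_ X₁ X₂ (X₁ ⊗ X₂)).inv ≫ (β_ (X₁ ⊗ X₂) (X₁ ⊗ X₂)).hom ≫ (α_ X₁ X₂ (X₁ ⊗ X₂)).hom =
      X₁ ◁ (β_ X₂ (X₁ ⊗ X₂)).hom ≫ ((α_ X₁ (X₁ ⊗ X₂) X₂).inv ≫
        ((β_ X₁ (X₁ ⊗ X₂)).hom ≫ (α_ X₁ X₂ X₁).hom) ▷ X₂ ≫ (α_ X₁ (X₂ ⊗ X₁) X₂).hom) ≫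
        X₁ ◁ (α_ X₂ X₁ X₂).hom := by
    have := BraidedCategory.hexagon_reverse X₁ X₂ (X₁ ⊗ X₂)
    rw [comp_whiskerRight]
    simp only [Category.assoc]
    rw [pentagon, ← reassoc_of% this]
    simp
  rw [leftCurl, leftTrace_nest, h, leftTrace_comp_left, leftTrace_comp_right, leftTrace_whisker,
    leftTrace_braiding, ← BraidedCategory.braiding_naturality_right_assoc, leftTrace_comp_left,
    leftTrace_braiding, Category.assoc]

/-- Mirror image of `leftCurl_nest`: the self-braiding is split by the hexagon in its second
variable, the inner loop is Y₁, and naturality is used in the first variable. -/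
theorem rightCurl_nest (e₁ : Y₁ ⊗ X₁ ⟶ 𝟙_ C) (e₂ : Y₂ ⊗ X₂ ⟶ 𝟙_ C) (c₁ : 𝟙_ C ⟶ Y₁ ⊗ X₁)
    (c₂ : 𝟙_ C ⟶ Y₂ ⊗ X₂) :
    rightCurl (nestEv e₁ e₂) (nestCoev c₁ c₂) =
      Y₂ ◁ rightCurl e₁ c₁ ≫ (β_ Y₂ Y₁).hom ≫ Y₁ ◁ rightCurl e₂ c₂ ≫ (β_ Y₁ Y₂).hom := by
  have h : (α_ (Y₂ ⊗ Y₁) Y₂ Y₁).hom ≫ (β_ (Y₂ ⊗ Y₁) (Y₂ ⊗ Y₁)).hom ≫ (α_ (Y₂ ⊗ Y₁) Y₂ Y₁).inv =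
      (β_ (Y₂ ⊗ Y₁) Y₂).hom ▷ Y₁ ≫ ((α_ Y₂ (Y₂ ⊗ Y₁) Y₁).hom ≫
        Y₂ ◁ ((β_ (Y₂ ⊗ Y₁) Y₁).hom ≫ (α_ Y₁ Y₂ Y₁).inv) ≫ (α_ Y₂ (Y₁ ⊗ Y₂) Y₁).inv) ≫
        (α_ Y₂ Y₁ Y₂).inv ▷ Y₁ := by
    have := BraidedCategory.hexagon_forward (Y₂ ⊗ Y₁) Y₂ Y₁
    rw [MonoidalCategory.whiskerLeft_comp]
    simp only [Category.assoc]
    rw [pentagon_inv, ← reassoc_of% this]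
    simp
  rw [rightCurl, rightTrace_nest, h, rightTrace_comp_left, rightTrace_comp_right,
    rightTrace_whisker, rightTrace_braiding, ← BraidedCategory.braiding_naturality_left_assoc,
    rightTrace_comp_left, rightTrace_braiding, Category.assoc]

/-- The left curl lives on the leg X that is being renamed, so the renaming conjugates it: both ends
of `s` slide into the trace and pass through the braiding by naturality. -/
theorem leftCurl_iso (s : X ≅ Z) :
    leftCurl (Y ◁ s.inv ≫ e) (c ≫ Y ◁ s.hom) = s.inv ≫ leftCurl e c ≫ s.hom := by
  have h : leftCurl (Y ◁ s.inv ≫ e) (c ≫ Y ◁ s.hom) =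
      leftTrace e c ((s.hom ▷ Z ≫ (β_ Z Z).hom) ≫ s.inv ▷ Z) := by
    simp only [leftCurl, leftTrace]
    monoidal
  rw [h, BraidedCategory.braiding_naturality_left, Category.assoc, whisker_exchange,
    ← BraidedCategory.braiding_naturality_right_assoc, leftTrace_comp_left, leftTrace_comp_right,
    leftCurl]

/-- The right curl lives on the other leg Y. The renamed leg runs straight from the cup to the cap,
where `s.hom` meets `s.inv`. -/
theorem rightCurl_iso (s : X ≅ Z) :
    rightCurl (Y ◁ s.inv ≫ e) (c ≫ Y ◁ s.hom) = rightCurl e c := by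
  simp only [rightCurl, rightTrace, MonoidalCategory.whiskerLeft_comp, Category.assoc]
  rw [associator_inv_naturality_right_assoc, whisker_exchange_assoc,
    associator_naturality_right_assoc, ← MonoidalCategory.whiskerLeft_comp_assoc,
    ← MonoidalCategory.whiskerLeft_comp, s.hom_inv_id]
  simp

theorem leftCurl_unit : leftCurl (λ_ (𝟙_ C)).hom (λ_ (𝟙_ C)).inv = 𝟙 _ := by
  simp only [leftCurl, leftTrace, braiding_tensorUnit_left]
  monoidal

theorem rightCurl_unit : rightCurl (λ_ (𝟙_ C)).hom (λ_ (𝟙_ C)).inv = 𝟙 _ := by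
  simp only [rightCurl, rightTrace, braiding_tensorUnit_left]
  monoidal

end PartialTrace

/-! ### The curl of a single strand -/

section CurlCrossing
set_option linter.unusedSectionVars false
universe v u
variable {C : Type u} [Category.{v} C] [Preadditive C] [Linear ℂ C] [MonoidalCategory C]
  [MonoidalPreadditive C] [MonoidalLinear ℂ C] {A X Y Z W : C} {t : ℂ}

theorem leftTrace_add (e : Y ⊗ X ⟶ 𝟙_ C) (c : 𝟙_ C ⟶ Y ⊗ X) (g h : X ⊗ Z ⟶ X ⊗ W) :
    leftTrace e c (g + h) = leftTrace e c g + leftTrace e c h := by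
  simp [leftTrace]

theorem leftTrace_smul (e : Y ⊗ X ⟶ 𝟙_ C) (c : 𝟙_ C ⟶ Y ⊗ X) (r : ℂ) (g : X ⊗ Z ⟶ X ⊗ W) :
    leftTrace e c (r • g) = r • leftTrace e c g := by
  simp [leftTrace]

theorem rightTrace_add (e : X ⊗ Y ⟶ 𝟙_ C) (c : 𝟙_ C ⟶ X ⊗ Y) (g h : Z ⊗ X ⟶ W ⊗ X) :
    rightTrace e c (g + h) = rightTrace e c g + rightTrace e c h := by
  simp [rightTrace]

theorem rightTrace_smul (e : X ⊗ Y ⟶ 𝟙_ C) (c : 𝟙_ C ⟶ X ⊗ Y) (r : ℂ) (g : Z ⊗ X ⟶ W ⊗ X) :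
    rightTrace e c (r • g) = r • rightTrace e c g := by
  simp [rightTrace]

variable {η : 𝟙_ C ⟶ A ⊗ A} {ε : A ⊗ A ⟶ 𝟙_ C}

/-- Closing the identity term leaves a free loop, of value -t² - t⁻²; closing the cup-cap term
leaves a strand that two zigzags straighten. The sum is t(-t² - t⁻²) + t⁻¹ = -t³. -/
theorem leftTrace_crossing (ht : t ≠ 0) (hl : η ≫ ε = (-t ^ 2 - (t⁻¹) ^ 2) • 𝟙 (𝟙_ C))
    (z₁ : A ◁ η ≫ (α_ A A A).inv ≫ ε ▷ A = (ρ_ A).hom ≫ (λ_ A).inv)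
    (z₂ : η ▷ A ≫ (α_ A A A).hom ≫ A ◁ ε = (λ_ A).hom ≫ (ρ_ A).inv) :
    leftTrace ε η (crossing t η ε) = (-t ^ 3) • 𝟙 A := by
  have h₁ : leftTrace ε η (𝟙 (A ⊗ A)) = (-t ^ 2 - (t⁻¹) ^ 2) • 𝟙 A := by
    have : η ▷ A ≫ ε ▷ A = (-t ^ 2 - (t⁻¹) ^ 2) • 𝟙 _ := by
      rw [← MonoidalCategory.comp_whiskerRight, hl]; simp
    simp [leftTrace, reassoc_of% this]
  have h₂ : leftTrace ε η (ε ≫ η) = 𝟙 A := by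
    simp only [leftTrace, MonoidalCategory.whiskerLeft_comp, Category.assoc]
    rw [reassoc_of% z₂, reassoc_of% z₁]
    simp
  rw [crossing, leftTrace_add, leftTrace_smul, leftTrace_smul, h₁, h₂, smul_smul, ← add_smul]
  congr 1
  field_simp
  ring

theorem rightTrace_crossing (ht : t ≠ 0) (hl : η ≫ ε = (-t ^ 2 - (t⁻¹) ^ 2) • 𝟙 (𝟙_ C))
    (z₁ : A ◁ η ≫ (α_ A A A).inv ≫ ε ▷ A = (ρ_ A).hom ≫ (λ_ A).inv)
    (z₂ : η ▷ A ≫ (α_ A A A).hom ≫ A ◁ ε = (λ_ A).hom ≫ (ρ_ A).inv) :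
    rightTrace ε η (crossing t η ε) = (-t ^ 3) • 𝟙 A := by
  have h₁ : rightTrace ε η (𝟙 (A ⊗ A)) = (-t ^ 2 - (t⁻¹) ^ 2) • 𝟙 A := by
    have : A ◁ η ≫ A ◁ ε = (-t ^ 2 - (t⁻¹) ^ 2) • 𝟙 _ := by
      rw [← MonoidalCategory.whiskerLeft_comp, hl]; simp
    simp [rightTrace, reassoc_of% this]
  have h₂ : rightTrace ε η (ε ≫ η) = 𝟙 A := by
    simp only [rightTrace, MonoidalCategory.comp_whiskerRight, Category.assoc]
    rw [reassoc_of% z₁, reassoc_of% z₂]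
    simp
  rw [crossing, rightTrace_add, rightTrace_smul, rightTrace_smul, h₁, h₂, smul_smul, ← add_smul]
  congr 1
  field_simp
  ring

end CurlCrossing

/-! ### Twists in an idempotent completion -/

section KaroubiTwist
open Idempotents
universe v u
variable {C : Type u} [Category.{v} C] [MonoidalCategory C] [BraidedCategory C]

/-- All copies of the idempotent commute with the associators and with the braiding, so they collect
just below the evaluation. The hypothesis `he` discards the copy on the left leg; the one on the
right leg slides around the loop and through the braiding to the free end of the strand. -/
theorem leftTwist_compress (P : Karoubi C) (e : P.X ⊗ P.X ⟶ 𝟙_ C) (c : 𝟙_ C ⟶ P.X ⊗ P.X)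
    (he : (P.p ⊗ₘ P.p) ≫ e = P.X ◁ P.p ≫ e) :
    (leftTwist (X := P) (TL.compress (P := P ⊗ P) (Q := 𝟙_ (Karoubi C)) e)
      (TL.compress (P := 𝟙_ (Karoubi C)) (Q := P ⊗ P) c) (Iso.refl _)).f =
      P.p ≫ leftCurl e c ≫ P.p := by
  have i2 : (P.p ⊗ₘ P.p) ≫ (P.p ⊗ₘ P.p) = P.p ⊗ₘ P.p := by
    rw [tensorHom_comp_tensorHom, P.idem]
  have i3 : ((P.p ⊗ₘ P.p) ⊗ₘ P.p) ≫ ((P.p ⊗ₘ P.p) ⊗ₘ P.p) = ((P.p ⊗ₘ P.p) ⊗ₘ P.p) := by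
    rw [tensorHom_comp_tensorHom, i2, P.idem]
  have i3' : (P.p ⊗ₘ P.p ⊗ₘ P.p) ≫ (P.p ⊗ₘ P.p ⊗ₘ P.p) = (P.p ⊗ₘ P.p ⊗ₘ P.p) := by
    rw [tensorHom_comp_tensorHom, i2, P.idem]
  have a := associator_naturality P.p P.p P.p
  have a' := associator_inv_naturality P.p P.p P.p
  have e1 : ((𝟙 _ ≫ c ≫ (P.p ⊗ₘ P.p)) ⊗ₘ P.p) = c ▷ P.X ≫ ((P.p ⊗ₘ P.p) ⊗ₘ P.p) := by
    rw [Category.id_comp, ← tensorHom_id, tensorHom_comp_tensorHom, Category.id_comp]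
  have e2 : (P.p ⊗ₘ ((P.p ⊗ₘ P.p) ≫ (β_ P.X P.X).hom)) =
      P.X ◁ (β_ P.X P.X).hom ≫ (P.p ⊗ₘ P.p ⊗ₘ P.p) := by
    rw [← id_tensorHom, tensorHom_comp_tensorHom, Category.id_comp, braid_nat]
  have e3 : (P.p ⊗ₘ P.p ⊗ₘ P.p) ≫ P.X ◁ (β_ P.X P.X).hom =
      P.X ◁ (β_ P.X P.X).hom ≫ (P.p ⊗ₘ P.p ⊗ₘ P.p) := by
    rw [← e2, ← id_tensorHom, tensorHom_comp_tensorHom, Category.comp_id]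
  -- The only place where `he` enters.
  have e4 : ((P.p ⊗ₘ P.p) ⊗ₘ P.p) ≫ (((P.p ⊗ₘ P.p) ≫ e) ⊗ₘ P.p) =
      (P.X ◁ P.p ≫ e) ▷ P.X ≫ _ ◁ P.p := by
    rw [tensorHom_comp_tensorHom, reassoc_of% i2, P.idem, he,
      MonoidalCategory.tensorHom_def]
  -- The underlying morphism of the twist: in the idempotent completion every unitor, associator and
  -- braiding is the original one preceded by the idempotent of its source.
  change (P.p ≫ (λ_ P.X).inv) ≫ ((𝟙 _ ≫ c ≫ (P.p ⊗ₘ P.p)) ⊗ₘ P.p) ≫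
    (((P.p ⊗ₘ P.p) ⊗ₘ P.p) ≫ (α_ P.X P.X P.X).hom) ≫
    (P.p ⊗ₘ ((P.p ⊗ₘ P.p) ≫ (β_ P.X P.X).hom)) ≫
    ((P.p ⊗ₘ (P.p ⊗ₘ P.p)) ≫ (α_ P.X P.X P.X).inv) ≫
    (((P.p ⊗ₘ P.p) ≫ e ≫ 𝟙 _) ⊗ₘ P.p) ≫ (𝟙 _ ⊗ₘ P.p) ≫ (λ_ P.X).hom = _
  have h : leftTrace (P.X ◁ P.p ≫ e) c (β_ P.X P.X).hom = P.p ≫ leftCurl e c := by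
    rw [leftTrace_slide, ← BraidedCategory.braiding_naturality_right, leftTrace_comp_left, leftCurl]
  rw [Category.comp_id e, e1, e2]
  simp only [Category.assoc]
  rw [reassoc_of% i3, reassoc_of% a, reassoc_of% e3, reassoc_of% i3', reassoc_of% i3',
    reassoc_of% a', reassoc_of% e4, id_tensorHom, leftUnitor_naturality,
    leftUnitor_naturality_assoc, P.idem, ← P.idem_assoc (leftCurl e c ≫ P.p),
    ← Category.assoc P.p (leftCurl e c), ← h]
  simp only [leftTrace, Category.assoc]

/-- Here the closed strand ends in the left leg of the evaluation, so the hypothesis keeps the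
idempotent on that leg. -/
theorem rightTwist_compress (P : Karoubi C) (e : P.X ⊗ P.X ⟶ 𝟙_ C) (c : 𝟙_ C ⟶ P.X ⊗ P.X)
    (he : (P.p ⊗ₘ P.p) ≫ e = P.p ▷ P.X ≫ e) :
    (rightTwist (X := P) (TL.compress (P := P ⊗ P) (Q := 𝟙_ (Karoubi C)) e)
      (TL.compress (P := 𝟙_ (Karoubi C)) (Q := P ⊗ P) c) (Iso.refl _)).f =
      P.p ≫ rightCurl e c ≫ P.p := by
  have i2 : (P.p ⊗ₘ P.p) ≫ (P.p ⊗ₘ P.p) = P.p ⊗ₘ P.p := by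
    rw [tensorHom_comp_tensorHom, P.idem]
  have i3 : ((P.p ⊗ₘ P.p) ⊗ₘ P.p) ≫ ((P.p ⊗ₘ P.p) ⊗ₘ P.p) = ((P.p ⊗ₘ P.p) ⊗ₘ P.p) := by
    rw [tensorHom_comp_tensorHom, i2, P.idem]
  have i3' : (P.p ⊗ₘ P.p ⊗ₘ P.p) ≫ (P.p ⊗ₘ P.p ⊗ₘ P.p) = (P.p ⊗ₘ P.p ⊗ₘ P.p) := by
    rw [tensorHom_comp_tensorHom, i2, P.idem]
  have a := associator_naturality P.p P.p P.p
  have a' := associator_inv_naturality P.p P.p P.p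
  have e1 : (P.p ⊗ₘ (𝟙 _ ≫ c ≫ (P.p ⊗ₘ P.p))) = P.X ◁ c ≫ (P.p ⊗ₘ P.p ⊗ₘ P.p) := by
    rw [Category.id_comp, ← id_tensorHom, tensorHom_comp_tensorHom, Category.id_comp]
  have e2 : (((P.p ⊗ₘ P.p) ≫ (β_ P.X P.X).hom) ⊗ₘ P.p) =
      (β_ P.X P.X).hom ▷ P.X ≫ ((P.p ⊗ₘ P.p) ⊗ₘ P.p) := by
    rw [← tensorHom_id, tensorHom_comp_tensorHom, Category.id_comp, braid_nat]
  have e3 : ((P.p ⊗ₘ P.p) ⊗ₘ P.p) ≫ (β_ P.X P.X).hom ▷ P.X =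
      (β_ P.X P.X).hom ▷ P.X ≫ ((P.p ⊗ₘ P.p) ⊗ₘ P.p) := by
    rw [← e2, ← tensorHom_id, tensorHom_comp_tensorHom, Category.comp_id]
  have e4 : (P.p ⊗ₘ P.p ⊗ₘ P.p) ≫ (P.p ⊗ₘ ((P.p ⊗ₘ P.p) ≫ e)) =
      P.X ◁ (P.p ▷ P.X ≫ e) ≫ P.p ▷ _ := by
    rw [tensorHom_comp_tensorHom, reassoc_of% i2, P.idem, he,
      MonoidalCategory.tensorHom_def']
  change (P.p ≫ (ρ_ P.X).inv) ≫ (P.p ⊗ₘ (𝟙 _ ≫ c ≫ (P.p ⊗ₘ P.p))) ≫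
    ((P.p ⊗ₘ (P.p ⊗ₘ P.p)) ≫ (α_ P.X P.X P.X).inv) ≫
    (((P.p ⊗ₘ P.p) ≫ (β_ P.X P.X).hom) ⊗ₘ P.p) ≫
    (((P.p ⊗ₘ P.p) ⊗ₘ P.p) ≫ (α_ P.X P.X P.X).hom) ≫
    (P.p ⊗ₘ ((P.p ⊗ₘ P.p) ≫ e ≫ 𝟙 _)) ≫ (P.p ⊗ₘ 𝟙 _) ≫ (ρ_ P.X).hom = _
  have h : rightTrace (P.p ▷ P.X ≫ e) c (β_ P.X P.X).hom = P.p ≫ rightCurl e c := by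
    rw [rightTrace_slide, ← BraidedCategory.braiding_naturality_left, rightTrace_comp_left,
      rightCurl]
  rw [Category.comp_id e, e1, e2]
  simp only [Category.assoc]
  rw [reassoc_of% i3', reassoc_of% a', reassoc_of% e3, reassoc_of% i3, reassoc_of% i3,
    reassoc_of% a, reassoc_of% e4, tensorHom_id, rightUnitor_naturality,
    rightUnitor_naturality_assoc, P.idem, ← P.idem_assoc (rightCurl e c ≫ P.p),
    ← Category.assoc P.p (rightCurl e c), ← h]
  simp only [rightTrace, Category.assoc]

end KaroubiTwist

/-! ### Nested evaluations, layer by layer -/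

section NestExpand
universe v u
variable {C : Type u} [Category.{v} C] [MonoidalCategory C] {X₁ X₂ Y₁ Y₂ W : C}

/-- Brings a nested evaluation into the shape of the recursion for `nestedCaps`: structural maps,
one cap between two bundles of strands, structural maps, and then the outer evaluation. -/
theorem whiskerLeft_comp_nestEv (e₁ : Y₁ ⊗ X₁ ⟶ 𝟙_ C) (e₂ : Y₂ ⊗ X₂ ⟶ 𝟙_ C)
    (s : W ⟶ X₁ ⊗ X₂) : (Y₂ ⊗ Y₁) ◁ s ≫ nestEv e₁ e₂ =
      (((Y₂ ⊗ Y₁) ◁ s ≫ (α_ Y₂ Y₁ (X₁ ⊗ X₂)).hom ≫ Y₂ ◁ (α_ Y₁ X₁ X₂).inv) ≫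
        Y₂ ◁ (e₁ ▷ X₂) ≫ Y₂ ◁ (λ_ X₂).hom) ≫ e₂ := by
  simp [nestEv]

theorem nestCoev_comp_whiskerLeft (c₁ : 𝟙_ C ⟶ Y₁ ⊗ X₁) (c₂ : 𝟙_ C ⟶ Y₂ ⊗ X₂)
    (s : X₁ ⊗ X₂ ⟶ W) : nestCoev c₁ c₂ ≫ (Y₂ ⊗ Y₁) ◁ s =
      c₂ ≫ (Y₂ ◁ (λ_ X₂).inv ≫ Y₂ ◁ (c₁ ▷ X₂) ≫
        (Y₂ ◁ (α_ Y₁ X₁ X₂).hom ≫ (α_ Y₂ Y₁ (X₁ ⊗ X₂)).inv ≫ (Y₂ ⊗ Y₁) ◁ s)) := by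
  simp [nestCoev]

end NestExpand

/-! ### Renumbering of strands -/

namespace PreTL
variable {k : ℕ}

/-- The morphism is the transport along an equality of objects. -/
def IsTransport {X Y : PreTL k} (f : X ⟶ Y) : Prop := ∃ h : X = Y, f = eqToHom h

namespace IsTransport
variable {X Y Z : PreTL k}

/-- Proof irrelevance for equalities of objects. It plays the part of a coherence theorem: the
structural maps of this category are renumberings of dots, so two composites of them with the same
ends agree. -/
theorem unique {f g : X ⟶ Y} (hf : IsTransport f) (hg : IsTransport g) : f = g := by
  obtain ⟨h, rfl⟩ := hf
  obtain ⟨h', rfl⟩ := hg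
  rfl

theorem id (X : PreTL k) : IsTransport (𝟙 X) := ⟨rfl, rfl⟩

theorem eqToHom (h : X = Y) : IsTransport (CategoryTheory.eqToHom h) := ⟨h, rfl⟩

theorem comp {f : X ⟶ Y} {g : Y ⟶ Z} (hf : IsTransport f) (hg : IsTransport g) :
    IsTransport (f ≫ g) := by
  obtain ⟨rfl, rfl⟩ := hf
  obtain ⟨rfl, rfl⟩ := hg
  exact ⟨rfl, Category.comp_id _⟩

theorem wl (W : PreTL k) {f : X ⟶ Y} (hf : IsTransport f) : IsTransport (W ◁ f) := by
  obtain ⟨rfl, rfl⟩ := hf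
  exact ⟨rfl, whiskerLeft_id _ _⟩

theorem wr {f : X ⟶ Y} (hf : IsTransport f) (W : PreTL k) : IsTransport (f ▷ W) := by
  obtain ⟨rfl, rfl⟩ := hf
  exact ⟨rfl, id_whiskerRight _ _⟩

theorem ofDiagram_iso {m n : ℕ} (h : m = n) :
    IsTransport (k := k) (ofDiagram (DiagramCat.iso h).hom) := by
  subst h; exact id _

theorem ofDiagram_iso_inv {m n : ℕ} (h : m = n) :
    IsTransport (k := k) (ofDiagram (DiagramCat.iso h).inv) := by
  subst h; exact id _

theorem assoc_hom (X Y Z : PreTL k) : IsTransport (α_ X Y Z).hom := ofDiagram_iso _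
theorem assoc_inv (X Y Z : PreTL k) : IsTransport (α_ X Y Z).inv := ofDiagram_iso_inv _
theorem leftUnitor_hom (X : PreTL k) : IsTransport (λ_ X).hom := ofDiagram_iso _
theorem leftUnitor_inv (X : PreTL k) : IsTransport (λ_ X).inv := ofDiagram_iso_inv _
theorem rightUnitor_hom (X : PreTL k) : IsTransport (ρ_ X).hom := ofDiagram_iso _
theorem rightUnitor_inv (X : PreTL k) : IsTransport (ρ_ X).inv := ofDiagram_iso_inv _

end IsTransport

/-- Adding a strand on the right of n strands gives n + 1 strands by definition; adding it on the
left gives 1 + n, which is equal to n + 1 only by commutativity of addition. -/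
theorem strands_shift (k n : ℕ) : strands k 1 ⊗ strands k n = strands k (n + 1) :=
  congrArg (strands k) (Nat.add_comm 1 n)

/-- Moving a strand from the left to the right of `n` strands by renumbering. -/
def shift (k n : ℕ) : strands k 1 ⊗ strands k n ≅ strands k n ⊗ strands k 1 :=
  eqToIso (strands_shift k n)

theorem isTransport_shift_hom (n : ℕ) : IsTransport (shift k n).hom := ⟨strands_shift k n, rfl⟩
theorem isTransport_shift_inv (n : ℕ) : IsTransport (shift k n).inv :=
  ⟨(strands_shift k n).symm, rfl⟩

/-! ### Nested caps and cups as iterated nestings -/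

/-- The `j` nested caps. -/
def caps (k j : ℕ) : strands k j ⊗ strands k j ⟶ 𝟙_ (PreTL k) :=
  ofDiagram (DiagramCat.ofTerm (nestedCaps j))

/-- The `j` nested cups. -/
def cups (k j : ℕ) : 𝟙_ (PreTL k) ⟶ strands k j ⊗ strands k j :=
  ofDiagram (DiagramCat.ofTerm (nestedCups j))

theorem caps_zero : caps k 0 = (λ_ (𝟙_ (PreTL k))).hom := rfl

theorem cups_zero : cups k 0 = (λ_ (𝟙_ (PreTL k))).inv := rfl

theorem strands_eq {m n : ℕ} (h : m = n) : strands k m = strands k n := congrArg _ h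

theorem ofDiagram_cast {m n m' n' : ℕ} (hm : m = m') (hn : n = n') (f : DiagramTerm m n) :
    (ofDiagram (DiagramCat.ofTerm (f.cast hm hn)) : strands k m' ⟶ strands k n') =
      eqToHom (strands_eq hm.symm) ≫ (ofDiagram (DiagramCat.ofTerm f) : strands k m ⟶ strands k n) ≫
        eqToHom (strands_eq hn) := by
  subst hm hn
  exact ((Category.id_comp _).trans (Category.comp_id _)).symm

theorem ofDiagram_sandwich {m n : ℕ} (j : ℕ) (f : DiagramTerm m n) :
    (ofDiagram (DiagramCat.ofTerm
      ((DiagramTerm.id j).tensor (f.tensor (DiagramTerm.id j)))) :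
        strands k j ⊗ (strands k m ⊗ strands k j) ⟶ strands k j ⊗ (strands k n ⊗ strands k j)) =
      strands k j ◁ ((ofDiagram (DiagramCat.ofTerm f) : strands k m ⟶ strands k n) ▷ strands k j) :=
  (ofDiagram_tensor (DiagramCat.ofTerm (DiagramTerm.id j))
    (DiagramCat.ofTerm (f.tensor (DiagramTerm.id j)))).trans
      ((id_tensorHom (strands k j) _).trans (congrArg (fun x => strands k j ◁ x)
        ((ofDiagram_tensor (DiagramCat.ofTerm f) (DiagramCat.ofTerm (DiagramTerm.id j))).trans
          (tensorHom_id _ (strands k j)))))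

/-- The new cap is the innermost one. Its left leg is the last of the left strands, as the numbering
wants, but its right leg is the first of the right strands; hence the `shift` on that side only. -/
theorem caps_succ (j : ℕ) : caps k (j + 1) =
    (strands k j ⊗ strands k 1) ◁ (shift k j).inv ≫ nestEv (cap k) (caps k j) := by
  rw [whiskerLeft_comp_nestEv]
  refine (ofDiagram_comp (k := k) (X := ⟨j + 1 + (j + 1)⟩) (Y := ⟨j + j⟩) (Z := ⟨0⟩)
    (DiagramCat.ofTerm _) (DiagramCat.ofTerm (nestedCaps j))).trans
      (congrArg (fun x => x ≫ caps k j) ?_)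
  refine (ofDiagram_cast _ _ _).trans ?_
  -- Both sides are a renumbering, the layer with one cap, and a renumbering. The layers agree by
  -- `ofDiagram_sandwich` and the renumberings by uniqueness.
  refine congr (congrArg _ (IsTransport.unique ⟨_, rfl⟩ ?_)) (congr (congrArg _
    (ofDiagram_sandwich _ _)) (IsTransport.unique ⟨_, rfl⟩ ?_))
  · exact ((isTransport_shift_inv j).wl _).comp ((IsTransport.assoc_hom _ _ _).comp
      ((IsTransport.assoc_inv _ _ _).wl _))
  · exact (IsTransport.leftUnitor_hom _).wl _

theorem cups_succ (j : ℕ) : cups k (j + 1) =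
    nestCoev (cup k) (cups k j) ≫ (strands k j ⊗ strands k 1) ◁ (shift k j).hom := by
  rw [nestCoev_comp_whiskerLeft]
  refine (ofDiagram_comp (k := k) (Z := ⟨j + 1 + (j + 1)⟩) (Y := ⟨j + j⟩) (X := ⟨0⟩)
    (DiagramCat.ofTerm (nestedCups j)) (DiagramCat.ofTerm _)).trans
      (congrArg (fun x => cups k j ≫ x) ?_)
  refine (ofDiagram_cast _ _ _).trans ?_
  refine congr (congrArg _ (IsTransport.unique ⟨_, rfl⟩ ?_)) (congr (congrArg _
    (ofDiagram_sandwich _ _)) (IsTransport.unique ⟨_, rfl⟩ ?_))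
  · exact (IsTransport.leftUnitor_inv _).wl _
  · exact ((IsTransport.assoc_hom _ _ _).wl _).comp ((IsTransport.assoc_inv _ _ _).comp
      ((isTransport_shift_hom j).wl _))

/-! ### Jones–Wenzl idempotents and crossings -/

/-- This is what the coefficient [n+1]/[n+2] is made for: by the last clause of `jonesWenzl_aux`, a
hook, f_{n+1} ⊗ 1 and a second hook collapse with the factor -[n+2]/[n+1], so the two terms of the
recursion cancel. -/
theorem jonesWenzl_comp_hook (n : ℕ) (hn : n + 1 ≤ k) :
    jonesWenzl k (n + 2) ≫ hook k n = 0 := by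
  have h := (jonesWenzl_aux (k := k) n (by omega)).2.2.2
  have h' := (jonesWenzl_aux (k := k) n (by omega)).2.2.1
  have q1 := qInt_ne_zero k (n + 1) (by omega) (by omega)
  have q2 := qInt_ne_zero k (n + 2) (by omega) (by omega)
  have h2 := congrArg addStrand h'
  rw [addStrand_comp] at h2
  rw [jonesWenzl, Preadditive.add_comp, Linear.smul_comp, Category.assoc, Category.assoc, h,
    Linear.comp_smul, reassoc_of% h2, smul_smul]
  have e : qInt k (n + 1) / qInt k (n + 2) * -(qInt k (n + 2) / qInt k (n + 1)) = -1 := by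
    field_simp
  rw [e, neg_one_smul, add_neg_cancel]

theorem jonesWenzl_comp_addStrand (n : ℕ) (hn : n ≤ k) :
    jonesWenzl k (n + 1) ≫ addStrand (jonesWenzl k n) = jonesWenzl k (n + 1) :=
  (jonesWenzl_aux n hn).2.2.1

/-- The braiding of `n` strands with one strand (in this order), as an endomorphism of `n + 1`
strands. -/
def rightCross (k n : ℕ) : strands k (n + 1) ⟶ strands k (n + 1) :=
  (β_ (strands k n) (strands k 1)).hom ≫ (shift k n).hom

/-- The braiding of one strand with `n` strands (in this order), as an endomorphism of `n + 1`
strands. -/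
def leftCross (k n : ℕ) : strands k (n + 1) ⟶ strands k (n + 1) :=
  (shift k n).inv ≫ (β_ (strands k 1) (strands k n)).hom

theorem braiding_one_one' : (β_ (strands k 1) (strands k 1)).hom =
    crossing (rootT k) (cup k) (cap k) := braiding_one_one

/-- The crossing of the last two of `n + 2` strands. -/
def lastCross (k n : ℕ) : strands k (n + 2) ⟶ strands k (n + 2) :=
  rootT k • 𝟙 (strands k (n + 2)) + (rootT k)⁻¹ • hook k n

theorem whiskerLeft_crossing (n : ℕ) :
    strands k n ◁ crossing (rootT k) (cup k) (cap k) = lastCross k n := by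
  simp only [crossing, MonoidalPreadditive.whiskerLeft_add, MonoidalLinear.whiskerLeft_smul,
    whiskerLeft_id]
  rfl

/-- The cup-cap term of the crossing is killed, and the identity term has coefficient t. -/
theorem jonesWenzl_comp_lastCross (n : ℕ) (hn : n + 1 ≤ k) :
    jonesWenzl k (n + 2) ≫ lastCross k n = rootT k • jonesWenzl k (n + 2) := by
  rw [lastCross, Preadditive.comp_add, Linear.comp_smul, Linear.comp_smul,
    jonesWenzl_comp_hook n hn, Category.comp_id, smul_zero, add_zero]

theorem shift_succ_hom (n : ℕ) : (shift k (n + 1)).hom =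
    (α_ (strands k 1) (strands k n) (strands k 1)).inv ≫ (shift k n).hom ▷ strands k 1 :=
  IsTransport.unique (isTransport_shift_hom _)
    ((IsTransport.assoc_inv _ _ _).comp ((isTransport_shift_hom n).wr _))

theorem shift_succ_inv (n : ℕ) : (shift k (n + 1)).inv =
    (shift k n).inv ▷ strands k 1 ≫ (α_ (strands k 1) (strands k n) (strands k 1)).hom :=
  IsTransport.unique (isTransport_shift_inv _)
    (((isTransport_shift_inv n).wr _).comp (IsTransport.assoc_hom _ _ _))

/-- The hexagon: the moving strand crosses the first n strands and then the last one. For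
`rightCross` the order is reversed, so the elementary crossing comes first there. -/
theorem leftCross_succ (n : ℕ) :
    leftCross k (n + 1) = addStrand (leftCross k n) ≫ lastCross k n := by
  have h := BraidedCategory.hexagon_forward (strands k 1) (strands k n) (strands k 1)
  rw [braiding_one_one', whiskerLeft_crossing] at h
  -- The associators of n, 1 and 1 strands are identities by the definition of addition and are
  -- dropped from the hexagon.
  have h' : (α_ (strands k 1) (strands k n) (strands k 1)).hom ≫
      (β_ (strands k 1) (strands k n ⊗ strands k 1)).hom =
        (β_ (strands k 1) (strands k n)).hom ▷ strands k 1 ≫ lastCross k n :=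
    (congrArg _ (Category.comp_id _).symm).trans (h.trans (congrArg _ (Category.id_comp _)))
  have h₂ := congrArg (fun x => (shift k n).inv ▷ strands k 1 ≫ x) h'
  have h₃ := congrArg (fun x => x ≫ (β_ (strands k 1) (strands k n ⊗ strands k 1)).hom)
    (shift_succ_inv (k := k) n)
  refine h₃.trans ((Category.assoc _ _ _).trans (h₂.trans ((Category.assoc _ _ _).symm.trans ?_)))
  exact congrArg (fun x => x ≫ lastCross k n) (comp_whiskerRight _ _ _).symm

theorem rightCross_succ (n : ℕ) :
    rightCross k (n + 1) = lastCross k n ≫ addStrand (rightCross k n) := by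
  have h := BraidedCategory.hexagon_reverse (strands k n) (strands k 1) (strands k 1)
  rw [braiding_one_one', whiskerLeft_crossing] at h
  have h' : (β_ (strands k n ⊗ strands k 1) (strands k 1)).hom ≫
      (α_ (strands k 1) (strands k n) (strands k 1)).inv =
        lastCross k n ≫ (β_ (strands k n) (strands k 1)).hom ▷ strands k 1 :=
    (Category.id_comp _).symm.trans (h.trans (congrArg _ (Category.id_comp _)))
  have h₂ := congrArg (fun x => x ≫ (shift k n).hom ▷ strands k 1) h'
  have h₃ := congrArg (fun x => (β_ (strands k n ⊗ strands k 1) (strands k 1)).hom ≫ x)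
    (shift_succ_hom (k := k) n)
  refine h₃.trans ((Category.assoc _ _ _).symm.trans (h₂.trans ((Category.assoc _ _ _).trans ?_)))
  exact congrArg (fun x => lastCross k n ≫ x) (comp_whiskerRight _ _ _).symm

theorem leftCross_zero : leftCross k 0 = 𝟙 _ := by
  have h : IsTransport (β_ (strands k 1) (𝟙_ (PreTL k))).hom := by
    rw [braiding_tensorUnit_right]
    exact (IsTransport.rightUnitor_hom _).comp (IsTransport.leftUnitor_inv _)
  exact ((isTransport_shift_inv 0).comp h).unique (IsTransport.id _)

theorem rightCross_zero : rightCross k 0 = 𝟙 _ := by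
  have h : IsTransport (β_ (𝟙_ (PreTL k)) (strands k 1)).hom := by
    rw [braiding_tensorUnit_left]
    exact (IsTransport.leftUnitor_hom _).comp (IsTransport.rightUnitor_inv _)
  exact (h.comp (isTransport_shift_hom 0)).unique (IsTransport.id _)

/-- The braiding consists of n elementary crossings. Each contributes t, once f_{n+1} has released a
factor f_n ⊗ 1 to meet the earlier crossings. -/
theorem jonesWenzl_comp_leftCross (n : ℕ) (hn : n ≤ k) :
    jonesWenzl k (n + 1) ≫ leftCross k n = rootT k ^ n • jonesWenzl k (n + 1) := by
  induction n with
  | zero => rw [leftCross_zero, Category.comp_id, pow_zero, one_smul]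
  | succ n ih =>
    have h := jonesWenzl_comp_addStrand (k := k) (n + 1) hn
    have e : jonesWenzl k (n + 2) ≫ addStrand (leftCross k n) =
        rootT k ^ n • jonesWenzl k (n + 2) := by
      rw [← h, Category.assoc, ← addStrand_comp, ih (by omega), addStrand_smul, Linear.comp_smul]
    rw [leftCross_succ, ← Category.assoc, e, Linear.smul_comp, jonesWenzl_comp_lastCross n hn,
      smul_smul, pow_succ]

theorem jonesWenzl_comp_rightCross (n : ℕ) (hn : n ≤ k) :
    jonesWenzl k (n + 1) ≫ rightCross k n = rootT k ^ n • jonesWenzl k (n + 1) := by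
  induction n with
  | zero => rw [rightCross_zero, Category.comp_id, pow_zero, one_smul]
  | succ n ih =>
    have h := jonesWenzl_comp_addStrand (k := k) (n + 1) hn
    have e : jonesWenzl k (n + 2) ≫ addStrand (rightCross k n) =
        rootT k ^ n • jonesWenzl k (n + 2) := by
      rw [← h, Category.assoc, ← addStrand_comp, ih (by omega), addStrand_smul, Linear.comp_smul]
    rw [rightCross_succ, ← Category.assoc, jonesWenzl_comp_lastCross n hn, Linear.smul_comp, e,
      smul_smul, pow_succ']

/-! ### Curls of j strands -/

theorem leftCurl_strand : leftCurl (cap k) (cup k) = (-rootT k ^ 3) • 𝟙 (strands k 1) := by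
  rw [leftCurl, braiding_one_one']
  exact leftTrace_crossing (rootT_ne_zero k) (by rw [loop, loopValue_eq]) zigzag₁ zigzag₂

theorem rightCurl_strand : rightCurl (cap k) (cup k) = (-rootT k ^ 3) • 𝟙 (strands k 1) := by
  rw [rightCurl, braiding_one_one']
  exact rightTrace_crossing (rootT_ne_zero k) (by rw [loop, loopValue_eq]) zigzag₁ zigzag₂

/-- `leftCurl_nest` with one inner and j outer strands. The conjugation by `shift` coming from
`leftCurl_iso` is absorbed in the definitions of the two crossings. -/
theorem leftCurl_succ (j : ℕ) : leftCurl (caps k (j + 1)) (cups k (j + 1)) =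
    (-rootT k ^ 3) • (leftCross k j ≫ addStrand (leftCurl (caps k j) (cups k j)) ≫
      rightCross k j) := by
  rw [caps_succ, cups_succ]
  refine (leftCurl_iso (nestEv (cap k) (caps k j)) (nestCoev (cup k) (cups k j)) (shift k j)).trans ?_
  rw [leftCurl_nest, leftCurl_strand, MonoidalLinear.smul_whiskerRight, id_whiskerRight,
    Linear.smul_comp, Category.id_comp, Linear.smul_comp, Linear.comp_smul]
  refine congrArg _ ?_
  rw [Category.assoc, Category.assoc]
  exact (Category.assoc _ _ _).symm

/-- For the right curl there is no conjugation, so `shift` and its inverse are inserted between the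
two braidings. Naturality has first moved the curl of the j strands to the front. -/
theorem rightCurl_succ (j : ℕ) : rightCurl (caps k (j + 1)) (cups k (j + 1)) =
    (-rootT k ^ 3) • (addStrand (rightCurl (caps k j) (cups k j)) ≫ rightCross k j ≫
      leftCross k j) := by
  rw [caps_succ, cups_succ]
  refine (rightCurl_iso (nestEv (cap k) (caps k j)) (nestCoev (cup k) (cups k j)) (shift k j)).trans ?_
  rw [rightCurl_nest, rightCurl_strand, MonoidalLinear.whiskerLeft_smul, whiskerLeft_id,
    Linear.smul_comp, Category.id_comp, ← BraidedCategory.braiding_naturality_left_assoc]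
  refine congrArg _ (congrArg (fun x => addStrand (rightCurl (caps k j) (cups k j)) ≫ x) ?_)
  have h : ((β_ (strands k j) (strands k 1)).hom ≫ (shift k j).hom) ≫
      ((shift k j).inv ≫ (β_ (strands k 1) (strands k j)).hom) =
      (β_ (strands k j) (strands k 1)).hom ≫ (β_ (strands k 1) (strands k j)).hom := by simp
  exact h.symm

/-- Each new strand contributes -t³ for its own curl and t^j for each of its two passages across the
j others. -/
theorem jonesWenzl_comp_leftCurl (j : ℕ) (hj : j ≤ k + 1) :
    jonesWenzl k j ≫ leftCurl (caps k j) (cups k j) =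
      ((-1) ^ j * rootT k ^ (j ^ 2 + 2 * j)) • jonesWenzl k j := by
  induction j with
  | zero =>
    rw [caps_zero, cups_zero]
    refine (congrArg _ leftCurl_unit).trans ((Category.comp_id _).trans ?_)
    simp
  | succ j ih =>
    have h := jonesWenzl_comp_addStrand (k := k) j (by omega)
    have e : jonesWenzl k (j + 1) ≫ addStrand (leftCurl (caps k j) (cups k j)) =
        ((-1) ^ j * rootT k ^ (j ^ 2 + 2 * j)) • jonesWenzl k (j + 1) := by
      rw [← h, Category.assoc, ← addStrand_comp, ih (by omega), addStrand_smul, Linear.comp_smul]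
    rw [leftCurl_succ, Linear.comp_smul, ← Category.assoc, jonesWenzl_comp_leftCross j (by omega),
      Linear.smul_comp, ← Category.assoc, e, Linear.smul_comp,
      jonesWenzl_comp_rightCross j (by omega), smul_smul, smul_smul, smul_smul]
    -- The exponents agree because (j+1)² + 2(j+1) = (j² + 2j) + 2j + 3.
    congr 1
    ring

theorem jonesWenzl_comp_rightCurl (j : ℕ) (hj : j ≤ k + 1) :
    jonesWenzl k j ≫ rightCurl (caps k j) (cups k j) =
      ((-1) ^ j * rootT k ^ (j ^ 2 + 2 * j)) • jonesWenzl k j := by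
  induction j with
  | zero =>
    rw [caps_zero, cups_zero]
    refine (congrArg _ rightCurl_unit).trans ((Category.comp_id _).trans ?_)
    simp
  | succ j ih =>
    have h := jonesWenzl_comp_addStrand (k := k) j (by omega)
    have e : jonesWenzl k (j + 1) ≫ addStrand (rightCurl (caps k j) (cups k j)) =
        ((-1) ^ j * rootT k ^ (j ^ 2 + 2 * j)) • jonesWenzl k (j + 1) := by
      rw [← h, Category.assoc, ← addStrand_comp, ih (by omega), addStrand_smul, Linear.comp_smul]
    rw [rightCurl_succ, Linear.comp_smul, ← Category.assoc, e, Linear.smul_comp, ← Category.assoc,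
      jonesWenzl_comp_rightCross j (by omega), Linear.smul_comp,
      jonesWenzl_comp_leftCross j (by omega), smul_smul, smul_smul, smul_smul]
    congr 1
    ring

end PreTL

/-! ### Moving morphisms across nested evaluations -/

section NestMates
universe v u
variable {C : Type u} [Category.{v} C] [MonoidalCategory C] {X₁ X₂ X₃ Y₁ Y₂ Y₃ W : C}

theorem nestEv_comp (e₁ : Y₁ ⊗ X₁ ⟶ 𝟙_ C) (e₂ : Y₂ ⊗ X₂ ⟶ 𝟙_ C) (s : W ⟶ X₂) :
    nestEv e₁ (Y₂ ◁ s ≫ e₂) = (Y₂ ⊗ Y₁) ◁ (X₁ ◁ s) ≫ nestEv e₁ e₂ := by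
  have h : (α_ Y₁ X₁ W).inv ≫ e₁ ▷ W ≫ (λ_ W).hom ≫ s =
      Y₁ ◁ (X₁ ◁ s) ≫ (α_ Y₁ X₁ X₂).inv ≫ e₁ ▷ X₂ ≫ (λ_ X₂).hom := by
    rw [← leftUnitor_naturality, ← whisker_exchange_assoc]
    simp
  have h' : nestEv e₁ (Y₂ ◁ s ≫ e₂) = (α_ Y₂ Y₁ (X₁ ⊗ W)).hom ≫
      Y₂ ◁ ((α_ Y₁ X₁ W).inv ≫ e₁ ▷ W ≫ (λ_ W).hom ≫ s) ≫ e₂ := by simp [nestEv]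
  rw [h', h]
  simp [nestEv]

/-- Nesting is associative up to the associators of the two bundles of legs. This allows the two
innermost caps to be treated as one evaluation. -/
theorem nestEv_nestEv (e₁ : Y₁ ⊗ X₁ ⟶ 𝟙_ C) (e₂ : Y₂ ⊗ X₂ ⟶ 𝟙_ C) (e₃ : Y₃ ⊗ X₃ ⟶ 𝟙_ C) :
    nestEv e₁ (nestEv e₂ e₃) = (α_ Y₃ Y₂ Y₁).hom ▷ _ ≫ _ ◁ (α_ X₁ X₂ X₃).inv ≫
      nestEv (nestEv e₁ e₂) e₃ := by
  simp only [nestEv]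
  monoidal

theorem nestEv_mate_inner (e₁ : Y₁ ⊗ X₁ ⟶ 𝟙_ C) (e₂ : Y₂ ⊗ X₂ ⟶ 𝟙_ C) {g : Y₁ ⟶ Y₁}
    {h : X₁ ⟶ X₁} (H : g ▷ X₁ ≫ e₁ = Y₁ ◁ h ≫ e₁) :
    (Y₂ ◁ g) ▷ (X₁ ⊗ X₂) ≫ nestEv e₁ e₂ = (Y₂ ⊗ Y₁) ◁ (h ▷ X₂) ≫ nestEv e₁ e₂ := by
  have h₁ : (Y₂ ◁ g) ▷ (X₁ ⊗ X₂) ≫ nestEv e₁ e₂ = (α_ Y₂ Y₁ (X₁ ⊗ X₂)).hom ≫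
      Y₂ ◁ ((α_ Y₁ X₁ X₂).inv ≫ (g ▷ X₁ ≫ e₁) ▷ X₂ ≫ (λ_ X₂).hom) ≫ e₂ := by
    simp only [nestEv]
    monoidal
  rw [h₁, H]
  simp only [nestEv]
  monoidal

theorem nestEv_mate_outer (e₁ : Y₁ ⊗ X₁ ⟶ 𝟙_ C) (e₂ : Y₂ ⊗ X₂ ⟶ 𝟙_ C) {g : Y₂ ⟶ Y₂}
    {h : X₂ ⟶ X₂} (H : g ▷ X₂ ≫ e₂ = Y₂ ◁ h ≫ e₂) :
    (g ▷ Y₁) ▷ (X₁ ⊗ X₂) ≫ nestEv e₁ e₂ = (Y₂ ⊗ Y₁) ◁ (X₁ ◁ h) ≫ nestEv e₁ e₂ := by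
  rw [← nestEv_comp, ← H]
  rw [nestEv, nestEv, associator_naturality_left_assoc, ← whisker_exchange_assoc]

/-- A cup on the left legs of two nested caps straightens, by zigzags, to a single cap on the right
legs, and symmetrically. Hence both sides reduce to two caps side by side. -/
theorem nestEv_zigzag {A : C} {η : 𝟙_ C ⟶ A ⊗ A} {ε : A ⊗ A ⟶ 𝟙_ C}
    (z₁ : A ◁ η ≫ (α_ A A A).inv ≫ ε ▷ A = (ρ_ A).hom ≫ (λ_ A).inv)
    (z₂ : η ▷ A ≫ (α_ A A A).hom ≫ A ◁ ε = (λ_ A).hom ≫ (ρ_ A).inv) :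
    (ε ≫ η) ▷ (A ⊗ A) ≫ nestEv ε ε = (A ⊗ A) ◁ (ε ≫ η) ≫ nestEv ε ε := by
  have h₁ : η ▷ (A ⊗ A) ≫ nestEv ε ε = (λ_ (A ⊗ A)).hom ≫ ε := by
    have : η ▷ (A ⊗ A) ≫ nestEv ε ε = (α_ (𝟙_ C) A A).inv ≫
        (η ▷ A ≫ (α_ A A A).hom ≫ A ◁ ε) ▷ A ≫ (ρ_ A).hom ▷ A ≫ ε := by
      simp only [nestEv]
      monoidal
    rw [this, z₂]
    monoidal
  have h₂ : (A ⊗ A) ◁ η ≫ nestEv ε ε = (ρ_ (A ⊗ A)).hom ≫ ε := by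
    have : (A ⊗ A) ◁ η ≫ nestEv ε ε = (α_ A A (𝟙_ C)).hom ≫
        A ◁ (A ◁ η ≫ (α_ A A A).inv ≫ ε ▷ A) ≫ A ◁ (λ_ A).hom ≫ ε := by
      simp only [nestEv]
      monoidal
    rw [this, z₁]
    monoidal
  rw [comp_whiskerRight, MonoidalCategory.whiskerLeft_comp, Category.assoc, Category.assoc, h₁, h₂,
    ← leftUnitor_naturality, ← whisker_exchange_assoc, unitors_equal, rightUnitor_naturality]

/-- Carries a relation between left and right legs through a renumbering of both bundles of legs.
Only the composites met in the middle have to cancel. -/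
theorem mate_conj {P P' Q Q' : C} {E : P' ⊗ Q' ⟶ 𝟙_ C} {g' : P' ⟶ P'} {h' : Q' ⟶ Q'}
    (H : g' ▷ Q' ≫ E = P' ◁ h' ≫ E) {a : P ⟶ P'} {a' : P' ⟶ P} (ha : a' ≫ a = 𝟙 _)
    {b : Q ⟶ Q'} {b' : Q' ⟶ Q} (hb : b' ≫ b = 𝟙 _) :
    (a ≫ g' ≫ a') ▷ Q ≫ a ▷ Q ≫ P' ◁ b ≫ E = P ◁ (b ≫ h' ≫ b') ≫ a ▷ Q ≫ P' ◁ b ≫ E := by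
  rw [whisker_exchange_assoc, ← comp_whiskerRight_assoc, ← MonoidalCategory.whiskerLeft_comp_assoc,
    Category.assoc, Category.assoc, Category.assoc, Category.assoc, ha, hb, Category.comp_id,
    Category.comp_id, comp_whiskerRight_assoc, ← whisker_exchange_assoc g', H,
    MonoidalCategory.whiskerLeft_comp_assoc]

theorem whisker_collect {P P' Q Q₁ Q₂ Q' : C} (a : P ⟶ P') (s₁ : Q ⟶ Q₁) (s₂ : Q₁ ⟶ Q₂)
    (s₃ : Q₂ ⟶ Q') (E : P' ⊗ Q' ⟶ 𝟙_ C) :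
    P ◁ s₁ ≫ P ◁ s₂ ≫ a ▷ Q₂ ≫ P' ◁ s₃ ≫ E = a ▷ Q ≫ P' ◁ (s₁ ≫ s₂ ≫ s₃) ≫ E := by
  rw [whisker_exchange_assoc, whisker_exchange_assoc]
  simp

end NestMates

/-! ### Cup-caps on adjacent strands -/

namespace PreTL
variable {k : ℕ}

/-- Juxtaposition of one strand on the left. -/
def addLeft {m n : ℕ} (g : strands k m ⟶ strands k n) : strands k (m + 1) ⟶ strands k (n + 1) :=
  (shift k m).inv ≫ strands k 1 ◁ g ≫ (shift k n).hom

/-- Strands added on opposite sides do not interact. The numbering agrees because shifting past n +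
1 strands is shifting past n of them, with one more strand on the right. -/
theorem addLeft_addStrand {m n : ℕ} (g : strands k m ⟶ strands k n) :
    addLeft (addStrand g) = addStrand (addLeft g) := by
  have h : ((shift k m).inv ▷ strands k 1 ≫ (α_ _ _ _).hom) ≫ strands k 1 ◁ (g ▷ strands k 1) ≫
      ((α_ _ _ _).inv ≫ (shift k n).hom ▷ strands k 1) =
      ((shift k m).inv ≫ strands k 1 ◁ g ≫ (shift k n).hom) ▷ strands k 1 := by simp
  rw [← shift_succ_inv, ← shift_succ_hom] at h
  exact h

theorem IsTransport.eq_id {X : PreTL k} {f : X ⟶ X} (hf : IsTransport f) : f = 𝟙 X :=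
  hf.unique (.id X)

/-- Normal form for a morphism between renumberings: only the ends matter, so intermediate
structural maps can be replaced at will. -/
theorem IsTransport.conj_eq {X X' Y Z Z' W : PreTL k} {p : X ⟶ Y} {r : Y ⟶ Z} {r' : Z' ⟶ W}
    {q : W ⟶ X'} {l : X ⟶ Z} {l' : Z' ⟶ X'} (u : Z ⟶ Z') (hp : IsTransport p)
    (hr : IsTransport r) (hr' : IsTransport r') (hq : IsTransport q) (hl : IsTransport l)
    (hl' : IsTransport l') : p ≫ (r ≫ u ≫ r') ≫ q = l ≫ u ≫ l' := by
  rw [← (hp.comp hr).unique hl, ← (hr'.comp hq).unique hl']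
  simp only [Category.assoc]

/-- A cup-cap on the last two strands still sits on the last two when a strand is added on the left.
-/
theorem addLeft_hook (n : ℕ) : addLeft (hook k n) = hook k (n + 1) := by
  have h : strands k 1 ◁ (strands k n ◁ (cap k ≫ cup k)) =
      ((α_ _ _ _).inv ≫ (shift k n).hom ▷ _) ≫ (strands k n ⊗ strands k 1) ◁ (cap k ≫ cup k) ≫
        (shift k n).inv ▷ _ ≫ (α_ _ _ _).hom := by
    rw [Category.assoc, ← whisker_exchange_assoc]
    simp
  have h₂ := congrArg (fun x => (shift k (n + 2)).inv ≫ x ≫ (shift k (n + 2)).hom) h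
  have a₁ := (IsTransport.assoc_inv (strands k 1) (strands k n) (strands k 1 ⊗ strands k 1)).comp
    ((isTransport_shift_hom n).wr _)
  have a₂ := ((isTransport_shift_inv n).wr _).comp
    (IsTransport.assoc_hom (strands k 1) (strands k n) (strands k 1 ⊗ strands k 1))
  have h₃ := IsTransport.conj_eq (hook k (n + 1)) (isTransport_shift_inv (n + 2)) a₁ a₂
    (isTransport_shift_hom (n + 2)) (.id _) (.id _)
  exact h₂.trans (h₃.trans ((Category.id_comp _).trans (Category.comp_id _)))

/-- The elements `U_i ⊗ 1` for `i` the first position. -/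
def hookFirst (k : ℕ) : (n : ℕ) → (strands k (n + 2) ⟶ strands k (n + 2))
  | 0 => hook k 0
  | n + 1 => addStrand (hookFirst k n)

/-- The generators of the Temperley–Lieb algebras: the cup-cap on two adjacent strands. -/
inductive IsHook : ∀ {n : ℕ}, (strands k n ⟶ strands k n) → Prop
  | last (n : ℕ) : IsHook (hook k n)
  | addStrand {n : ℕ} {g : strands k n ⟶ strands k n} : IsHook g → IsHook (addStrand g)

/-- The generators of the Temperley–Lieb algebras, built up by adding strands on the left. -/
inductive IsHookLeft : ∀ {n : ℕ}, (strands k n ⟶ strands k n) → Prop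
  | first (n : ℕ) : IsHookLeft (hookFirst k n)
  | addLeft {n : ℕ} {g : strands k n ⟶ strands k n} : IsHookLeft g → IsHookLeft (addLeft g)

theorem IsHookLeft.addStrand {n : ℕ} {g : strands k n ⟶ strands k n} (hg : IsHookLeft g) :
    IsHookLeft (addStrand g) := by
  induction hg with
  | first n => exact .first (n + 1)
  | addLeft _ ih => rw [← addLeft_addStrand]; exact ih.addLeft

theorem isHookLeft_hook (n : ℕ) : IsHookLeft (hook k n) := by
  induction n with
  | zero => exact .first 0
  | succ n ih => rw [← addLeft_hook]; exact ih.addLeft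

/-- Growing on the right matches the recursion for the idempotents, growing on the left matches the
right legs of nested caps. Since the two kinds of growth commute, both descriptions reach the same
cup-caps. -/
theorem IsHook.isHookLeft {n : ℕ} {g : strands k n ⟶ strands k n} (hg : IsHook g) :
    IsHookLeft g := by
  induction hg with
  | last n => exact isHookLeft_hook n
  | addStrand _ ih => exact ih.addStrand

theorem isHook_hookFirst (n : ℕ) : IsHook (hookFirst k n) := by
  induction n with
  | zero => exact .last 0
  | succ n ih => exact ih.addStrand

theorem IsHook.addLeft {n : ℕ} {g : strands k n ⟶ strands k n} (hg : IsHook g) :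
    IsHook (addLeft g) := by
  induction hg with
  | last n => rw [addLeft_hook]; exact .last _
  | addStrand _ ih => rw [addLeft_addStrand]; exact ih.addStrand

/-- The cup-cap in the last position is `jonesWenzl_comp_hook`; any other one is a cup-cap on fewer
strands, killed by the factor f_n ⊗ 1 that f_{n+1} absorbs. -/
theorem jonesWenzl_comp_isHook {n : ℕ} (hn : n ≤ k + 1) {g : strands k n ⟶ strands k n}
    (hg : IsHook g) : jonesWenzl k n ≫ g = 0 := by
  induction hg with
  | last n => exact jonesWenzl_comp_hook n (by omega)
  | @addStrand n g _ ih =>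
    rw [← jonesWenzl_comp_addStrand n (by omega), Category.assoc, ← addStrand_comp, ih (by omega)]
    exact (congrArg _ MonoidalPreadditive.zero_whiskerRight).trans Limits.comp_zero

/-! ### The idempotent modulo cup-caps -/

/-- The left ideal of the Temperley–Lieb algebra generated by the cup-caps. -/
def hookIdeal (k n : ℕ) : Submodule ℂ (strands k n ⟶ strands k n) :=
  Submodule.span ℂ {f | ∃ x g : strands k n ⟶ strands k n, IsHook g ∧ f = x ≫ g}

theorem comp_mem_hookIdeal {n : ℕ} (x : strands k n ⟶ strands k n) {f : strands k n ⟶ strands k n}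
    (hf : f ∈ hookIdeal k n) : x ≫ f ∈ hookIdeal k n := by
  induction hf using Submodule.span_induction with
  | mem f hf =>
    obtain ⟨y, g, hg, rfl⟩ := hf
    exact Submodule.subset_span ⟨x ≫ y, g, hg, (Category.assoc _ _ _).symm⟩
  | zero => rw [Limits.comp_zero]; exact zero_mem _
  | add f g _ _ hf hg => rw [Preadditive.comp_add]; exact add_mem hf hg
  | smul r f _ hf => rw [Linear.comp_smul]; exact Submodule.smul_mem _ r hf

theorem addStrand_mem_hookIdeal {n : ℕ} {f : strands k n ⟶ strands k n}
    (hf : f ∈ hookIdeal k n) : addStrand f ∈ hookIdeal k (n + 1) := by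
  induction hf using Submodule.span_induction with
  | mem f hf =>
    obtain ⟨y, g, hg, rfl⟩ := hf
    exact Submodule.subset_span ⟨addStrand y, addStrand g, hg.addStrand, addStrand_comp _ _⟩
  | zero =>
    have : addStrand (0 : strands k n ⟶ strands k n) = 0 := MonoidalPreadditive.zero_whiskerRight
    rw [this]; exact zero_mem _
  | add f g _ _ hf hg => rw [addStrand_add]; exact add_mem hf hg
  | smul r f _ hf => rw [addStrand_smul]; exact Submodule.smul_mem _ r hf

/-- In the recursion, the first term is 1 plus an element of the ideal by induction. In the second
term only the final f_{n+1} ⊗ 1 is expanded as 1 plus an ideal element: the 1 leaves a product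
ending in a cup-cap, the rest is a multiple of an ideal element. -/
theorem exists_jonesWenzl_eq (n : ℕ) : ∃ f ∈ hookIdeal k n, jonesWenzl k n = 𝟙 _ + f := by
  match n with
  | 0 => exact ⟨0, zero_mem _, (add_zero _).symm⟩
  | 1 => exact ⟨0, zero_mem _, (add_zero _).symm⟩
  | n + 2 =>
    obtain ⟨f, hf, e⟩ := exists_jonesWenzl_eq (n + 1)
    have e' : addStrand (jonesWenzl k (n + 1)) = 𝟙 _ + addStrand f := by
      rw [e, addStrand_add, addStrand_id]
    refine ⟨addStrand f + (qInt k (n + 1) / qInt k (n + 2)) •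
      (addStrand (jonesWenzl k (n + 1)) ≫ hook k n +
        (addStrand (jonesWenzl k (n + 1)) ≫ hook k n) ≫ addStrand f), ?_, ?_⟩
    · refine add_mem (addStrand_mem_hookIdeal hf) (Submodule.smul_mem _ _ (add_mem ?_ ?_))
      · exact Submodule.subset_span ⟨_, _, .last n, rfl⟩
      · exact comp_mem_hookIdeal _ (addStrand_mem_hookIdeal hf)
    · rw [← add_assoc, ← e', jonesWenzl]
      congr 2
      -- Only the factor after the cup-cap is expanded.
      nth_rewrite 2 [e']
      rw [Preadditive.comp_add, Preadditive.comp_add, Category.comp_id, Category.assoc]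

/-! ### Cup-caps pulled across the nested caps -/

/-- `g` on the left legs of the nested caps agrees with `h` on the right legs. -/
def IsMate {n : ℕ} (g h : strands k n ⟶ strands k n) : Prop :=
  g ▷ strands k n ≫ caps k n = strands k n ◁ h ≫ caps k n

/-- The extra cap is innermost: `g` and `h` act on the outer legs, so the idle strand is on the
right of `g` and on the left of `h`. -/
theorem IsMate.addStrand_addLeft {n : ℕ} {g h : strands k n ⟶ strands k n} (H : IsMate g h) :
    IsMate (addStrand g) (addLeft h) := by
  have e := nestEv_mate_outer (cap k) (caps k n) H
  have e' : (g ▷ strands k 1) ▷ (strands k n ⊗ strands k 1) ≫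
      (strands k n ⊗ strands k 1) ◁ (shift k n).inv ≫ nestEv (cap k) (caps k n) =
      (strands k n ⊗ strands k 1) ◁ ((shift k n).inv ≫ strands k 1 ◁ h ≫ (shift k n).hom) ≫
      (strands k n ⊗ strands k 1) ◁ (shift k n).inv ≫ nestEv (cap k) (caps k n) := by
    rw [← whisker_exchange_assoc, e, ← MonoidalCategory.whiskerLeft_comp_assoc,
      ← MonoidalCategory.whiskerLeft_comp_assoc]
    simp
  rw [IsMate, caps_succ]
  exact e'

theorem strands_pair (n : ℕ) :
    strands k (n + 2) = (strands k 1 ⊗ strands k 1) ⊗ strands k n :=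
  congrArg (strands k) (Nat.add_comm n 2)

/-- Describes the cup-cap in the first position without recursion. The renumberings are arbitrary,
so that the formula applies with whichever ones a computation produces. -/
theorem hookFirst_eq (n : ℕ) {a : strands k (n + 2) ⟶ (strands k 1 ⊗ strands k 1) ⊗ strands k n}
    {b : (strands k 1 ⊗ strands k 1) ⊗ strands k n ⟶ strands k (n + 2)} (ha : IsTransport a)
    (hb : IsTransport b) : hookFirst k n = a ≫ (cap k ≫ cup k) ▷ strands k n ≫ b := by
  induction n with
  | zero =>
    have h₁ : (cap k ≫ cup k) ▷ 𝟙_ (PreTL k) = (ρ_ _).hom ≫ (cap k ≫ cup k) ≫ (ρ_ _).inv := by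
      simp
    have h₂ : 𝟙_ (PreTL k) ◁ (cap k ≫ cup k) = (λ_ _).hom ≫ (cap k ≫ cup k) ≫ (λ_ _).inv := by
      simp
    refine Eq.trans h₂ (Eq.trans ?_ (congrArg (fun x => a ≫ x ≫ b) h₁.symm))
    exact (IsTransport.conj_eq _ ha (IsTransport.rightUnitor_hom _)
      (IsTransport.rightUnitor_inv _) hb (IsTransport.leftUnitor_hom _)
      (IsTransport.leftUnitor_inv _)).symm
  | succ n ih =>
    have h₁ : (cap k ≫ cup k) ▷ (strands k n ⊗ strands k 1) =
        (α_ _ _ _).inv ≫ ((cap k ≫ cup k) ▷ strands k n) ▷ strands k 1 ≫ (α_ _ _ _).hom := by simp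
    have h₂ := ih (IsTransport.eqToHom (strands_pair n)) (IsTransport.eqToHom (strands_pair n).symm)
    have h₃ : addStrand (hookFirst k n) = (eqToHom (strands_pair n)) ▷ strands k 1 ≫
        ((cap k ≫ cup k) ▷ strands k n) ▷ strands k 1 ≫
          (eqToHom (strands_pair n).symm) ▷ strands k 1 := by
      refine (congrArg addStrand h₂).trans ((addStrand_comp _ _).trans (congrArg _ ?_))
      exact addStrand_comp _ _
    refine h₃.trans (Eq.trans ?_ (congrArg (fun x => a ≫ x ≫ b) h₁.symm))
    exact (IsTransport.conj_eq _ ha (IsTransport.assoc_inv _ _ _)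
      (IsTransport.assoc_hom _ _ _) hb ((IsTransport.eqToHom _).wr _)
      ((IsTransport.eqToHom _).wr _)).symm

/-- Separates the two innermost caps, the only ones that a cup-cap on the last two left legs can
see. -/
theorem caps_add_two (n : ℕ)
    {a : strands k (n + 2) ⟶ strands k n ⊗ (strands k 1 ⊗ strands k 1)}
    {b : strands k (n + 2) ⟶ (strands k 1 ⊗ strands k 1) ⊗ strands k n}
    (ha : IsTransport a) (hb : IsTransport b) :
    caps k (n + 2) = a ▷ strands k (n + 2) ≫ _ ◁ b ≫
      nestEv (nestEv (cap k) (cap k)) (caps k n) := by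
  have h₁ : nestEv (cap k) (caps k (n + 1)) =
      ((strands k n ⊗ strands k 1) ⊗ strands k 1) ◁ (strands k 1 ◁ (shift k n).inv) ≫
      (α_ _ _ _).hom ▷ _ ≫ _ ◁ (α_ _ _ _).inv ≫
      nestEv (nestEv (cap k) (cap k)) (caps k n) := by
    have h := caps_succ (k := k) n
    have h' := nestEv_comp (cap k) (nestEv (cap k) (caps k n)) (shift k n).inv
    rw [nestEv_nestEv] at h'
    exact (congrArg (fun x => nestEv (cap k) x) h).trans h'
  have ha' : a = (α_ (strands k n) (strands k 1) (strands k 1)).hom :=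
    ha.unique (IsTransport.assoc_hom (strands k n) (strands k 1) (strands k 1))
  have hb' : b = (shift k (n + 1)).inv ≫ strands k 1 ◁ (shift k n).inv ≫
      (α_ (strands k 1) (strands k 1) (strands k n)).inv :=
    hb.unique ((isTransport_shift_inv _).comp (((isTransport_shift_inv _).wl _).comp
      (IsTransport.assoc_inv (strands k 1) (strands k 1) (strands k n))))
  rw [ha', hb']
  refine (caps_succ (n + 1)).trans ((congrArg (fun x => _ ≫ x) h₁).trans ?_)
  exact whisker_collect _ _ _ _ _

/-- The last two left legs and the first two right legs are the ends of the two innermost caps.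
`nestEv_zigzag` exchanges the cup-caps there, and the outer caps are spectators. -/
theorem isMate_hook (n : ℕ) : IsMate (hook k n) (hookFirst k n) := by
  have hb := IsTransport.eqToHom (strands_pair (k := k) n)
  have hb' := IsTransport.eqToHom (strands_pair (k := k) n).symm
  have H := nestEv_mate_inner (nestEv (cap k) (cap k)) (caps k n)
    (nestEv_zigzag (zigzag₁ (k := k)) zigzag₂)
  have h := mate_conj H (a := (α_ (strands k n) (strands k 1) (strands k 1)).hom) (a' := (α_ _ _ _).inv)
    (Iso.inv_hom_id _) (hb'.comp hb).eq_id
  have h₁ : hook k n = (α_ (strands k n) (strands k 1) (strands k 1)).hom ≫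
      strands k n ◁ (cap k ≫ cup k) ≫ (α_ (strands k n) (strands k 1) (strands k 1)).inv :=
    ((Category.id_comp _).trans (Category.comp_id _)).symm
  rw [IsMate, caps_add_two n (IsTransport.assoc_hom (strands k n) (strands k 1) (strands k 1)) hb, hookFirst_eq n hb hb']
  exact (congrArg (fun x => x ▷ strands k (n + 2) ≫ _) h₁).trans h

theorem IsHook.exists_mate {n : ℕ} {g : strands k n ⟶ strands k n} (hg : IsHook g) :
    ∃ h, IsHook h ∧ IsMate g h := by
  induction hg with
  | last n => exact ⟨_, isHook_hookFirst n, isMate_hook n⟩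
  | addStrand _ ih =>
    obtain ⟨h, hh, H⟩ := ih
    exact ⟨_, hh.addLeft, H.addStrand_addLeft⟩

theorem IsHookLeft.exists_mate {n : ℕ} {h : strands k n ⟶ strands k n} (hh : IsHookLeft h) :
    ∃ g, IsHook g ∧ IsMate g h := by
  induction hh with
  | first n => exact ⟨_, .last n, isMate_hook n⟩
  | addLeft _ ih =>
    obtain ⟨g, hg, H⟩ := ih
    exact ⟨_, hg.addStrand, H.addStrand_addLeft⟩

/-- Writing the left idempotent as 1 plus an ideal element, the 1 gives the right-hand side. This
avoids having to show that f_n is invariant under rotation by a half turn. -/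
theorem jonesWenzl_tensor_caps_right (n : ℕ) (hn : n ≤ k + 1) :
    (jonesWenzl k n ⊗ₘ jonesWenzl k n) ≫ caps k n = strands k n ◁ jonesWenzl k n ≫ caps k n := by
  obtain ⟨f, hf, e⟩ := exists_jonesWenzl_eq (k := k) n
  have key : f ▷ strands k n ≫ strands k n ◁ jonesWenzl k n ≫ caps k n = 0 := by
    clear e
    induction hf using Submodule.span_induction with
    | mem f hf =>
      obtain ⟨x, g, hg, rfl⟩ := hf
      obtain ⟨h, hh, H⟩ := hg.exists_mate
      -- In `x ≫ g` the cup-cap `g` can be brought next to the caps, because a left ideal is used.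
      -- Its mate `h` then comes right after the idempotent on the right legs, which kills it.
      rw [comp_whiskerRight, Category.assoc, ← whisker_exchange_assoc g, H,
        ← MonoidalCategory.whiskerLeft_comp_assoc, jonesWenzl_comp_isHook hn hh]
      simp
    | zero => simp
    | add f g _ _ hf hg => simp [hf, hg]
    | smul r f _ hf => simp [hf]
  rw [MonoidalCategory.tensorHom_def, Category.assoc]
  nth_rewrite 1 [e]
  rw [MonoidalPreadditive.add_whiskerRight, Preadditive.add_comp, key, add_zero, id_whiskerRight,
    Category.id_comp]

/-- The mirror argument needs mates in the other direction: a cup-cap on the right legs, described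
by growth on the left, is carried to the left legs. -/
theorem jonesWenzl_tensor_caps_left (n : ℕ) (hn : n ≤ k + 1) :
    (jonesWenzl k n ⊗ₘ jonesWenzl k n) ≫ caps k n = jonesWenzl k n ▷ strands k n ≫ caps k n := by
  obtain ⟨f, hf, e⟩ := exists_jonesWenzl_eq (k := k) n
  have key : strands k n ◁ f ≫ jonesWenzl k n ▷ strands k n ≫ caps k n = 0 := by
    clear e
    induction hf using Submodule.span_induction with
    | mem f hf =>
      obtain ⟨x, h, hh, rfl⟩ := hf
      obtain ⟨g, hg, H⟩ := hh.isHookLeft.exists_mate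
      rw [MonoidalCategory.whiskerLeft_comp, Category.assoc, whisker_exchange_assoc _ h, ← H,
        ← comp_whiskerRight_assoc, jonesWenzl_comp_isHook hn hg]
      simp
    | zero => simp
    | add f g _ _ hf hg => simp [hf, hg]
    | smul r f _ hf => simp [hf]
  rw [MonoidalCategory.tensorHom_def', Category.assoc]
  nth_rewrite 1 [e]
  rw [MonoidalPreadditive.whiskerLeft_add, Preadditive.add_comp, key, add_zero,
    MonoidalCategory.whiskerLeft_id, Category.id_comp]

end PreTL

/-! ### One-by-one matrices in the additive completion -/

section MatrixEntries
universe v u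
variable {C : Type u} [Category.{v} C] [Preadditive C]

theorem mat_comp_apply {M N K : Mat_ C} (hN : Subsingleton N.ι) (f : M ⟶ N) (g : N ⟶ K) (i : M.ι)
    (j : N.ι) (l : K.ι) : (f ≫ g) i l = f i j ≫ g j l := by
  change ∑ j, f i j ≫ g j l = _
  exact Fintype.sum_subsingleton _ j

/-- With a single intermediate index the sum in a matrix product has one term, so entries of long
composites can be read off factor by factor. -/
theorem mat_comp_eq {M N K : Mat_ C} (hN : Subsingleton N.ι) {f : M ⟶ N} {g : N ⟶ K} {i : M.ι}
    (j : N.ι) {l : K.ι} {a : M.X i ⟶ N.X j} {b : N.X j ⟶ K.X l} (hf : f i j = a) (hg : g j l = b) :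
    (f ≫ g) i l = a ≫ b := by
  rw [mat_comp_apply hN f g i j l, hf, hg]

theorem relabelInv_apply {M N : Mat_ C} (e : M.ι ≃ N.ι) (φ : ∀ i, M.X i ≅ N.X (e i)) (i : M.ι) :
    relabelInv e φ (e i) i = (φ i).inv := by simp [relabelInv]

variable [MonoidalCategory C]

theorem subsingleton_tensor {M N : Mat_ C} (hM : Subsingleton M.ι) (hN : Subsingleton N.ι) :
    Subsingleton (M ⊗ N).ι := inferInstanceAs (Subsingleton (M.ι × N.ι))

theorem subsingleton_unit : Subsingleton (𝟙_ (Mat_ C)).ι := inferInstanceAs (Subsingleton PUnit)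

theorem mat_whiskerRight_apply [MonoidalPreadditive C] {M N : Mat_ C} (f : M ⟶ N) (K : Mat_ C)
    (i : M.ι) (j : N.ι) (l : K.ι) : (f ▷ K : M ⊗ K ⟶ N ⊗ K) (i, l) (j, l) = f i j ▷ K.X l :=
  (congrArg (fun x => f i j ⊗ₘ x) (Mat_.id_apply_self K l)).trans (tensorHom_id _ _)

theorem mat_whiskerLeft_apply [MonoidalPreadditive C] {M N : Mat_ C} (K : Mat_ C) (f : M ⟶ N)
    (i : M.ι) (j : N.ι) (l : K.ι) : (K ◁ f : K ⊗ M ⟶ K ⊗ N) (l, i) (l, j) = K.X l ◁ f i j :=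
  (congrArg (fun x => x ⊗ₘ f i j) (Mat_.id_apply_self K l)).trans (id_tensorHom _ _)

variable [MonoidalPreadditive C] [BraidedCategory C] {M : Mat_ C}

/-- Every object in the definition of the curl has a single index, and the structural isomorphisms
of the completion have those of the base category as their entries. -/
theorem leftCurl_apply (hM : Subsingleton M.ι) (e : M ⊗ M ⟶ 𝟙_ (Mat_ C))
    (c : 𝟙_ (Mat_ C) ⟶ M ⊗ M) (i : M.ι) (u : (𝟙_ (Mat_ C)).ι) :
    leftCurl e c i i = leftCurl (X := M.X i) (Y := M.X i) (e (i, i) u) (c u (i, i)) := by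
  have hMM := subsingleton_tensor hM hM
  have h₁ : (λ_ M).inv i (u, i) = (λ_ (M.X i)).inv :=
    relabelInv_apply (M := matTensor matUnit M) (Equiv.punitProd _) (fun p => λ_ (M.X p.2)) (u, i)
  have h₂ : (λ_ M).hom (u, i) i = (λ_ (M.X i)).hom :=
    relabel_apply (M := matTensor matUnit M) (Equiv.punitProd _) (fun p => λ_ (M.X p.2)) (u, i)
  have h₃ : (α_ M M M).hom ((i, i), i) (i, (i, i)) = (α_ (M.X i) (M.X i) (M.X i)).hom :=
    relabel_apply (M := matTensor (matTensor M M) M) (N := matTensor M (matTensor M M))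
      (Equiv.prodAssoc _ _ _) (fun p => α_ (M.X p.1.1) (M.X p.1.2) (M.X p.2)) ((i, i), i)
  have h₄ : (α_ M M M).inv (i, (i, i)) ((i, i), i) = (α_ (M.X i) (M.X i) (M.X i)).inv :=
    relabelInv_apply (M := matTensor (matTensor M M) M) (N := matTensor M (matTensor M M))
      (Equiv.prodAssoc _ _ _) (fun p => α_ (M.X p.1.1) (M.X p.1.2) (M.X p.2)) ((i, i), i)
  have h₅ : (β_ M M).hom (i, i) (i, i) = (β_ (M.X i) (M.X i)).hom :=
    relabel_apply (M := matTensor M M) (N := matTensor M M) (Equiv.prodComm _ _)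
      (fun p => β_ (M.X p.1) (M.X p.2)) (i, i)
  exact mat_comp_eq (subsingleton_tensor subsingleton_unit hM) (u, i) h₁
    (mat_comp_eq (subsingleton_tensor hMM hM) ((i, i), i) (mat_whiskerRight_apply c M u (i, i) i)
    (mat_comp_eq (subsingleton_tensor hM hMM) (i, (i, i)) h₃
    (mat_comp_eq (subsingleton_tensor hM hMM) (i, (i, i))
      ((mat_whiskerLeft_apply M (β_ M M).hom (i, i) (i, i) i).trans (congrArg _ h₅))
    (mat_comp_eq (subsingleton_tensor hMM hM) ((i, i), i) h₄
    (mat_comp_eq (subsingleton_tensor subsingleton_unit hM) (u, i)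
      (mat_whiskerRight_apply e M (i, i) u i) h₂)))))

theorem rightCurl_apply (hM : Subsingleton M.ι) (e : M ⊗ M ⟶ 𝟙_ (Mat_ C))
    (c : 𝟙_ (Mat_ C) ⟶ M ⊗ M) (i : M.ι) (u : (𝟙_ (Mat_ C)).ι) :
    rightCurl e c i i = rightCurl (X := M.X i) (Y := M.X i) (e (i, i) u) (c u (i, i)) := by
  have hMM := subsingleton_tensor hM hM
  have h₁ : (ρ_ M).inv i (i, u) = (ρ_ (M.X i)).inv :=
    relabelInv_apply (M := matTensor M matUnit) (Equiv.prodPUnit _) (fun p => ρ_ (M.X p.1)) (i, u)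
  have h₂ : (ρ_ M).hom (i, u) i = (ρ_ (M.X i)).hom :=
    relabel_apply (M := matTensor M matUnit) (Equiv.prodPUnit _) (fun p => ρ_ (M.X p.1)) (i, u)
  have h₃ : (α_ M M M).hom ((i, i), i) (i, (i, i)) = (α_ (M.X i) (M.X i) (M.X i)).hom :=
    relabel_apply (M := matTensor (matTensor M M) M) (N := matTensor M (matTensor M M))
      (Equiv.prodAssoc _ _ _) (fun p => α_ (M.X p.1.1) (M.X p.1.2) (M.X p.2)) ((i, i), i)
  have h₄ : (α_ M M M).inv (i, (i, i)) ((i, i), i) = (α_ (M.X i) (M.X i) (M.X i)).inv :=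
    relabelInv_apply (M := matTensor (matTensor M M) M) (N := matTensor M (matTensor M M))
      (Equiv.prodAssoc _ _ _) (fun p => α_ (M.X p.1.1) (M.X p.1.2) (M.X p.2)) ((i, i), i)
  have h₅ : (β_ M M).hom (i, i) (i, i) = (β_ (M.X i) (M.X i)).hom :=
    relabel_apply (M := matTensor M M) (N := matTensor M M) (Equiv.prodComm _ _)
      (fun p => β_ (M.X p.1) (M.X p.2)) (i, i)
  exact mat_comp_eq (subsingleton_tensor hM subsingleton_unit) (i, u) h₁
    (mat_comp_eq (subsingleton_tensor hM hMM) (i, (i, i)) (mat_whiskerLeft_apply M c u (i, i) i)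
    (mat_comp_eq (subsingleton_tensor hMM hM) ((i, i), i) h₄
    (mat_comp_eq (subsingleton_tensor hMM hM) ((i, i), i)
      ((mat_whiskerRight_apply (β_ M M).hom M (i, i) (i, i) i).trans
        (congrArg (fun x => x ▷ M.X i) h₅))
    (mat_comp_eq (subsingleton_tensor hM hMM) (i, (i, i)) h₃
    (mat_comp_eq (subsingleton_tensor hM subsingleton_unit) (i, u)
      (mat_whiskerLeft_apply M e (i, i) u i) h₂)))))

end MatrixEntries

/-! ### Twists in a quotient by a tensor ideal -/

section QuotientTwist
universe v u
variable {C : Type u} [Category.{v} C] [Preadditive C] [Linear ℂ C] [MonoidalCategory C]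
  [MonoidalPreadditive C] [MonoidalLinear ℂ C] [BraidedCategory C] {A B : C} (g : A ⟶ B) {X : C}

/-- The projection is strictly monoidal and braided, since the structure of the quotient is defined
as the image of the original one. -/
theorem leftTwist_toQuot (e : X ⊗ X ⟶ 𝟙_ C) (c : 𝟙_ C ⟶ X ⊗ X) :
    leftTwist (C := TensorQuotient g) (X := (toQuot g).obj X) ((toQuot g).map e) ((toQuot g).map c)
      (Iso.refl _) = (toQuot g).map (leftTwist e c (Iso.refl _)) := by
  simp only [leftTwist, Functor.map_comp]
  rw [← toQuot_tensor g (Iso.refl X).hom (β_ X X).hom]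
  rfl

theorem rightTwist_toQuot (e : X ⊗ X ⟶ 𝟙_ C) (c : 𝟙_ C ⟶ X ⊗ X) :
    rightTwist (C := TensorQuotient g) (X := (toQuot g).obj X) ((toQuot g).map e) ((toQuot g).map c)
      (Iso.refl _) = (toQuot g).map (rightTwist e c (Iso.refl _)) := by
  simp only [rightTwist, Functor.map_comp]
  rw [← toQuot_tensor g (β_ X X).hom (Iso.refl X).inv]
  rfl

end QuotientTwist

/-! ### The twists of F_j -/

namespace TL
variable {k : ℕ}

theorem subsingleton_strands (j : ℕ) : Subsingleton (strands k j).ι :=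
  inferInstanceAs (Subsingleton PUnit)

/-- The Jones–Wenzl idempotent as a morphism of the additive completion. -/
abbrev jonesWenzlMat (k j : ℕ) : strands k j ⟶ strands k j :=
  (Mat_.embedding (PreTL k)).map (PreTL.jonesWenzl k j)

theorem jonesWenzlMat_idem (j : ℕ) (hj : j ≤ k + 1) :
    jonesWenzlMat k j ≫ jonesWenzlMat k j = jonesWenzlMat k j :=
  (jonesWenzlObj k j hj).idem

theorem jonesWenzlMat_comp_leftCurl (j : ℕ) (hj : j ≤ k + 1) :
    jonesWenzlMat k j ≫ leftCurl (caps k j) (cups k j) =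
      ((-1) ^ j * rootT k ^ (j ^ 2 + 2 * j)) • jonesWenzlMat k j := by
  refine Mat_.hom_ext _ _ fun i i' => ?_
  rw [mat_comp_apply (subsingleton_strands j) _ _ i i' i',
    leftCurl_apply (subsingleton_strands j) _ _ i' PUnit.unit]
  exact PreTL.jonesWenzl_comp_leftCurl j hj

theorem jonesWenzlMat_comp_rightCurl (j : ℕ) (hj : j ≤ k + 1) :
    jonesWenzlMat k j ≫ rightCurl (caps k j) (cups k j) =
      ((-1) ^ j * rootT k ^ (j ^ 2 + 2 * j)) • jonesWenzlMat k j := by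
  refine Mat_.hom_ext _ _ fun i i' => ?_
  rw [mat_comp_apply (subsingleton_strands j) _ _ i i' i',
    rightCurl_apply (subsingleton_strands j) _ _ i' PUnit.unit]
  exact PreTL.jonesWenzl_comp_rightCurl j hj

theorem jonesWenzlMat_tensor_caps_right (j : ℕ) (hj : j ≤ k + 1) :
    (jonesWenzlMat k j ⊗ₘ jonesWenzlMat k j) ≫ caps k j =
      strands k j ◁ jonesWenzlMat k j ≫ caps k j := by
  have hs := subsingleton_tensor (subsingleton_strands (k := k) j) (subsingleton_strands (k := k) j)
  refine Mat_.hom_ext _ _ fun i i' => ?_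
  have h₁ := mat_comp_apply hs (jonesWenzlMat k j ⊗ₘ jonesWenzlMat k j) (caps k j) i i i'
  have h₂ := (mat_comp_apply hs (strands k j ◁ jonesWenzlMat k j) (caps k j) i i i').trans
    (congrArg (fun x => x ≫ caps k j i i') (mat_whiskerLeft_apply (strands k j) (jonesWenzlMat k j) i.2 i.2 i.1))
  exact h₁.trans ((PreTL.jonesWenzl_tensor_caps_right j hj).trans h₂.symm)

theorem jonesWenzlMat_tensor_caps_left (j : ℕ) (hj : j ≤ k + 1) :
    (jonesWenzlMat k j ⊗ₘ jonesWenzlMat k j) ≫ caps k j =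
      jonesWenzlMat k j ▷ strands k j ≫ caps k j := by
  have hs := subsingleton_tensor (subsingleton_strands (k := k) j) (subsingleton_strands (k := k) j)
  refine Mat_.hom_ext _ _ fun i i' => ?_
  have h₁ := mat_comp_apply hs (jonesWenzlMat k j ⊗ₘ jonesWenzlMat k j) (caps k j) i i i'
  have h₂ := (mat_comp_apply hs (jonesWenzlMat k j ▷ strands k j) (caps k j) i i i').trans
    (congrArg (fun x => x ≫ caps k j i i') (mat_whiskerRight_apply (jonesWenzlMat k j) (strands k j) i.1 i.1 i.2))
  exact h₁.trans ((PreTL.jonesWenzl_tensor_caps_left j hj).trans h₂.symm)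

/-- The twist is p ∘ curl ∘ p, the curl acts on p by the scalar, and p ∘ p = p is the identity of
F_j in the idempotent completion. -/
theorem leftTwist_jonesWenzlObj (j : ℕ) (hj : j ≤ k + 1) :
    leftTwist (ev k j hj) (coev k j hj) (Iso.refl _) =
      ((-1) ^ j * rootT k ^ (j ^ 2 + 2 * j)) • 𝟙 (jonesWenzlObj k j hj) := by
  refine Idempotents.Karoubi.hom_ext _ _ ((leftTwist_compress (jonesWenzlObj k j hj) (caps k j)
    (cups k j) (jonesWenzlMat_tensor_caps_right j hj)).trans ?_)
  have h := congrArg (fun x => x ≫ jonesWenzlMat k j) (jonesWenzlMat_comp_leftCurl j hj)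
  refine (Category.assoc _ _ _).symm.trans (h.trans ?_)
  exact (Linear.smul_comp _ _ _ _ _ _).trans (congrArg _ (jonesWenzlMat_idem j hj))

theorem rightTwist_jonesWenzlObj (j : ℕ) (hj : j ≤ k + 1) :
    rightTwist (ev k j hj) (coev k j hj) (Iso.refl _) =
      ((-1) ^ j * rootT k ^ (j ^ 2 + 2 * j)) • 𝟙 (jonesWenzlObj k j hj) := by
  refine Idempotents.Karoubi.hom_ext _ _ ((rightTwist_compress (jonesWenzlObj k j hj) (caps k j)
    (cups k j) (jonesWenzlMat_tensor_caps_left j hj)).trans ?_)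
  have h := congrArg (fun x => x ≫ jonesWenzlMat k j) (jonesWenzlMat_comp_rightCurl j hj)
  refine (Category.assoc _ _ _).symm.trans (h.trans ?_)
  exact (Linear.smul_comp _ _ _ _ _ _).trans (congrArg _ (jonesWenzlMat_idem j hj))

end TL
end
end TLJ

theorem lemma3p19 (k : ℕ) (hk : 1 ≤ k) (j : ℕ) (hj : j ≤ k + 1) :
    TLJ.leftTwist (TLJ.ReducedTL.ev k j hj) (TLJ.ReducedTL.coev k j hj) (Iso.refl _) =
        ((-1) ^ j * TLJ.rootT k ^ (j ^ 2 + 2 * j)) • 𝟙 (TLJ.ReducedTL.jonesWenzlObj k j hj) ∧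
      TLJ.rightTwist (TLJ.ReducedTL.ev k j hj) (TLJ.ReducedTL.coev k j hj) (Iso.refl _) =
        ((-1) ^ j * TLJ.rootT k ^ (j ^ 2 + 2 * j)) • 𝟙 (TLJ.ReducedTL.jonesWenzlObj k j hj) :=
  -- The equalities of `TL` are projected to the quotient.
  ⟨(TLJ.leftTwist_toQuot _ _ _).trans
      (congrArg (TLJ.ReducedTL.proj k).map (TLJ.TL.leftTwist_jonesWenzlObj j hj)),
    (TLJ.rightTwist_toQuot _ _ _).trans
      (congrArg (TLJ.ReducedTL.proj k).map (TLJ.TL.rightTwist_jonesWenzlObj j hj))⟩
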